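/- Let $(A,\Delta)$ be a multiplier Hopf $^*$-algebra (in the sense of Van Daele) over $\mathbb{C}$ with antipode $S$, and assume that it has a positive left integral $\varphi$, i.e. a non-zero linear functional with $\varphi(a^*a)\ge 0$ and $(\iota\otimes\varphi)\Delta(a)=\varphi(a)1$ for all $a\in A$. Let $B=\hat A=\{\varphi(\,\cdot\,a) : a\in A\}$ be the dual of $A$, with the product dual to $\Delta$, $(bb')(x)=(b\otimes b')\Delta(x)$, and with the comultiplication $\Delta_B$ opposite to the one that is dual to the product of $A$, so that $\langle x\otimes y,\Delta_B(b)\rangle=\langle yx,b\rangle$. Here $\langle a,b\rangle=b(a)$ for $a\in A$, $b\in B$. Then $(B,\Delta_B)$ is a multiplier Hopf algebra; its antipode is also denoted by $S$. Define $\pi(a)x=ax$ and $\lambda(b)x=\langle S^{-1}(x_{(1)}),b\rangle x_{(2)}$ for $a,x\in A$ and $b\in B$. Via $\pi\otimes\lambda$ the algebra $A\otimes B$ acts on $A\otimes A$; this action is non-degenerate and therefore extends uniquely to an action of the multiplier algebra $M(A\otimes B)$. The pairing $\langle a'\otimes b',b\otimes a\rangle=\langle a',b\rangle\langle a,b'\rangle$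 of $A\otimes B$ with $B\otimes A$ extends to $M(A\otimes B)$ by $\langle m,b\otimes a\rangle=\langle m(e\otimes f),b\otimes a\rangle$, where $e\in A$ and $f\in B$ are any elements with $\langle a'e,b\rangle=\langle a',b\rangle$ for all $a'\in A$ and $\langle a,b'f\rangle=\langle a,b'\rangle$ for all $b'\in B$; such elements exist, the value does not depend on their choice, and it is bilinear in $m$ and $b\otimes a$. Let $V$ be the bijective linear map from $A\otimes A$ to itself given by $V(x\otimes x')=\Delta(x')(x\otimes 1)$, and let $W=V^{-1}$. Then $W$ is the action of an invertible multiplier in $M(A\otimes B)$, again denoted by $W$, and $W^{-1}\in M(A\otimes B)$ acts on $A\otimes A$ as $V$. Moreover, for all $a\in A$ and $b\in B$, $$\langle W,b\otimes a\rangle=\langle a,b\rangle ,\qquad \langle W^{-1},b\otimes a\rangle=\langle S(a),b\rangle=\langle a,S^{-1}(b)\rangle .$$ -/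

import Mathlib

open scoped TensorProduct ComplexOrder

noncomputable section

/-! ### Multipliers of an algebra over `ℂ` -/

section Multipliers

variable (R : Type*) [NonUnitalRing R] [Module ℂ R] [IsScalarTower ℂ R R] [SMulCommClass ℂ R R]

/-- The multiplier algebra of `R`: pairs `(L, P)` of linear maps, thought of as
`L x = m x` and `P x = x m`, such that `L (x y) = L x * y`, `P (x y) = x * P y` and
`P x * y = x * L y`. The product is `(L, P) (L', P') = (L ∘ L', P' ∘ P)`. -/
def multiplierSubalgebra : Subalgebra ℂ (Module.End ℂ R × (Module.End ℂ R)ᵐᵒᵖ) where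
  carrier := {p | (∀ x y, p.1 (x * y) = p.1 x * y) ∧
    (∀ x y, p.2.unop (x * y) = x * p.2.unop y) ∧ ∀ x y, p.2.unop x * y = x * p.1 y}
  mul_mem' := by
    rintro p q ⟨h1, h2, h3⟩ ⟨k1, k2, k3⟩
    refine ⟨fun x y => ?_, fun x y => ?_, fun x y => ?_⟩
    · simp [h1, k1]
    · simp [h2, k2]
    · simp [h3, k3]
  add_mem' := by
    rintro p q ⟨h1, h2, h3⟩ ⟨k1, k2, k3⟩
    refine ⟨fun x y => ?_, fun x y => ?_, fun x y => ?_⟩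
    · simp [h1, k1, add_mul]
    · simp [h2, k2, mul_add]
    · simp [h3, k3, add_mul, mul_add]
  algebraMap_mem' := by
    intro r
    refine ⟨fun x y => ?_, fun x y => ?_, fun x y => ?_⟩
    · simp [Prod.algebraMap_apply, Module.algebraMap_end_apply, smul_mul_assoc]
    · simp [Prod.algebraMap_apply, Module.algebraMap_end_apply, mul_smul_comm]
    · simp [Prod.algebraMap_apply, Module.algebraMap_end_apply, smul_mul_assoc, mul_smul_comm]

/-- The multiplier algebra `M(R)`, a unital algebra over `ℂ`. -/
abbrev Multiplier : Type _ := multiplierSubalgebra R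

end Multipliers

namespace Multiplier

section

variable {R : Type*} [NonUnitalRing R] [Module ℂ R] [IsScalarTower ℂ R R] [SMulCommClass ℂ R R]

/-- `x ↦ m x`. -/
def left (m : Multiplier R) : R →ₗ[ℂ] R := m.1.1

/-- `x ↦ x m`. -/
def right (m : Multiplier R) : R →ₗ[ℂ] R := m.1.2.unop

theorem left_mul (m : Multiplier R) (x y : R) : m.left (x * y) = m.left x * y := m.2.1 x y

theorem right_mul (m : Multiplier R) (x y : R) : m.right (x * y) = x * m.right y := m.2.2.1 x y

theorem balanced (m : Multiplier R) (x y : R) : m.right x * y = x * m.left y := m.2.2.2 x y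

theorem left_mul_apply (m n : Multiplier R) (x : R) : (m * n).left x = m.left (n.left x) := rfl

theorem right_mul_apply (m n : Multiplier R) (x : R) : (m * n).right x = n.right (m.right x) := rfl

theorem ext' {m n : Multiplier R} (h : ∀ x, m.left x = n.left x)
    (k : ∀ x, m.right x = n.right x) : m = n := by
  apply Subtype.ext
  refine Prod.ext (LinearMap.ext h) ?_
  exact MulOpposite.unop_injective (LinearMap.ext k)

/-- The canonical map `R → M(R)`. -/
def ofElem (z : R) : Multiplier R :=
  ⟨(LinearMap.mulLeft ℂ z, MulOpposite.op (LinearMap.mulRight ℂ z)),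
    fun x y => by simp [mul_assoc], fun x y => by simp [mul_assoc],
    fun x y => by simp [mul_assoc]⟩

@[simp] theorem left_ofElem (z x : R) : (ofElem z).left x = z * x := rfl

@[simp] theorem right_ofElem (z x : R) : (ofElem z).right x = x * z := rfl

theorem mul_ofElem (m : Multiplier R) (z : R) : m * ofElem z = ofElem (m.left z) :=
  ext' (fun x => by simp [left_mul_apply, left_mul])
    (fun x => by simp [right_mul_apply, balanced])

theorem ofElem_mul (m : Multiplier R) (z : R) : ofElem z * m = ofElem (m.right z) :=
  ext' (fun x => by simp [left_mul_apply, balanced])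
    (fun x => by simp [right_mul_apply, right_mul])

end

section Legs

variable {A : Type*} [NonUnitalRing A] [Module ℂ A] [IsScalarTower ℂ A A] [SMulCommClass ℂ A A]

/-- The multiplier `a ⊗ 1` of `A ⊗ A`. -/
def inl (a : A) : Multiplier (A ⊗[ℂ] A) :=
  ⟨((LinearMap.mulLeft ℂ a).rTensor A, MulOpposite.op ((LinearMap.mulRight ℂ a).rTensor A)), by
    refine ⟨fun x y => ?_, fun x y => ?_, fun x y => ?_⟩ <;>
    · induction x with
      | zero => simp
      | add x x' hx hx' => simp only [add_mul, map_add, hx, hx']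
      | tmul p q =>
        induction y with
        | zero => simp
        | add y y' hy hy' => simp only [mul_add, map_add, hy, hy']
        | tmul r s => simp [mul_assoc]⟩

/-- The multiplier `1 ⊗ a` of `A ⊗ A`. -/
def inr (a : A) : Multiplier (A ⊗[ℂ] A) :=
  ⟨((LinearMap.mulLeft ℂ a).lTensor A, MulOpposite.op ((LinearMap.mulRight ℂ a).lTensor A)), by
    refine ⟨fun x y => ?_, fun x y => ?_, fun x y => ?_⟩ <;>
    · induction x with
      | zero => simp
      | add x x' hx hx' => simp only [add_mul, map_add, hx, hx']
      | tmul p q =>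
        induction y with
        | zero => simp
        | add y y' hy hy' => simp only [mul_add, map_add, hy, hy']
        | tmul r s => simp [mul_assoc]⟩

theorem left_inl (a : A) : (inl a).left = (LinearMap.mulLeft ℂ a).rTensor A := rfl
theorem right_inl (a : A) : (inl a).right = (LinearMap.mulRight ℂ a).rTensor A := rfl
theorem left_inr (a : A) : (inr a).left = (LinearMap.mulLeft ℂ a).lTensor A := rfl
theorem right_inr (a : A) : (inr a).right = (LinearMap.mulRight ℂ a).lTensor A := rfl

theorem inl_mul_inr (a b : A) : inl a * inr b = ofElem (a ⊗ₜ[ℂ] b) := by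
  refine ext' (fun x => ?_) (fun x => ?_) <;>
  · induction x with
    | zero => simp
    | add x y hx hy => simp only [map_add, hx, hy]
    | tmul p q => simp [left_mul_apply, right_mul_apply, left_inl, left_inr, right_inl, right_inr]

theorem inr_mul_inl (a b : A) : inr b * inl a = ofElem (a ⊗ₜ[ℂ] b) := by
  refine ext' (fun x => ?_) (fun x => ?_) <;>
  · induction x with
    | zero => simp
    | add x y hx hy => simp only [map_add, hx, hy]
    | tmul p q => simp [left_mul_apply, right_mul_apply, left_inl, left_inr, right_inl, right_inr]

end Legs

section Star

variable {A : Type*} [NonUnitalRing A] [StarRing A] [Module ℂ A] [IsScalarTower ℂ A A]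
  [SMulCommClass ℂ A A] [StarModule ℂ A]

theorem star_tensor_mul (x y : A ⊗[ℂ] A) : star (x * y) = star y * star x := by
  induction x with
  | zero => simp
  | add x x' hx hx' => simp only [add_mul, mul_add, star_add, hx, hx']
  | tmul p q =>
    induction y with
    | zero => simp
    | add y y' hy hy' => simp only [mul_add, add_mul, star_add, hy, hy']
    | tmul r s => simp

/-- The linear map `x ↦ (f (x*))*` on `A ⊗ A`. -/
def conjMap (f : A ⊗[ℂ] A →ₗ[ℂ] A ⊗[ℂ] A) : A ⊗[ℂ] A →ₗ[ℂ] A ⊗[ℂ] A where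
  toFun x := star (f (star x))
  map_add' x y := by simp
  map_smul' c x := by simp

/-- The involution of `M(A ⊗ A)`: `m* x = (x* m)*` and `x m* = (m x*)*`. -/
instance : Star (Multiplier (A ⊗[ℂ] A)) where
  star m := ⟨(conjMap m.right, MulOpposite.op (conjMap m.left)), by
    refine ⟨fun x y => ?_, fun x y => ?_, fun x y => ?_⟩
    · simp [conjMap, star_tensor_mul, right_mul]
    · simp [conjMap, star_tensor_mul, left_mul]
    · apply star_injective
      simp [conjMap, star_tensor_mul, balanced]⟩

theorem left_star (m : Multiplier (A ⊗[ℂ] A)) (x : A ⊗[ℂ] A) :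
    (star m).left x = star (m.right (star x)) := rfl

theorem right_star (m : Multiplier (A ⊗[ℂ] A)) (x : A ⊗[ℂ] A) :
    (star m).right x = star (m.left (star x)) := rfl

theorem star_comp (m n : Multiplier (A ⊗[ℂ] A)) : star (m * n) = star n * star m :=
  ext' (fun x => by simp [left_star, left_mul_apply, right_mul_apply])
    (fun x => by simp [right_star, left_mul_apply, right_mul_apply])

theorem star_ofElem (z : A ⊗[ℂ] A) : star (ofElem z) = ofElem (star z) :=
  ext' (fun x => by simp [left_star, star_tensor_mul])
    (fun x => by simp [right_star, star_tensor_mul])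

theorem star_inl (a : A) : star (inl a) = inl (star a) := by
  refine ext' (fun x => ?_) (fun x => ?_)
  · rw [left_star, right_inl, left_inl]
    induction x with
    | zero => simp
    | add x y hx hy => simp only [star_add, map_add, hx, hy]
    | tmul p q => simp
  · rw [right_star, right_inl, left_inl]
    induction x with
    | zero => simp
    | add x y hx hy => simp only [star_add, map_add, hx, hy]
    | tmul p q => simp

end Star

end Multiplier

open Multiplier

/-! ### Multiplier Hopf algebras -/

section Slices

variable {M N : Type*} [AddCommGroup M] [Module ℂ M] [AddCommGroup N] [Module ℂ N]

/-- The slice map `f ⊗ ι : M ⊗ N → N`. -/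
def sliceL (f : Module.Dual ℂ M) : M ⊗[ℂ] N →ₗ[ℂ] N :=
  (TensorProduct.lid ℂ N).toLinearMap ∘ₗ f.rTensor N

/-- The slice map `ι ⊗ f : M ⊗ N → M`. -/
def sliceR (f : Module.Dual ℂ N) : M ⊗[ℂ] N →ₗ[ℂ] M :=
  (TensorProduct.rid ℂ M).toLinearMap ∘ₗ f.lTensor M

/-- The functional `f ⊗ g` on `M ⊗ N`. -/
def tensorFun (f : Module.Dual ℂ M) (g : Module.Dual ℂ N) : Module.Dual ℂ (M ⊗[ℂ] N) :=
  TensorProduct.dualDistrib ℂ M N (f ⊗ₜ[ℂ] g)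

@[simp] theorem sliceL_tmul (f : Module.Dual ℂ M) (m : M) (n : N) :
    sliceL f (m ⊗ₜ[ℂ] n) = f m • n := by simp [sliceL]

@[simp] theorem sliceR_tmul (f : Module.Dual ℂ N) (m : M) (n : N) :
    sliceR f (m ⊗ₜ[ℂ] n) = f n • m := by simp [sliceR]

@[simp] theorem tensorFun_tmul (f : Module.Dual ℂ M) (g : Module.Dual ℂ N) (m : M) (n : N) :
    tensorFun f g (m ⊗ₜ[ℂ] n) = f m * g n := by simp [tensorFun]

end Slices

section Algebra

variable (A : Type*) [NonUnitalRing A] [Module ℂ A] [IsScalarTower ℂ A A] [SMulCommClass ℂ A A]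

/-- A multiplier Hopf algebra over `ℂ`: an algebra with a non-degenerate product and a
comultiplication `Δ : A → M(A ⊗ A)`, such that `a ⊗ a' ↦ Δ(a)(1 ⊗ a')` and
`a ⊗ a' ↦ (a ⊗ 1)Δ(a')` are bijective maps `T₁`, `T₂` of `A ⊗ A` onto itself. (The maps `T₁`
and `T₂` are determined by `Δ`.) -/
structure MultiplierHopfAlgebra where
  nondeg_left : ∀ a : A, (∀ b, a * b = 0) → a = 0
  nondeg_right : ∀ a : A, (∀ b, b * a = 0) → a = 0
  Δ : A →ₙₐ[ℂ] Multiplier (A ⊗[ℂ] A)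
  T₁ : A ⊗[ℂ] A ≃ₗ[ℂ] A ⊗[ℂ] A
  T₂ : A ⊗[ℂ] A ≃ₗ[ℂ] A ⊗[ℂ] A
  T₁_spec : ∀ a a', Δ a * inr a' = ofElem (T₁ (a ⊗ₜ[ℂ] a'))
  T₂_spec : ∀ a a', inl a * Δ a' = ofElem (T₂ (a ⊗ₜ[ℂ] a'))
  /-- `Δ` is non-degenerate: `Δ(A)(A ⊗ A) = A ⊗ A`. -/
  nondeg_comul : Submodule.span ℂ {z | ∃ a y, (Δ a).left y = z} = ⊤
  /-- Coassociativity `(Δ ⊗ ι)Δ(b) = (ι ⊗ Δ)Δ(b)`, multiplied by `a ⊗ 1 ⊗ 1` on the left and by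
  `1 ⊗ 1 ⊗ c` on the right:
  `(a ⊗ 1 ⊗ 1) (Δ ⊗ ι)(Δ(b)(1 ⊗ c)) = (ι ⊗ Δ)((a ⊗ 1)Δ(b)) (1 ⊗ 1 ⊗ c)`. -/
  coassoc : ∀ a b c,
    T₂.toLinearMap.rTensor A ((TensorProduct.assoc ℂ A A A).symm (a ⊗ₜ[ℂ] T₁ (b ⊗ₜ[ℂ] c))) =
      (TensorProduct.assoc ℂ A A A).symm
        (T₁.toLinearMap.lTensor A (TensorProduct.assoc ℂ A A A (T₂ (a ⊗ₜ[ℂ] b) ⊗ₜ[ℂ] c)))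

variable {A}

/-- `ε` is the counit: `(ε ⊗ ι)Δ(a) = a` and `(ι ⊗ ε)Δ(a) = a`, read in `M(A)`. The first
formula determines `ε`, since `T₁` is surjective. -/
structure MultiplierHopfAlgebra.IsCounit (H : MultiplierHopfAlgebra A) (ε : Module.Dual ℂ A) :
    Prop where
  map_mul : ∀ a a', ε (a * a') = ε a * ε a'
  left : ∀ a a', sliceL ε (H.T₁ (a ⊗ₜ[ℂ] a')) = a * a'
  right : ∀ a a', sliceR ε (H.T₂ (a' ⊗ₜ[ℂ] a)) = a' * a

/-- `S` is the antipode (for the counit `ε`): an anti-homomorphism with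
`m(S ⊗ ι)Δ(a) = ε(a)1` and `m(ι ⊗ S)Δ(a) = ε(a)1`, read in `M(A)`. The first
formula determines `S`, since `T₁` is surjective. -/
structure MultiplierHopfAlgebra.IsAntipode (H : MultiplierHopfAlgebra A) (ε : Module.Dual ℂ A)
    (S : A ≃ₗ[ℂ] A) : Prop where
  map_mul : ∀ a a', S (a * a') = S a' * S a
  left : ∀ a a', LinearMap.mul' ℂ A (S.toLinearMap.rTensor A (H.T₁ (a ⊗ₜ[ℂ] a'))) = ε a • a'
  right : ∀ a a', LinearMap.mul' ℂ A (S.toLinearMap.lTensor A (H.T₂ (a' ⊗ₜ[ℂ] a))) = ε a • a'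

end Algebra

/-- A multiplier Hopf `*`-algebra with a positive left integral `φ`, i.e. a non-zero positive
functional `φ` with `(ι ⊗ φ)Δ(a) = φ(a)1`, read in `M(A)`. -/
structure AlgebraicQuantumGroup (A : Type*) [NonUnitalRing A] [StarRing A] [Module ℂ A]
    [IsScalarTower ℂ A A] [SMulCommClass ℂ A A] [StarModule ℂ A] extends
    MultiplierHopfAlgebra A where
  comul_star : ∀ a, Δ (star a) = star (Δ a)
  φ : Module.Dual ℂ A
  φ_ne_zero : φ ≠ 0
  φ_nonneg : ∀ a, 0 ≤ φ (star a * a)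
  φ_invariant : ∀ a a', sliceR φ (T₂ (a' ⊗ₜ[ℂ] a)) = φ a • a'

section Separation

theorem rTensor_separates {M N W ι : Type*} [AddCommGroup M] [Module ℂ M] [AddCommGroup N]
    [Module ℂ N] [AddCommGroup W] [Module ℂ W] (f : ι → M →ₗ[ℂ] N)
    (hf : ∀ m, (∀ i, f i m = 0) → m = 0) (z : M ⊗[ℂ] W)
    (hz : ∀ i, (f i).rTensor W z = 0) : z = 0 := by
  classical
  let b := Module.Basis.ofVectorSpace ℂ W
  have key : ∀ (i : ι) (z : M ⊗[ℂ] W) j,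
      f i (sliceR (b.coord j) z) = sliceR (b.coord j) ((f i).rTensor W z) := by
    intro i z j
    induction z with
    | zero => simp
    | add x y hx hy => simp only [map_add, hx, hy]
    | tmul m w => simp
  have h0 : ∀ j, sliceR (b.coord j) z = 0 := fun j => hf _ fun i => by rw [key, hz, map_zero]
  apply (TensorProduct.equivFinsuppOfBasisRight b).injective
  rw [map_zero]
  ext j
  have : ∀ z : M ⊗[ℂ] W, TensorProduct.equivFinsuppOfBasisRight b z j
      = sliceR (b.coord j) z := by
    intro z
    induction z with
    | zero => simp
    | add x y hx hy => simp only [map_add, Finsupp.add_apply, hx, hy]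
    | tmul m w => simp
  rw [this, h0]; rfl

end Separation

namespace MultiplierHopfAlgebra

variable {A : Type*} [NonUnitalRing A] [Module ℂ A] [IsScalarTower ℂ A A] [SMulCommClass ℂ A A]

theorem ofElem_inj (H : MultiplierHopfAlgebra A) {z w : A ⊗[ℂ] A} (h : ofElem z = ofElem w) :
    z = w := by
  have h0 : ∀ y, (z - w) * y = 0 := fun y => by
    have := congrArg (fun m => Multiplier.left m y) h
    simpa [sub_mul, sub_eq_zero] using this
  rw [← sub_eq_zero]
  generalize z - w = u at h0
  refine rTensor_separates (fun a : A => LinearMap.mulRight ℂ a) H.nondeg_left u fun a => ?_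
  apply (TensorProduct.comm ℂ A A).injective
  rw [map_zero]
  refine rTensor_separates (fun b : A => LinearMap.mulRight ℂ b) H.nondeg_left _ fun b => ?_
  have : ∀ u : A ⊗[ℂ] A, (LinearMap.mulRight ℂ b).rTensor A
      (TensorProduct.comm ℂ A A ((LinearMap.mulRight ℂ a).rTensor A u)) =
      TensorProduct.comm ℂ A A (u * (a ⊗ₜ[ℂ] b)) := by
    intro u
    induction u with
    | zero => simp
    | add x y hx hy => simp only [map_add, add_mul, hx, hy]
    | tmul m w => simp
  rw [this, h0, map_zero]

end MultiplierHopfAlgebra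

namespace AlgebraicQuantumGroup

variable {A : Type*} [NonUnitalRing A] [StarRing A] [Module ℂ A]
    [IsScalarTower ℂ A A] [SMulCommClass ℂ A A] [StarModule ℂ A] (G : AlgebraicQuantumGroup A)

/-- The bijection `V` of `A ⊗ A` with `V(x ⊗ x') = Δ(x')(x ⊗ 1)`, see `V_spec`; it is
`z ↦ (T₂(z*))*`. -/
def V : A ⊗[ℂ] A ≃ₗ[ℂ] A ⊗[ℂ] A where
  __ := conjMap G.T₂.toLinearMap
  invFun := conjMap G.T₂.symm.toLinearMap
  left_inv z := by simp [conjMap]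
  right_inv z := by simp [conjMap]

theorem V_apply (z : A ⊗[ℂ] A) : G.V z = star (G.T₂ (star z)) := rfl

theorem V_spec (x x' : A) : G.Δ x' * inl x = ofElem (G.V (x ⊗ₜ[ℂ] x')) := by
  have h := congrArg star (G.T₂_spec (star x) (star x'))
  rw [star_comp, star_ofElem, star_inl, ← G.comul_star, star_star, star_star] at h
  rw [h, V_apply, TensorProduct.star_tmul]

/-! ### The dual algebra -/

/-- The map `a ↦ φ(· a)`. -/
def fourier : A →ₗ[ℂ] Module.Dual ℂ A where
  toFun a := G.φ ∘ₗ LinearMap.mulRight ℂ a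
  map_add' a b := by ext x; simp [mul_add]
  map_smul' c a := by ext x; simp [mul_smul_comm]

@[simp] theorem fourier_apply (a x : A) : G.fourier a x = G.φ (x * a) := rfl

/-- The dual `B` of `A`: the space of functionals on `A` of the form `φ(· a)` with `a ∈ A`. The
pairing `⟨a, b⟩` is the value `b.1 a`. -/
def Dual : Submodule ℂ (Module.Dual ℂ A) := LinearMap.range G.fourier

theorem left_comul (x c d : A) : (inl c).right (G.T₁ (x ⊗ₜ[ℂ] d)) = (G.Δ x).left (c ⊗ₜ[ℂ] d) := by
  apply G.ofElem_inj
  rw [← ofElem_mul, ← G.T₁_spec, mul_assoc, inr_mul_inl, mul_ofElem]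

theorem left_comul' (x c d : A) : (inr d).right (G.V (c ⊗ₜ[ℂ] x)) = (G.Δ x).left (c ⊗ₜ[ℂ] d) := by
  apply G.ofElem_inj
  rw [← ofElem_mul, ← G.V_spec, mul_assoc, inl_mul_inr, mul_ofElem]

theorem left_comul_V (x q p : A) :
    (G.Δ x).left (G.V (q ⊗ₜ[ℂ] p)) = G.V (q ⊗ₜ[ℂ] (x * p)) := by
  apply G.ofElem_inj
  rw [← mul_ofElem, ← G.V_spec, ← G.V_spec, map_mul, mul_assoc]

theorem inl_left_V (a c x : A) :
    (inl a).left (G.V (c ⊗ₜ[ℂ] x)) = (inl c).right (G.T₂ (a ⊗ₜ[ℂ] x)) := by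
  apply G.ofElem_inj
  rw [← mul_ofElem, ← ofElem_mul, ← G.V_spec, ← G.T₂_spec, mul_assoc]

theorem invariant_V (q y : A) : sliceR G.φ (G.V (q ⊗ₜ[ℂ] y)) = G.φ y • q := by
  rw [← sub_eq_zero]
  refine G.nondeg_right _ fun a => ?_
  have h1 : ∀ z : A ⊗[ℂ] A, a * sliceR G.φ z = sliceR G.φ ((inl a).left z) := by
    intro z
    induction z with
    | zero => simp
    | add x y hx hy => simp only [map_add, mul_add, hx, hy]
    | tmul m w => simp [left_inl, mul_smul_comm]
  have h2 : ∀ z : A ⊗[ℂ] A, sliceR G.φ ((inl q).right z) = sliceR G.φ z * q := by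
    intro z
    induction z with
    | zero => simp
    | add x y hx hy => simp only [map_add, add_mul, hx, hy]
    | tmul m w => simp [right_inl, smul_mul_assoc]
  rw [mul_sub, h1, inl_left_V, h2, G.φ_invariant, smul_mul_assoc, mul_smul_comm, sub_self]

theorem conv_eq₁ (c d x : A) : tensorFun (G.fourier c) G.φ (G.T₁ (x ⊗ₜ[ℂ] d)) =
    tensorFun G.φ G.φ ((G.Δ x).left (c ⊗ₜ[ℂ] d)) := by
  rw [← left_comul]
  generalize G.T₁ (x ⊗ₜ[ℂ] d) = z
  induction z with
  | zero => simp
  | add x y hx hy => simp only [map_add, hx, hy]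
  | tmul m w => simp [right_inl]

theorem conv_eq₂ (c d x : A) : tensorFun G.φ (G.fourier d) (G.V (c ⊗ₜ[ℂ] x)) =
    tensorFun G.φ G.φ ((G.Δ x).left (c ⊗ₜ[ℂ] d)) := by
  rw [← left_comul']
  generalize G.V (c ⊗ₜ[ℂ] x) = z
  induction z with
  | zero => simp
  | add x y hx hy => simp only [map_add, hx, hy]
  | tmul m w => simp [right_inr]

theorem conv_mem (c d : A) : ∃ e, ∀ x, G.φ (x * e) =
    tensorFun G.φ G.φ ((G.Δ x).left (c ⊗ₜ[ℂ] d)) := by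
  refine ⟨sliceL G.φ (G.V.symm (c ⊗ₜ[ℂ] d)), fun x => ?_⟩
  obtain ⟨u, hu⟩ := G.V.surjective (c ⊗ₜ[ℂ] d)
  rw [← hu, LinearEquiv.symm_apply_apply]
  clear hu
  induction u with
  | zero => simp
  | add u v hu hv => simp only [map_add, mul_add, hu, hv]
  | tmul q p =>
    rw [left_comul_V]
    have h : ∀ z : A ⊗[ℂ] A, tensorFun G.φ G.φ z = G.φ (sliceR G.φ z) := by
      intro z
      induction z with
      | zero => simp
      | add x y hx hy => simp only [map_add, hx, hy]
      | tmul m w => simp [mul_comm]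
    rw [h, invariant_V]
    simp [mul_smul_comm, mul_comm]

/-- `(b ⊗ b')Δ(x)` is well defined: with `b' = φ(· d)` it is `(b ⊗ φ)(Δ(x)(1 ⊗ d))`; as a function
of `x` it is again an element of the dual. -/
theorem exists_conv (b b' : G.Dual) : ∃ p : G.Dual, ∀ d, b'.1 = G.fourier d →
    ∀ x, p.1 x = tensorFun b.1 G.φ (G.T₁ (x ⊗ₜ[ℂ] d)) := by
  obtain ⟨_, c, rfl⟩ := b
  obtain ⟨_, d, rfl⟩ := b'
  obtain ⟨e, he⟩ := G.conv_mem c d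
  refine ⟨⟨G.fourier e, e, rfl⟩, fun d' hd x => ?_⟩
  simp only at hd
  rw [fourier_apply, he, ← conv_eq₂, hd, conv_eq₂, conv_eq₁]

/-- The product of the dual, dual to the coproduct: `(b b')(x) = (b ⊗ b')Δ(x)`, that is,
`(b b')(x) = (b ⊗ φ)(Δ(x)(1 ⊗ d))` if `b' = φ(· d)`. -/
instance : Mul G.Dual where
  mul b b' := (G.exists_conv b b').choose

theorem mul_apply (b b' : G.Dual) (d : A) (hd : b'.1 = G.fourier d) (x : A) :
    (b * b').1 x = tensorFun b.1 G.φ (G.T₁ (x ⊗ₜ[ℂ] d)) :=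
  (G.exists_conv b b').choose_spec d hd x

theorem mul_apply' (b b' : G.Dual) (c : A) (hc : b.1 = G.fourier c) (x : A) :
    (b * b').1 x = tensorFun G.φ b'.1 (G.V (c ⊗ₜ[ℂ] x)) := by
  obtain ⟨d, hd⟩ := b'.2
  rw [mul_apply G b b' d hd.symm, hc, conv_eq₁, ← conv_eq₂, hd]

theorem coassoc_V (c x d : A) :
    G.V.toLinearMap.rTensor A ((TensorProduct.assoc ℂ A A A).symm (c ⊗ₜ[ℂ] G.T₁ (x ⊗ₜ[ℂ] d))) =
      (TensorProduct.assoc ℂ A A A).symm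
        (G.T₁.toLinearMap.lTensor A (TensorProduct.assoc ℂ A A A (G.V (c ⊗ₜ[ℂ] x) ⊗ₜ[ℂ] d))) := by
  have h1 : ∀ a (u : A ⊗[ℂ] A), ((inl a).left.rTensor A) (G.V.toLinearMap.rTensor A
      ((TensorProduct.assoc ℂ A A A).symm (c ⊗ₜ[ℂ] u))) = ((inl c).right.rTensor A)
      (G.T₂.toLinearMap.rTensor A ((TensorProduct.assoc ℂ A A A).symm (a ⊗ₜ[ℂ] u))) := by
    intro a u
    induction u with
    | zero => simp
    | add x y hx hy => simp only [TensorProduct.tmul_add, map_add, hx, hy]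
    | tmul m w => simp [inl_left_V]
  have h2 : ∀ (f : A →ₗ[ℂ] A) (v : A ⊗[ℂ] A), ((f.rTensor A).rTensor A)
      ((TensorProduct.assoc ℂ A A A).symm (G.T₁.toLinearMap.lTensor A
        (TensorProduct.assoc ℂ A A A (v ⊗ₜ[ℂ] d)))) = (TensorProduct.assoc ℂ A A A).symm
      (G.T₁.toLinearMap.lTensor A (TensorProduct.assoc ℂ A A A ((f.rTensor A v) ⊗ₜ[ℂ] d))) := by
    intro f v
    induction v with
    | zero => simp
    | add x y hx hy => simp only [TensorProduct.add_tmul, map_add, hx, hy]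
    | tmul m w =>
      simp only [TensorProduct.assoc_tmul, LinearMap.lTensor_tmul, LinearMap.rTensor_tmul]
      generalize G.T₁.toLinearMap (w ⊗ₜ[ℂ] d) = t
      induction t with
      | zero => simp
      | add x y hx hy => simp only [TensorProduct.tmul_add, map_add, hx, hy]
      | tmul m w => simp
  rw [← sub_eq_zero]
  refine rTensor_separates (fun a : A => (inl a).left) (fun v hv => ?_) _ fun a => ?_
  · exact rTensor_separates (fun a : A => LinearMap.mulLeft ℂ a) G.nondeg_right v hv
  · rw [map_sub, h1, left_inl, h2, ← left_inl, inl_left_V, right_inl, ← h2, G.coassoc, sub_self]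

instance : NonUnitalRing G.Dual where
  left_distrib b b' b'' := by
    obtain ⟨c, hc⟩ := b.2
    apply Subtype.ext
    ext x
    have h : ∀ (f g : Module.Dual ℂ A) (z : A ⊗[ℂ] A),
        tensorFun G.φ (f + g) z = tensorFun G.φ f z + tensorFun G.φ g z := by
      intro f g z
      simp [tensorFun, TensorProduct.tmul_add]
    simp only [Submodule.coe_add, LinearMap.add_apply, mul_apply' G b _ c hc.symm, h]
  right_distrib b b' b'' := by
    obtain ⟨d, hd⟩ := b''.2
    apply Subtype.ext
    ext x
    have h : ∀ (f g : Module.Dual ℂ A) (z : A ⊗[ℂ] A),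
        tensorFun (f + g) G.φ z = tensorFun f G.φ z + tensorFun g G.φ z := by
      intro f g z
      simp [tensorFun, TensorProduct.add_tmul]
    simp only [Submodule.coe_add, LinearMap.add_apply, mul_apply G _ b'' d hd.symm, h]
  zero_mul b := by
    obtain ⟨d, hd⟩ := b.2
    apply Subtype.ext
    ext x
    simp [mul_apply G _ b d hd.symm, tensorFun]
  mul_zero b := by
    obtain ⟨c, hc⟩ := b.2
    apply Subtype.ext
    ext x
    simp [mul_apply' G b _ c hc.symm, tensorFun]
  mul_assoc b₁ b₂ b₃ := by
    obtain ⟨c, hc⟩ := b₁.2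
    obtain ⟨d, hd⟩ := b₃.2
    apply Subtype.ext
    ext x
    rw [mul_apply G _ b₃ d hd.symm, mul_apply' G b₁ _ c hc.symm]
    have h1 : ∀ u : A ⊗[ℂ] A, tensorFun (b₁ * b₂).1 G.φ u =
        tensorFun (tensorFun G.φ b₂.1) G.φ (G.V.toLinearMap.rTensor A
          ((TensorProduct.assoc ℂ A A A).symm (c ⊗ₜ[ℂ] u))) := by
      intro u
      induction u with
      | zero => simp
      | add x y hx hy => simp only [TensorProduct.tmul_add, map_add, hx, hy]
      | tmul m w => simp [mul_apply' G b₁ b₂ c hc.symm]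
    have h2 : ∀ v : A ⊗[ℂ] A, tensorFun G.φ (b₂ * b₃).1 v =
        tensorFun (tensorFun G.φ b₂.1) G.φ ((TensorProduct.assoc ℂ A A A).symm
          (G.T₁.toLinearMap.lTensor A (TensorProduct.assoc ℂ A A A (v ⊗ₜ[ℂ] d)))) := by
      intro v
      induction v with
      | zero => simp
      | add x y hx hy => simp only [TensorProduct.add_tmul, map_add, hx, hy]
      | tmul m w =>
        rw [tensorFun_tmul, mul_apply G b₂ b₃ d hd.symm]
        simp only [TensorProduct.assoc_tmul, LinearMap.lTensor_tmul, LinearEquiv.coe_coe]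
        generalize G.T₁ (w ⊗ₜ[ℂ] d) = t
        induction t with
        | zero => simp
        | add x y hx hy => simp only [TensorProduct.tmul_add, map_add, mul_add, hx, hy]
        | tmul p q => simp [mul_assoc]
    rw [h1, h2, coassoc_V]

instance : IsScalarTower ℂ G.Dual G.Dual where
  smul_assoc r b b' := by
    obtain ⟨d, hd⟩ := b'.2
    apply Subtype.ext
    ext x
    have h : (r • b.1) ⊗ₜ[ℂ] G.φ = r • (b.1 ⊗ₜ[ℂ] G.φ) := (TensorProduct.smul_tmul' r b.1 G.φ).symm
    simp [smul_eq_mul, mul_apply G _ b' d hd.symm, tensorFun, h]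

instance : SMulCommClass ℂ G.Dual G.Dual where
  smul_comm r b b' := by
    obtain ⟨c, hc⟩ := b.2
    apply Subtype.ext
    ext x
    simp [smul_eq_mul, mul_apply' G b _ c hc.symm, tensorFun]

/-- The comultiplication of `HB` on the dual `B` is the opposite of the one dual to the product of
`A`, i.e. `⟨x ⊗ y, Δ_B(b)⟩ = ⟨y x, b⟩`. Since `⟨y, b'' b'⟩ = ⟨Δ(y), b'' ⊗ b'⟩`, this reads
`⟨x ⊗ y, Δ_B(b)(1 ⊗ b')⟩ = ⟨Δ(y)(x ⊗ 1), b ⊗ b'⟩` for elements `Δ_B(b)(1 ⊗ b')` of `B ⊗ B`, and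
this determines `Δ_B`. -/
def IsOppositeDual (HB : MultiplierHopfAlgebra G.Dual) : Prop :=
  ∀ (b b' : G.Dual) (x y : A),
    TensorProduct.dualDistrib ℂ A A
      (TensorProduct.map G.Dual.subtype G.Dual.subtype (HB.T₁ (b ⊗ₜ[ℂ] b'))) (x ⊗ₜ[ℂ] y) =
    tensorFun b.1 b'.1 (G.V (x ⊗ₜ[ℂ] y))

/-! ### The action of `A ⊗ B` on `A ⊗ A` and the pairing of `M(A ⊗ B)` with `B ⊗ A` -/

/-- `lam` is the map `b ↦ λ(b)`, where `λ(b)x = ⟨S⁻¹(x₍₁₎), b⟩ x₍₂₎`, that is,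
`(λ(b)x) a' = ((b ∘ S⁻¹) ⊗ ι)(Δ(x)(1 ⊗ a'))` for all `a'`. This determines `λ(b)x`, since the
product of `A` is non-degenerate. -/
def IsConvolution (S : A ≃ₗ[ℂ] A) (lam : G.Dual →ₗ[ℂ] Module.End ℂ A) : Prop :=
  ∀ (b : G.Dual) (x a' : A),
    lam b x * a' = sliceL (b.1 ∘ₗ S.symm.toLinearMap) (G.T₁ (x ⊗ₜ[ℂ] a'))

/-- The action `a ⊗ b ↦ π(a) ⊗ λ(b)` of `A ⊗ B` on `A ⊗ A`, where `π(a)x = a x`. -/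
def tensorAction (lam : G.Dual →ₗ[ℂ] Module.End ℂ A) :
    A ⊗[ℂ] G.Dual →ₗ[ℂ] Module.End ℂ (A ⊗[ℂ] A) :=
  TensorProduct.homTensorHomMap (RingHom.id ℂ) A A A A ∘ₗ
    TensorProduct.map (LinearMap.mul ℂ A) lam

/-- The operator `T` on `A ⊗ A` is the action of the multiplier `m ∈ M(A ⊗ B)`. The action of
`A ⊗ B` is non-degenerate, and its unique extension to `M(A ⊗ B)` is given by
`m • (p • z) = (m p) • z` for `p ∈ A ⊗ B` and `z ∈ A ⊗ A`. -/
def ActsAs (lam : G.Dual →ₗ[ℂ] Module.End ℂ A) (m : Multiplier (A ⊗[ℂ] G.Dual))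
    (T : Module.End ℂ (A ⊗[ℂ] A)) : Prop :=
  Submodule.span ℂ {w | ∃ p z, G.tensorAction lam p z = w} = ⊤ ∧
    ∀ p z, T (G.tensorAction lam p z) = G.tensorAction lam (m.left p) z

/-- The functional `p ↦ ⟨p, b ⊗ a⟩` on `A ⊗ B`, with `⟨a' ⊗ b', b ⊗ a⟩ = ⟨a', b⟩⟨a, b'⟩`. -/
def pairing (b : G.Dual) (a : A) : Module.Dual ℂ (A ⊗[ℂ] G.Dual) :=
  tensorFun b.1 (LinearMap.applyₗ a ∘ₗ G.Dual.subtype)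

/-- The extended pairing `⟨m, b ⊗ a⟩` of `m ∈ M(A ⊗ B)` with `b ⊗ a ∈ B ⊗ A` has the value `t`.
Here `b` is covered by an `e ∈ A` with `⟨a' e, b⟩ = ⟨a', b⟩` for all `a'`, and `a` by an `f ∈ B`
with `⟨a, b' f⟩ = ⟨a, b'⟩` for all `b'`. Such elements exist, and
`⟨m, b ⊗ a⟩ = ⟨m (e ⊗ f), b ⊗ a⟩` for every choice of them. -/
def HasPairing (m : Multiplier (A ⊗[ℂ] G.Dual)) (b : G.Dual) (a : A) (t : ℂ) : Prop :=
  (∃ e : A, ∀ a', b.1 (a' * e) = b.1 a') ∧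
  (∃ f : G.Dual, ∀ b' : G.Dual, (b' * f).1 a = b'.1 a) ∧
  ∀ (e : A) (f : G.Dual), (∀ a', b.1 (a' * e) = b.1 a') →
    (∀ b' : G.Dual, (b' * f).1 a = b'.1 a) → G.pairing b a (m.left (e ⊗ₜ[ℂ] f)) = t

end AlgebraicQuantumGroup

end

noncomputable section

open Multiplier

/-! ### Slice maps and separation in tensor products -/

section TensorAux

variable {M N X Y : Type*} [AddCommGroup M] [Module ℂ M] [AddCommGroup N] [Module ℂ N]
  [AddCommGroup X] [Module ℂ X] [AddCommGroup Y] [Module ℂ Y]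

/-! The dual B acts on A from both sides by b ⬝ y = y₍₁₎ b(y₍₂₎) (`lact`) and y ⬝ b = b(y₍₁₎) y₍₂₎
(`ract`). The actions commute, and (b b')(y) = b(b' ⬝ y) = b'(y ⬝ b). Formally W is the canonical
element with (ι ⊗ ⟨y, ·⟩)W = y, so its two parts must satisfy (ι ⊗ ⟨y, ·⟩)(W(a ⊗ b)) = (b ⬝ y)a and
(ι ⊗ ⟨y, ·⟩)((a ⊗ b)W) = a(y ⬝ b) (`sliceR_leftW`, `sliceR_rightW`). These formulas determine the
parts, and the multiplier laws become the bimodule laws of the two actions. That such elements exist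
in A ⊗ B, and that W is invertible, is strong invariance of the integrals: under a ↦ φ(· a) the left
part of W is V⁻¹, and under S ⊗ ψ(· c), with ψ = φ ∘ S, the right part is the flip of T₁. By S(b ⬝
S⁻¹(y)) = y ⬝ S(b) (`S_lact`), W⁻¹ acts as V. If e covers b and f covers a, then f ⬝ a = a, so W
pairs to b((f ⬝ a)e) = b(a) and W⁻¹ to b(S(f ⬝ a)e) = b(S(a)).

The preparation rests on four points. Counit and antipode are constructed for any multiplier Hopf
algebra that also has a bijection V(x ⊗ x') = Δ(x')(x ⊗ 1); this serves both A and B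
(`exists_counit`, `exists_antipode`). The integral φ is faithful (`fourier_injective`), and the
functionals φ(· a), ψ(· a) and φ(a ·) all describe the same space B (`exists_ψ`, `exists_φ_mul`).
Under these identifications the maps T₁, T₂, V of B are the maps V, T₁⁻¹ and the flipped V⁻¹ of A,
hence bijective; Δ_B is multiplicative because Δ is, and coassociative because A is associative.
Finally, local units in A and for the action of B on A provide the covering elements in the pairing,
and covers on the opposite side show that the value does not depend on them. -/

theorem sliceL_comp_rTensor (f : Module.Dual ℂ N) (g : M →ₗ[ℂ] N) (z : M ⊗[ℂ] X) :
    sliceL f (g.rTensor X z) = sliceL (f ∘ₗ g) z := by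
  induction z with
  | zero => simp
  | add x y hx hy => simp only [map_add, hx, hy]
  | tmul m w => simp

theorem sliceR_comp_lTensor (f : Module.Dual ℂ N) (g : M →ₗ[ℂ] N) (z : X ⊗[ℂ] M) :
    sliceR f (g.lTensor X z) = sliceR (f ∘ₗ g) z := by
  induction z with
  | zero => simp
  | add x y hx hy => simp only [map_add, hx, hy]
  | tmul m w => simp

theorem sliceL_lTensor (f : Module.Dual ℂ M) (g : X →ₗ[ℂ] Y) (z : M ⊗[ℂ] X) :
    sliceL f (g.lTensor M z) = g (sliceL f z) := by
  induction z with
  | zero => simp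
  | add x y hx hy => simp only [map_add, hx, hy]
  | tmul m w => simp

theorem sliceR_rTensor (f : Module.Dual ℂ M) (g : X →ₗ[ℂ] Y) (z : X ⊗[ℂ] M) :
    sliceR f (g.rTensor M z) = g (sliceR f z) := by
  induction z with
  | zero => simp
  | add x y hx hy => simp only [map_add, hx, hy]
  | tmul m w => simp

theorem apply_sliceL (f : Module.Dual ℂ M) (g : Module.Dual ℂ N) (z : M ⊗[ℂ] N) :
    g (sliceL f z) = tensorFun f g z := by
  induction z with
  | zero => simp
  | add x y hx hy => simp only [map_add, hx, hy]
  | tmul m w => simp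

theorem apply_sliceR (f : Module.Dual ℂ M) (g : Module.Dual ℂ N) (z : M ⊗[ℂ] N) :
    f (sliceR g z) = tensorFun f g z := by
  induction z with
  | zero => simp
  | add x y hx hy => simp only [map_add, hx, hy]
  | tmul m w => simp [mul_comm]

theorem lTensor_separates {ι : Type*} (f : ι → M →ₗ[ℂ] N)
    (hf : ∀ m, (∀ i, f i m = 0) → m = 0) (z : X ⊗[ℂ] M)
    (hz : ∀ i, (f i).lTensor X z = 0) : z = 0 := by
  apply (TensorProduct.comm ℂ X M).injective
  rw [map_zero]
  refine rTensor_separates f hf _ fun i => ?_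
  have : ∀ z : X ⊗[ℂ] M, (f i).rTensor X (TensorProduct.comm ℂ X M z) =
      TensorProduct.comm ℂ X N ((f i).lTensor X z) := by
    intro z
    induction z with
    | zero => simp
    | add x y hx hy => simp only [map_add, hx, hy]
    | tmul m w => simp
  rw [this, hz, map_zero]

theorem sliceR_separates {ι : Type*} (f : ι → Module.Dual ℂ M)
    (hf : ∀ m, (∀ i, f i m = 0) → m = 0) {z w : X ⊗[ℂ] M}
    (hz : ∀ i, sliceR (f i) z = sliceR (f i) w) : z = w := by
  rw [← sub_eq_zero]
  refine lTensor_separates f hf _ fun i => (TensorProduct.rid ℂ X).injective ?_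
  have := hz i
  rw [← sub_eq_zero, ← map_sub] at this
  simpa [sliceR] using this

theorem sliceL_surjective {f : Module.Dual ℂ M} (hf : f ≠ 0) :
    Function.Surjective (sliceL f : M ⊗[ℂ] N →ₗ[ℂ] N) := by
  obtain ⟨m, hm⟩ := DFunLike.ne_iff.mp hf
  exact fun n => ⟨((f m)⁻¹ • m) ⊗ₜ n, by simp [inv_mul_cancel₀ (show f m ≠ 0 from hm)]⟩

theorem sliceR_surjective {f : Module.Dual ℂ N} (hf : f ≠ 0) :
    Function.Surjective (sliceR f : M ⊗[ℂ] N →ₗ[ℂ] M) := by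
  obtain ⟨n, hn⟩ := DFunLike.ne_iff.mp hf
  exact fun m => ⟨m ⊗ₜ ((f n)⁻¹ • n), by simp [inv_smul_smul₀ (show f n ≠ 0 from hn)]⟩

end TensorAux

/-! ### Identities for the canonical maps `T₁`, `T₂` and `V` -/

namespace MultiplierHopfAlgebra

variable {A : Type*} [NonUnitalRing A] [Module ℂ A] [IsScalarTower ℂ A A] [SMulCommClass ℂ A A]
  (H : MultiplierHopfAlgebra A)

include H in
theorem eq_of_mul_right {a b : A} (h : ∀ c, a * c = b * c) : a = b :=
  sub_eq_zero.mp (H.nondeg_left _ fun c => by rw [sub_mul, h, sub_self])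

include H in
theorem eq_of_mul_left {a b : A} (h : ∀ c, c * a = c * b) : a = b :=
  sub_eq_zero.mp (H.nondeg_right _ fun c => by rw [mul_sub, h, sub_self])

include H in
theorem eq_of_rTensor_mulLeft {X : Type*} [AddCommGroup X] [Module ℂ X] {z w : A ⊗[ℂ] X}
    (h : ∀ c : A, (LinearMap.mulLeft ℂ c).rTensor X z = (LinearMap.mulLeft ℂ c).rTensor X w) :
    z = w := by
  rw [← sub_eq_zero]
  exact rTensor_separates (fun c : A => LinearMap.mulLeft ℂ c) H.nondeg_right _ fun c => by
    rw [map_sub, h, sub_self]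

include H in
theorem eq_of_rTensor_mulRight {X : Type*} [AddCommGroup X] [Module ℂ X] {z w : A ⊗[ℂ] X}
    (h : ∀ c : A, (LinearMap.mulRight ℂ c).rTensor X z = (LinearMap.mulRight ℂ c).rTensor X w) :
    z = w := by
  rw [← sub_eq_zero]
  exact rTensor_separates (fun c : A => LinearMap.mulRight ℂ c) H.nondeg_left _ fun c => by
    rw [map_sub, h, sub_self]

include H in
theorem eq_of_lTensor_mulRight {X : Type*} [AddCommGroup X] [Module ℂ X] {z w : X ⊗[ℂ] A}
    (h : ∀ c : A, (LinearMap.mulRight ℂ c).lTensor X z = (LinearMap.mulRight ℂ c).lTensor X w) :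
    z = w := by
  rw [← sub_eq_zero]
  exact lTensor_separates (fun c : A => LinearMap.mulRight ℂ c) H.nondeg_left _ fun c => by
    rw [map_sub, h, sub_self]

theorem T₁_mul (a b c : A) :
    H.T₁ (a ⊗ₜ (b * c)) = (LinearMap.mulRight ℂ c).lTensor A (H.T₁ (a ⊗ₜ b)) := by
  apply H.ofElem_inj
  have h : (inr (b * c) : Multiplier (A ⊗[ℂ] A)) = inr b * inr c :=
    ext' (fun x => by simp [left_mul_apply, left_inr, LinearMap.mulLeft_mul, LinearMap.lTensor_comp])
      (fun x => by simp [right_mul_apply, right_inr, LinearMap.mulRight_mul, LinearMap.lTensor_comp])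
  rw [← H.T₁_spec, h, ← mul_assoc, H.T₁_spec, ← right_inr, ofElem_mul]

/-- Both sides are (c ⊗ 1)Δ(a)(1 ⊗ d). This is the bridge between `T₁` and `T₂`. -/
theorem rTensor_T₁ (a c d : A) : (LinearMap.mulLeft ℂ c).rTensor A (H.T₁ (a ⊗ₜ d)) =
    (LinearMap.mulRight ℂ d).lTensor A (H.T₂ (c ⊗ₜ a)) := by
  apply H.ofElem_inj
  rw [← left_inl, ← right_inr, ← mul_ofElem, ← ofElem_mul, ← H.T₁_spec, ← H.T₂_spec, mul_assoc]

theorem left_comul_T₁ (a b c : A) : (H.Δ a).left (H.T₁ (b ⊗ₜ c)) = H.T₁ ((a * b) ⊗ₜ c) := by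
  apply H.ofElem_inj
  rw [← mul_ofElem, ← H.T₁_spec, ← H.T₁_spec, map_mul, mul_assoc]

theorem left_comul_tmul (a p q : A) :
    (H.Δ a).left (p ⊗ₜ q) = (LinearMap.mulRight ℂ p).rTensor A (H.T₁ (a ⊗ₜ q)) := by
  apply H.ofElem_inj
  rw [← right_inl, ← ofElem_mul, ← H.T₁_spec, mul_assoc, inr_mul_inl, mul_ofElem]

section V

variable {H} {V : A ⊗[ℂ] A ≃ₗ[ℂ] A ⊗[ℂ] A}
  (hV : ∀ x x', H.Δ x' * inl x = ofElem (V (x ⊗ₜ[ℂ] x')))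

include hV

/-- `V` is kept abstract here: for A it comes from the involution, while for the dual it is written
down directly. -/
theorem lTensor_V (c x d : A) : (LinearMap.mulRight ℂ d).lTensor A (V (c ⊗ₜ x)) =
    (H.Δ x).left (c ⊗ₜ d) := by
  apply H.ofElem_inj
  rw [← right_inr, ← ofElem_mul, ← hV, mul_assoc, inl_mul_inr, mul_ofElem]

theorem left_comul_V_tmul (x q p : A) : (H.Δ x).left (V (q ⊗ₜ p)) = V (q ⊗ₜ (x * p)) := by
  apply H.ofElem_inj
  rw [← mul_ofElem, ← hV, ← hV, map_mul, mul_assoc]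

theorem rTensor_mulLeft_V (a c x : A) : (LinearMap.mulLeft ℂ a).rTensor A (V (c ⊗ₜ x)) =
    (LinearMap.mulRight ℂ c).rTensor A (H.T₂ (a ⊗ₜ x)) := by
  apply H.ofElem_inj
  rw [← left_inl, ← right_inl, ← mul_ofElem, ← ofElem_mul, ← hV, ← H.T₂_spec, mul_assoc]

theorem V_mul (a b c : A) :
    V ((a * b) ⊗ₜ c) = (LinearMap.mulRight ℂ b).rTensor A (V (a ⊗ₜ c)) := by
  apply H.ofElem_inj
  have h : (inl (a * b) : Multiplier (A ⊗[ℂ] A)) = inl a * inl b :=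
    ext' (fun x => by simp [left_mul_apply, left_inl, LinearMap.mulLeft_mul, LinearMap.rTensor_comp])
      (fun x => by simp [right_mul_apply, right_inl, LinearMap.mulRight_mul, LinearMap.rTensor_comp])
  rw [← hV, h, ← mul_assoc, hV, ← right_inl, ofElem_mul]

end V

/-! ### The counit -/

/-- `T₂ ⊗ ι` on `A ⊗ (A ⊗ A)`. -/
def T₂₁₂ : A ⊗[ℂ] (A ⊗[ℂ] A) ≃ₗ[ℂ] A ⊗[ℂ] (A ⊗[ℂ] A) :=
  (TensorProduct.assoc ℂ A A A).symm ≪≫ₗ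
    TensorProduct.congr H.T₂ (LinearEquiv.refl ℂ A) ≪≫ₗ TensorProduct.assoc ℂ A A A

/-- `ι ⊗ T₁` on `A ⊗ (A ⊗ A)`. -/
def T₁₂₃ : A ⊗[ℂ] (A ⊗[ℂ] A) ≃ₗ[ℂ] A ⊗[ℂ] (A ⊗[ℂ] A) :=
  TensorProduct.congr (LinearEquiv.refl ℂ A) H.T₁

@[simp] theorem T₂₁₂_tmul (a b c : A) :
    H.T₂₁₂ (a ⊗ₜ (b ⊗ₜ c)) = TensorProduct.assoc ℂ A A A (H.T₂ (a ⊗ₜ b) ⊗ₜ c) := by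
  simp [T₂₁₂]

@[simp] theorem T₁₂₃_tmul (a : A) (z : A ⊗[ℂ] A) : H.T₁₂₃ (a ⊗ₜ z) = a ⊗ₜ H.T₁ z := by
  simp [T₁₂₃]

/-- Coassociativity as commutation of two bijections; in this form it also holds for their inverses.
-/
theorem T₂₁₂_T₁₂₃ (z : A ⊗[ℂ] (A ⊗[ℂ] A)) : H.T₂₁₂ (H.T₁₂₃ z) = H.T₁₂₃ (H.T₂₁₂ z) := by
  have h := H.coassoc
  have h2 : ∀ z, H.T₂₁₂ z = TensorProduct.assoc ℂ A A A
      (H.T₂.toLinearMap.rTensor A ((TensorProduct.assoc ℂ A A A).symm z)) := fun z => rfl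
  have h3 : ∀ z, H.T₁₂₃ z = H.T₁.toLinearMap.lTensor A z := fun z => rfl
  induction z with
  | zero => simp
  | add x y hx hy => simp only [map_add, hx, hy]
  | tmul a u =>
    induction u with
    | zero => simp
    | add x y hx hy => simp only [TensorProduct.tmul_add, map_add, hx, hy]
    | tmul b c =>
      rw [T₁₂₃_tmul, h2, h, LinearEquiv.apply_symm_apply, T₂₁₂_tmul, h3]

theorem lTensor_mul'_T₂₁₂ (a : A) (u : A ⊗[ℂ] A) :
    (LinearMap.mul' ℂ A).lTensor A (H.T₂₁₂ (a ⊗ₜ u)) =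
      (LinearMap.mulLeft ℂ a).rTensor A (H.T₁ u) := by
  induction u with
  | zero => simp
  | add x y hx hy => simp only [TensorProduct.tmul_add, map_add, hx, hy]
  | tmul b c =>
    rw [rTensor_T₁, T₂₁₂_tmul]
    generalize H.T₂ (a ⊗ₜ b) = v
    induction v with
    | zero => simp
    | add x y hx hy => simp only [TensorProduct.add_tmul, map_add, hx, hy]
    | tmul p q => simp

/-- Commuting ι ⊗ T₁ past T₂ ⊗ ι leaves (ι ⊗ m)(T₂ ⊗ ι), which multiplies (a ⊗ 1) onto T₁ of the
other two legs. -/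
theorem lTensor_mul'_T₁symm (z : A ⊗[ℂ] A) (c : A) :
    (LinearMap.mul' ℂ A ∘ₗ H.T₁.symm.toLinearMap).lTensor A (TensorProduct.assoc ℂ A A A (z ⊗ₜ c)) =
      LinearMap.mul' ℂ A (H.T₂.symm z) ⊗ₜ c := by
  obtain ⟨u, rfl⟩ := H.T₂.surjective z
  rw [LinearEquiv.symm_apply_apply]
  induction u with
  | zero => simp
  | add x y hx hy => simp only [TensorProduct.add_tmul, map_add, hx, hy]
  | tmul a b =>
    rw [← T₂₁₂_tmul]
    obtain ⟨w, hw⟩ := H.T₁.surjective (b ⊗ₜ c)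
    rw [← hw, ← T₁₂₃_tmul, T₂₁₂_T₁₂₃, LinearMap.lTensor_comp, LinearMap.comp_apply]
    have : ∀ z, H.T₁.symm.toLinearMap.lTensor A (H.T₁₂₃ z) = z := by
      intro z
      have h3 : H.T₁₂₃ z = H.T₁.toLinearMap.lTensor A z := rfl
      rw [h3, ← LinearMap.comp_apply, ← LinearMap.lTensor_comp]
      simp
    rw [this, lTensor_mul'_T₂₁₂, hw]
    simp

/-- By `lTensor_mul'_T₁symm`, r ⊗ mT₁⁻¹(q ⊗ c) = mT₂⁻¹(r ⊗ q) ⊗ c. Comparing legs, mT₁⁻¹(q ⊗ c) and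
mT₂⁻¹(r ⊗ q) are the multiples of c and of r by one and the same scalar ε(q). -/
theorem exists_counit [Nontrivial A] : ∃ ε : Module.Dual ℂ A, H.IsCounit ε := by
  obtain ⟨r, hr⟩ := exists_ne (0 : A)
  obtain ⟨ω, hω⟩ := Module.Projective.exists_dual_ne_zero ℂ hr
  -- The scalar in mT₂⁻¹(r ⊗ q) = ε(q)r, read off by ω at the fixed r.
  let ε : Module.Dual ℂ A := (ω r)⁻¹ • (ω ∘ₗ LinearMap.mul' ℂ A ∘ₗ H.T₂.symm.toLinearMap ∘ₗ
    TensorProduct.mk ℂ A A r)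
  have key : ∀ z : A ⊗[ℂ] A, LinearMap.mul' ℂ A (H.T₁.symm z) = sliceL ε z := by
    intro z
    induction z with
    | zero => simp
    | add x y hx hy => simp only [map_add, hx, hy]
    | tmul q c =>
      have := congrArg (fun t => (ω r)⁻¹ • sliceL ω t) (H.lTensor_mul'_T₁symm (r ⊗ₜ q) c)
      simpa [inv_smul_smul₀ hω, ε, mul_smul] using this
  have hl : ∀ u : A ⊗[ℂ] A, sliceL ε (H.T₁ u) = LinearMap.mul' ℂ A u := fun u => by
    rw [← key, LinearEquiv.symm_apply_apply]
  have key₂ : ∀ z : A ⊗[ℂ] A, LinearMap.mul' ℂ A (H.T₂.symm z) = sliceR ε z := by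
    intro z
    induction z with
    | zero => simp
    | add x y hx hy => simp only [map_add, hx, hy]
    | tmul q c =>
      have := H.lTensor_mul'_T₁symm (q ⊗ₜ c) r
      simp only [TensorProduct.assoc_tmul, LinearMap.lTensor_tmul, LinearMap.comp_apply,
        LinearEquiv.coe_coe, key, sliceL_tmul] at this
      have := congrArg (fun t => (ω r)⁻¹ • sliceR ω t) this
      simp only [sliceR_tmul, map_smul, smul_eq_mul, inv_smul_smul₀ hω, mul_smul] at this
      rw [← this, sliceR_tmul, smul_comm, inv_smul_smul₀ hω]
  refine ⟨ε, fun p u => ?_, fun a b => by simp [hl], fun a b => by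
    rw [← key₂, LinearEquiv.symm_apply_apply, LinearMap.mul'_apply]⟩
  -- Multiplicativity follows by slicing Δ(b)(u ⊗ c) = T₁(b ⊗ c)(u ⊗ 1): the left side gives ε(u)bc,
  -- so right multiplication by u ⊗ 1 is scaling by ε(u) under ε ⊗ ι.
  have h1 : ∀ (a : A) (z : A ⊗[ℂ] A), sliceL ε ((H.Δ a).left z) = a * sliceL ε z := by
    intro a z
    obtain ⟨w, rfl⟩ := H.T₁.surjective z
    induction w with
    | zero => simp
    | add x y hx hy => simp only [map_add, mul_add, hx, hy]
    | tmul b c => rw [left_comul_T₁, hl, hl]; simp [mul_assoc]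
  have h2 : ∀ z : A ⊗[ℂ] A, sliceL ε ((LinearMap.mulRight ℂ u).rTensor A z) = ε u • sliceL ε z := by
    intro z
    obtain ⟨w, rfl⟩ := H.T₁.surjective z
    induction w with
    | zero => simp
    | add x y hx hy => simp only [map_add, smul_add, hx, hy]
    | tmul b c => rw [← left_comul_tmul, h1, hl]; simp [mul_smul_comm]
  have := congrArg ω (h2 (p ⊗ₜ r))
  simp only [LinearMap.rTensor_tmul, sliceL_tmul, map_smul, smul_eq_mul,
    LinearMap.mulRight_apply, ← mul_assoc] at this
  rw [mul_right_cancel₀ hω this, mul_comm]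

end MultiplierHopfAlgebra

namespace MultiplierHopfAlgebra

variable {A : Type*} [NonUnitalRing A] [Module ℂ A] [IsScalarTower ℂ A A] [SMulCommClass ℂ A A]
  {H : MultiplierHopfAlgebra A}

namespace IsCounit

variable {ε : Module.Dual ℂ A} (hε : H.IsCounit ε)
include hε

theorem sliceL_T₁ (u : A ⊗[ℂ] A) : sliceL ε (H.T₁ u) = LinearMap.mul' ℂ A u := by
  induction u with
  | zero => simp
  | add x y hx hy => simp only [map_add, hx, hy]
  | tmul a b => simp [hε.left]

theorem sliceR_T₂ (u : A ⊗[ℂ] A) : sliceR ε (H.T₂ u) = LinearMap.mul' ℂ A u := by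
  induction u with
  | zero => simp
  | add x y hx hy => simp only [map_add, hx, hy]
  | tmul a b => simp [hε.right]

theorem mul'_T₂_symm (z : A ⊗[ℂ] A) : LinearMap.mul' ℂ A (H.T₂.symm z) = sliceR ε z := by
  rw [← hε.sliceR_T₂, LinearEquiv.apply_symm_apply]

theorem mul'_T₁_symm (z : A ⊗[ℂ] A) : LinearMap.mul' ℂ A (H.T₁.symm z) = sliceL ε z := by
  rw [← hε.sliceL_T₁, LinearEquiv.apply_symm_apply]

theorem ne_zero [Nontrivial A] : ε ≠ 0 := by
  rintro rfl
  obtain ⟨r, hr⟩ := exists_ne (0 : A)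
  exact hr (H.nondeg_left r fun b => by
    rw [← hε.left, sliceL]; simp)

theorem mul'_surjective [Nontrivial A] : Function.Surjective (LinearMap.mul' ℂ A) := fun a => by
  obtain ⟨z, rfl⟩ := sliceL_surjective (M := A) hε.ne_zero a
  exact ⟨_, hε.mul'_T₁_symm z⟩

theorem sliceR_T₁ (a c : A) : sliceR ε (H.T₁ (a ⊗ₜ c)) = ε c • a := by
  refine H.eq_of_mul_left fun d => ?_
  have h : ε ∘ₗ LinearMap.mulRight ℂ c = ε c • ε := by
    ext x; simp [hε.map_mul, mul_comm]
  have h' : ∀ z : A ⊗[ℂ] A, sliceR (ε c • ε) z = ε c • sliceR ε z := by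
    intro z
    induction z with
    | zero => simp
    | add x y hx hy => simp only [map_add, smul_add, hx, hy]
    | tmul m w => simp [mul_smul]
  rw [← LinearMap.mulLeft_apply (R := ℂ), ← sliceR_rTensor, rTensor_T₁, sliceR_comp_lTensor, h, h',
    hε.right, mul_smul_comm]

variable {V : A ⊗[ℂ] A ≃ₗ[ℂ] A ⊗[ℂ] A}
  (hV : ∀ x x', H.Δ x' * inl x = ofElem (V (x ⊗ₜ[ℂ] x')))
include hV

theorem sliceL_V (c a : A) : sliceL ε (V (c ⊗ₜ a)) = ε c • a := by
  refine H.eq_of_mul_right fun d => ?_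
  have h : ε ∘ₗ LinearMap.mulRight ℂ c = ε c • ε := by
    ext x; simp [hε.map_mul, mul_comm]
  have h' : ∀ z : A ⊗[ℂ] A, sliceL (ε c • ε) z = ε c • sliceL ε z := by
    intro z
    induction z with
    | zero => simp
    | add x y hx hy => simp only [map_add, smul_add, hx, hy]
    | tmul m w => simp [mul_smul]
  rw [← LinearMap.mulRight_apply (R := ℂ), ← sliceL_lTensor, lTensor_V hV, left_comul_tmul,
    sliceL_comp_rTensor, h, h', hε.left, smul_mul_assoc]

/-! ### The antipode -/

omit hV in
theorem sliceL_T₁_symm_left (q : A) (z : A ⊗[ℂ] A) :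
    sliceL ε (H.T₁.symm ((H.Δ q).left z)) = ε q • sliceL ε (H.T₁.symm z) := by
  obtain ⟨u, rfl⟩ := H.T₁.surjective z
  induction u with
  | zero => simp
  | add x y hx hy => simp only [map_add, smul_add, hx, hy]
  | tmul r s => rw [left_comul_T₁]; simp [hε.map_mul, mul_smul]

theorem sliceR_V_symm_left (q : A) (z : A ⊗[ℂ] A) :
    sliceR ε (V.symm ((H.Δ q).left z)) = ε q • sliceR ε (V.symm z) := by
  obtain ⟨u, rfl⟩ := V.surjective z
  induction u with
  | zero => simp
  | add x y hx hy => simp only [map_add, smul_add, hx, hy]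
  | tmul r s => rw [left_comul_V_tmul hV]; simp [hε.map_mul, mul_smul]

omit hε hV in
theorem sliceL_T₁_symm_mulRight (z : A ⊗[ℂ] A) (c : A) :
    sliceL ε (H.T₁.symm ((LinearMap.mulRight ℂ c).lTensor A z)) =
      sliceL ε (H.T₁.symm z) * c := by
  obtain ⟨u, rfl⟩ := H.T₁.surjective z
  induction u with
  | zero => simp
  | add x y hx hy => simp only [map_add, add_mul, hx, hy]
  | tmul r s => rw [← T₁_mul]; simp [smul_mul_assoc]

omit hε in
theorem sliceR_V_symm_mulRight (z : A ⊗[ℂ] A) (c : A) :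
    sliceR ε (V.symm ((LinearMap.mulRight ℂ c).rTensor A z)) =
      sliceR ε (V.symm z) * c := by
  obtain ⟨u, rfl⟩ := V.surjective z
  induction u with
  | zero => simp
  | add x y hx hy => simp only [map_add, add_mul, hx, hy]
  | tmul r s => rw [← V_mul hV]; simp [smul_mul_assoc]

/-- Think of (ε ⊗ ι)T₁⁻¹(p ⊗ q) as S(p)q and of (ι ⊗ ε)V⁻¹(p ⊗ q) as S⁻¹(q)p; the claim then reads
S(S⁻¹(q)p)b = S(p)qb. It holds on z = V(p ⊗ q) because Δ(q) acts as the scalar ε(q) under (ε ⊗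
ι)T₁⁻¹. -/
theorem sliceL_T₁_symm_sliceR (z : A ⊗[ℂ] A) (b : A) :
    sliceL ε (H.T₁.symm (sliceR ε (V.symm z) ⊗ₜ b)) = sliceL ε (H.T₁.symm z) * b := by
  rw [← sliceL_T₁_symm_mulRight]
  obtain ⟨u, rfl⟩ := V.surjective z
  induction u with
  | zero => simp
  | add x y hx hy => simp only [map_add, TensorProduct.add_tmul, hx, hy]
  | tmul p q =>
    rw [lTensor_V hV, hε.sliceL_T₁_symm_left]
    simp [← TensorProduct.smul_tmul']

/-- The mirror image, S⁻¹(S(p)q)a = S⁻¹(q)pa. -/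
theorem sliceR_V_symm_sliceL (z : A ⊗[ℂ] A) (a : A) :
    sliceR ε (V.symm (a ⊗ₜ sliceL ε (H.T₁.symm z))) = sliceR ε (V.symm z) * a := by
  rw [← sliceR_V_symm_mulRight hV]
  obtain ⟨u, rfl⟩ := H.T₁.surjective z
  induction u with
  | zero => simp
  | add x y hx hy => simp only [map_add, TensorProduct.tmul_add, hx, hy]
  | tmul p q =>
    rw [← left_comul_tmul, hε.sliceR_V_symm_left hV]
    simp

/-- S has to map S⁻¹(q)p to S(p)q, that is N(z) to N₁(z). Both maps are onto since ε ≠ 0, and the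
two preceding identities force equal kernels, so S is well defined and bijective at once. -/
theorem exists_antipode [Nontrivial A] : ∃ S : A ≃ₗ[ℂ] A, H.IsAntipode ε S := by
  let N₁ : A ⊗[ℂ] A →ₗ[ℂ] A := sliceL ε ∘ₗ H.T₁.symm.toLinearMap
  let N : A ⊗[ℂ] A →ₗ[ℂ] A := sliceR ε ∘ₗ V.symm.toLinearMap
  have hN₁ : Function.Surjective N₁ :=
    (sliceL_surjective hε.ne_zero).comp H.T₁.symm.surjective
  have hN : Function.Surjective N := (sliceR_surjective hε.ne_zero).comp V.symm.surjective
  have hker : LinearMap.ker N = LinearMap.ker N₁ := by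
    ext z
    constructor
    · intro hz
      refine H.nondeg_left _ fun b => ?_
      have := hε.sliceL_T₁_symm_sliceR hV z b
      rw [show sliceR ε (V.symm z) = 0 from hz, TensorProduct.zero_tmul, map_zero, map_zero] at this
      exact this.symm
    · intro hz
      refine H.nondeg_left _ fun a => ?_
      have := hε.sliceR_V_symm_sliceL hV z a
      rw [show sliceL ε (H.T₁.symm z) = 0 from hz, TensorProduct.tmul_zero, map_zero, map_zero] at this
      exact this.symm
  let S : A ≃ₗ[ℂ] A := (N.quotKerEquivOfSurjective hN).symm ≪≫ₗ
    Submodule.quotEquivOfEq _ _ hker ≪≫ₗ N₁.quotKerEquivOfSurjective hN₁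
  have hS : ∀ z, S (N z) = N₁ z := by
    intro z
    have : (N.quotKerEquivOfSurjective hN).symm (N z) = Submodule.Quotient.mk z := by
      rw [LinearEquiv.symm_apply_eq]; rfl
    simp only [S, LinearEquiv.trans_apply, this]
    rfl
  have hS₁ : ∀ a b, S a * b = N₁ (a ⊗ₜ b) := by
    intro a b
    obtain ⟨z, rfl⟩ := hN a
    rw [hS]
    exact (hε.sliceL_T₁_symm_sliceR hV z b).symm
  have hS₂ : ∀ a b, S.symm b * a = N (a ⊗ₜ b) := by
    intro a b
    obtain ⟨z, rfl⟩ := hN₁ b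
    rw [← hS, LinearEquiv.symm_apply_apply, hS]
    exact (hε.sliceR_V_symm_sliceL hV z a).symm
  -- Apply the triple product to the two commuting inverses at c ⊗ a ⊗ b, using mT₁⁻¹ = ε ⊗ ι and
  -- mT₂⁻¹ = ι ⊗ ε.
  have hS₃ : ∀ c a b, c * N₁ (a ⊗ₜ b) = sliceR ε (H.T₂.symm (c ⊗ₜ a)) * b := by
    intro c a b
    have e₁ : ∀ u : A ⊗[ℂ] A, (LinearMap.mul' ℂ A) ((LinearMap.mul' ℂ A).rTensor A
        ((TensorProduct.assoc ℂ A A A).symm (H.T₂₁₂.symm (c ⊗ₜ u)))) = c * sliceL ε u := by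
      intro u
      induction u with
      | zero => simp
      | add x y hx hy => simp only [TensorProduct.tmul_add, map_add, mul_add, hx, hy]
      | tmul p q =>
        have : H.T₂₁₂.symm (c ⊗ₜ (p ⊗ₜ q)) =
            TensorProduct.assoc ℂ A A A (H.T₂.symm (c ⊗ₜ p) ⊗ₜ q) := by
          simp [T₂₁₂]
        rw [this]
        simp [hε.mul'_T₂_symm, mul_smul_comm, smul_mul_assoc]
    have e₂ : ∀ v : A ⊗[ℂ] A, (LinearMap.mul' ℂ A) ((LinearMap.mul' ℂ A).rTensor A
        ((TensorProduct.assoc ℂ A A A).symm (H.T₁₂₃.symm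
          (TensorProduct.assoc ℂ A A A (v ⊗ₜ b))))) = sliceR ε v * b := by
      have e₃ : ∀ z : A ⊗[ℂ] (A ⊗[ℂ] A), (LinearMap.mul' ℂ A) ((LinearMap.mul' ℂ A).rTensor A
        ((TensorProduct.assoc ℂ A A A).symm z)) =
          LinearMap.mul' ℂ A ((LinearMap.mul' ℂ A).lTensor A z) := by
        intro z
        induction z with
        | zero => simp
        | add x y hx hy => simp only [map_add, hx, hy]
        | tmul p u =>
          induction u with
          | zero => simp
          | add x y hx hy => simp only [TensorProduct.tmul_add, map_add, hx, hy]
          | tmul q r => simp [mul_assoc]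
      intro v
      induction v with
      | zero => simp
      | add x y hx hy => simp only [TensorProduct.add_tmul, map_add, add_mul, hx, hy]
      | tmul r s =>
        have : H.T₁₂₃.symm (r ⊗ₜ (s ⊗ₜ b)) = r ⊗ₜ H.T₁.symm (s ⊗ₜ b) := by
          simp [T₁₂₃]
        rw [e₃, TensorProduct.assoc_tmul, this]
        simp [hε.mul'_T₁_symm, smul_mul_assoc]
    have e₄ : H.T₂₁₂.symm (H.T₁₂₃.symm (c ⊗ₜ (a ⊗ₜ b))) =
        H.T₁₂₃.symm (H.T₂₁₂.symm (c ⊗ₜ (a ⊗ₜ b))) := by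
      rw [LinearEquiv.symm_apply_eq, LinearEquiv.symm_apply_eq, ← T₂₁₂_T₁₂₃,
        LinearEquiv.apply_symm_apply, LinearEquiv.apply_symm_apply]
    have e₅ : H.T₂₁₂.symm (c ⊗ₜ (a ⊗ₜ b)) =
            TensorProduct.assoc ℂ A A A (H.T₂.symm (c ⊗ₜ a) ⊗ₜ b) := by
          simp [T₂₁₂]
    have e₆ : H.T₁₂₃.symm (c ⊗ₜ (a ⊗ₜ b)) = c ⊗ₜ H.T₁.symm (a ⊗ₜ b) := by
          simp [T₁₂₃]
    rw [← e₂, ← e₅, ← e₄, e₆, e₁]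
    rfl
  have hS₄ : ∀ c a, c * S a = sliceR ε (H.T₂.symm (c ⊗ₜ a)) := by
    intro c a
    refine H.eq_of_mul_right fun b => ?_
    rw [mul_assoc, hS₁, hS₃]
  refine ⟨S, fun a b => ?_, fun a a' => ?_, fun a a' => ?_⟩
  -- With a = S⁻¹(c) the product ab is N(b ⊗ c), which S maps to N₁(b ⊗ c) = S(b)c.
  · obtain ⟨c, rfl⟩ := S.symm.surjective a
    rw [hS₂, hS, ← hS₁, LinearEquiv.apply_symm_apply]
  · have : ∀ z, LinearMap.mul' ℂ A (S.toLinearMap.rTensor A z) = N₁ z := by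
      intro z
      induction z with
      | zero => simp
      | add x y hx hy => simp only [map_add, hx, hy]
      | tmul p q => simp [hS₁]
    rw [this]
    simp [N₁]
  · have : ∀ z, LinearMap.mul' ℂ A (S.toLinearMap.lTensor A z) = sliceR ε (H.T₂.symm z) := by
      intro z
      induction z with
      | zero => simp
      | add x y hx hy => simp only [map_add, hx, hy]
      | tmul p q => simp [hS₄]
    rw [this]
    simp

end IsCounit

/-! ### Formulas for the inverses of `T₁`, `T₂` and `V` in terms of the antipode -/

namespace IsAntipode

variable {ε : Module.Dual ℂ A} {S : A ≃ₗ[ℂ] A} (hS : H.IsAntipode ε S)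
include hS

theorem mul_eq (a b : A) : S a * b = sliceL ε (H.T₁.symm (a ⊗ₜ b)) := by
  have : ∀ u, LinearMap.mul' ℂ A (S.toLinearMap.rTensor A (H.T₁ u)) = sliceL ε u := by
    intro z
    induction z with
    | zero => simp
    | add x y hx hy => simp only [map_add, hx, hy]
    | tmul p q => simp [hS.left]
  rw [← this]
  simp

theorem mul_eq' (c a : A) : c * S a = sliceR ε (H.T₂.symm (c ⊗ₜ a)) := by
  have : ∀ u, LinearMap.mul' ℂ A (S.toLinearMap.lTensor A (H.T₂ u)) = sliceR ε u := by
    intro z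
    induction z with
    | zero => simp
    | add x y hx hy => simp only [map_add, hx, hy]
    | tmul p q => simp [hS.right]
  rw [← this]
  simp

theorem symm_map_mul (a b : A) : S.symm (a * b) = S.symm b * S.symm a := by
  apply S.injective
  simp [hS.map_mul]

theorem symm_mul_eq (hε : H.IsCounit ε) {V : A ⊗[ℂ] A ≃ₗ[ℂ] A ⊗[ℂ] A}
    (hV : ∀ x x', H.Δ x' * inl x = ofElem (V (x ⊗ₜ[ℂ] x'))) (a b : A) :
    S.symm b * a = sliceR ε (V.symm (a ⊗ₜ b)) := by
  apply S.injective
  refine H.eq_of_mul_right fun c => ?_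
  rw [hS.mul_eq (sliceR ε _), hε.sliceL_T₁_symm_sliceR hV, ← hS.mul_eq, hS.map_mul]
  simp

/-- `T₂⁻¹(c ⊗ a)(1 ⊗ b) = (c S ⊗ ι)(Δ(a)(1 ⊗ b))`. -/
theorem lTensor_T₂_symm (hε : H.IsCounit ε) (c a b : A) :
    (LinearMap.mulRight ℂ b).lTensor A (H.T₂.symm (c ⊗ₜ a)) =
      (LinearMap.mulLeft ℂ c ∘ₗ S.toLinearMap).rTensor A (H.T₁ (a ⊗ₜ b)) := by
  -- `Φ` is p ⊗ q ⊗ r ↦ pS(q) ⊗ r.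
  let Φ : A ⊗[ℂ] (A ⊗[ℂ] A) →ₗ[ℂ] A ⊗[ℂ] A :=
    (sliceR ε ∘ₗ H.T₂.symm.toLinearMap).rTensor A ∘ₗ (TensorProduct.assoc ℂ A A A).symm.toLinearMap
  have h₁ : ∀ u : A ⊗[ℂ] A, Φ (c ⊗ₜ u) =
      (LinearMap.mulLeft ℂ c ∘ₗ S.toLinearMap).rTensor A u := by
    intro u
    induction u with
    | zero => simp
    | add x y hx hy => simp only [TensorProduct.tmul_add, map_add, hx, hy]
    | tmul p q => simp [Φ, hS.mul_eq']
  have h₂ : ∀ r (w : A ⊗[ℂ] A), Φ (H.T₂₁₂ (r ⊗ₜ w)) = r ⊗ₜ sliceL ε w := by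
    intro r w
    induction w with
    | zero => simp
    | add x y hx hy => simp only [TensorProduct.tmul_add, map_add, hx, hy]
    | tmul p q => simp [Φ, TensorProduct.smul_tmul']
  have h₃ : ∀ u : A ⊗[ℂ] A, Φ (H.T₁₂₃ (TensorProduct.assoc ℂ A A A (H.T₂ u ⊗ₜ b))) =
      (LinearMap.mulRight ℂ b).lTensor A u := by
    intro u
    induction u with
    | zero => simp
    | add x y hx hy => simp only [TensorProduct.add_tmul, map_add, hx, hy]
    | tmul r s => rw [← T₂₁₂_tmul, ← T₂₁₂_T₁₂₃, T₁₂₃_tmul, h₂, hε.sliceL_T₁]; simp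
  rw [← h₃, LinearEquiv.apply_symm_apply, ← h₁]
  simp

/-- `(e ⊗ 1)T₁⁻¹(c ⊗ d) = (ι ⊗ S(·)d)((e ⊗ 1)Δ(c))`. -/
theorem rTensor_T₁_symm (hε : H.IsCounit ε) (e c d : A) :
    (LinearMap.mulLeft ℂ e).rTensor A (H.T₁.symm (c ⊗ₜ d)) =
      (LinearMap.mulRight ℂ d ∘ₗ S.toLinearMap).lTensor A (H.T₂ (e ⊗ₜ c)) := by
  let Φ : A ⊗[ℂ] (A ⊗[ℂ] A) →ₗ[ℂ] A ⊗[ℂ] A := (sliceL ε ∘ₗ H.T₁.symm.toLinearMap).lTensor A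
  have h₁ : ∀ u : A ⊗[ℂ] A, Φ (TensorProduct.assoc ℂ A A A (u ⊗ₜ d)) =
      (LinearMap.mulRight ℂ d ∘ₗ S.toLinearMap).lTensor A u := by
    intro u
    induction u with
    | zero => simp
    | add x y hx hy => simp only [TensorProduct.add_tmul, map_add, hx, hy]
    | tmul p q => simp [Φ, hS.mul_eq]
  have h₂ : ∀ z, Φ (H.T₁₂₃ z) = (sliceL ε).lTensor A z := by
    intro z
    induction z with
    | zero => simp
    | add x y hx hy => simp only [map_add, hx, hy]
    | tmul p q => simp [Φ]
  have h₃ : ∀ u : A ⊗[ℂ] A, (sliceL ε).lTensor A (H.T₂₁₂ (e ⊗ₜ u)) =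
      (LinearMap.mulLeft ℂ e).rTensor A u := by
    intro u
    induction u with
    | zero => simp
    | add x y hx hy => simp only [TensorProduct.tmul_add, map_add, hx, hy]
    | tmul r s =>
      have : ∀ v : A ⊗[ℂ] A, (sliceL ε).lTensor A (TensorProduct.assoc ℂ A A A (v ⊗ₜ s)) =
          sliceR ε v ⊗ₜ s := by
        intro v
        induction v with
        | zero => simp
        | add x y hx hy => simp only [TensorProduct.add_tmul, map_add, hx, hy]
        | tmul p q => simp [TensorProduct.smul_tmul']
      rw [T₂₁₂_tmul, this, hε.sliceR_T₂]
      simp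
  rw [← h₃, ← h₂, ← T₂₁₂_T₁₂₃, T₁₂₃_tmul, LinearEquiv.apply_symm_apply, T₂₁₂_tmul, h₁]

/-- `T₂⁻¹(c ⊗ a)(S(d) ⊗ 1) = (c ⊗ 1)(S ⊗ ι)((d ⊗ 1)Δ(a))`. -/
theorem rTensor_T₂_symm (hε : H.IsCounit ε) (c a d : A) :
    (LinearMap.mulRight ℂ (S d)).rTensor A (H.T₂.symm (c ⊗ₜ a)) =
      (LinearMap.mulLeft ℂ c ∘ₗ S.toLinearMap).rTensor A (H.T₂ (d ⊗ₜ a)) := by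
  refine H.eq_of_lTensor_mulRight fun b => ?_
  rw [← LinearMap.comp_apply, LinearMap.lTensor_comp_rTensor, ← LinearMap.rTensor_comp_lTensor,
    LinearMap.comp_apply, hS.lTensor_T₂_symm hε, ← LinearMap.comp_apply (LinearMap.lTensor A _),
    LinearMap.lTensor_comp_rTensor, ← LinearMap.rTensor_comp_lTensor, LinearMap.comp_apply,
    ← H.rTensor_T₁, ← LinearMap.comp_apply, ← LinearMap.comp_apply, ← LinearMap.rTensor_comp,
    ← LinearMap.rTensor_comp]
  congr 2
  ext x
  simp [hS.map_mul, mul_assoc]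

/-- `(1 ⊗ S(a))T₁⁻¹(c ⊗ d) = (ι ⊗ S)(Δ(c)(1 ⊗ a))(1 ⊗ d)`. -/
theorem lTensor_T₁_symm (hε : H.IsCounit ε) (a c d : A) :
    (LinearMap.mulLeft ℂ (S a)).lTensor A (H.T₁.symm (c ⊗ₜ d)) =
      (LinearMap.mulRight ℂ d ∘ₗ S.toLinearMap).lTensor A (H.T₁ (c ⊗ₜ a)) := by
  refine H.eq_of_rTensor_mulLeft fun b => ?_
  rw [← LinearMap.comp_apply, LinearMap.rTensor_comp_lTensor, ← LinearMap.lTensor_comp_rTensor,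
    LinearMap.comp_apply, hS.rTensor_T₁_symm hε, ← LinearMap.comp_apply (LinearMap.rTensor A _),
    LinearMap.rTensor_comp_lTensor, ← LinearMap.lTensor_comp_rTensor, LinearMap.comp_apply,
    H.rTensor_T₁, ← LinearMap.comp_apply, ← LinearMap.comp_apply, ← LinearMap.lTensor_comp,
    ← LinearMap.lTensor_comp]
  congr 2
  ext x
  simp [hS.map_mul, mul_assoc]

end IsAntipode

/-! ### The twofold coproduct and local units -/

/-- The map `z ↦ Δ(s) z`, as a linear function of `s`. -/
def comulLeft (z : A ⊗[ℂ] A) : A →ₗ[ℂ] A ⊗[ℂ] A where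
  toFun s := (H.Δ s).left z
  map_add' x y := by rw [map_add]; rfl
  map_smul' c x := by rw [map_smul]; rfl

@[simp] theorem comulLeft_apply (z : A ⊗[ℂ] A) (s : A) : H.comulLeft z s = (H.Δ s).left z := rfl

theorem comulLeft_add (z w : A ⊗[ℂ] A) : H.comulLeft (z + w) = H.comulLeft z + H.comulLeft w := by
  ext s; simp

theorem comulLeft_zero : H.comulLeft (0 : A ⊗[ℂ] A) = 0 := by
  ext s; simp

/-- The map `q ⊗ d ↦ (T₁ ⊗ ι)(Δ(b)₁₃ (1 ⊗ q ⊗ d))`. -/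
def comulTwice (H : MultiplierHopfAlgebra A) (b : A) : A ⊗[ℂ] A →ₗ[ℂ] A ⊗[ℂ] (A ⊗[ℂ] A) :=
  (TensorProduct.assoc ℂ A A A).toLinearMap ∘ₗ H.T₁.toLinearMap.rTensor A ∘ₗ
    (TensorProduct.assoc ℂ A A A).symm.toLinearMap ∘ₗ
    (TensorProduct.comm ℂ A A).toLinearMap.lTensor A ∘ₗ
    (TensorProduct.assoc ℂ A A A).toLinearMap ∘ₗ
    (H.T₁.toLinearMap ∘ₗ TensorProduct.mk ℂ A A b).rTensor A ∘ₗ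
    (TensorProduct.comm ℂ A A).toLinearMap

/-- The map `x ⊗ y ↦ Δ(x)₁₂(1 ⊗ q ⊗ y)`. -/
def comulInsert (H : MultiplierHopfAlgebra A) (q : A) : A ⊗[ℂ] A →ₗ[ℂ] A ⊗[ℂ] (A ⊗[ℂ] A) :=
  (TensorProduct.assoc ℂ A A A).toLinearMap ∘ₗ
    (H.T₁.toLinearMap ∘ₗ (TensorProduct.mk ℂ A A).flip q).rTensor A

/-- In Sweedler notation both sides are b₍₁₎ ⊗ b₍₂₎q ⊗ b₍₃₎d, with Δ applied to the first leg. -/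
theorem comulTwice_tmul (b q d : A) :
    H.comulTwice b (q ⊗ₜ d) = H.comulInsert q (H.T₁ (b ⊗ₜ d)) := by
  simp only [comulTwice, comulInsert, LinearMap.comp_apply, LinearEquiv.coe_coe,
    TensorProduct.comm_tmul, LinearMap.rTensor_tmul, TensorProduct.mk_apply]
  generalize H.T₁ (b ⊗ₜ d) = v
  induction v with
  | zero => simp
  | add x y hx hy => simp only [TensorProduct.add_tmul, map_add, hx, hy]
  | tmul p q => simp

/-- Coassociativity moves the second Δ to the other leg: b₍₁₎ ⊗ Δ(b₍₂₎)z. The factor c makes the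
expression an element of the tensor product. -/
theorem rTensor_comulTwice (c b : A) (z : A ⊗[ℂ] A) :
    (LinearMap.mulLeft ℂ c).rTensor _ (H.comulTwice b z) =
      (H.comulLeft z).lTensor A (H.T₂ (c ⊗ₜ b)) := by
  induction z with
  | zero => simp [comulLeft_zero]
  | add x y hx hy => simp only [map_add, hx, hy, comulLeft_add, LinearMap.lTensor_add,
      LinearMap.add_apply]
  | tmul q d =>
    have h₁ : ∀ v : A ⊗[ℂ] A, (LinearMap.mulLeft ℂ c).rTensor _ (H.comulInsert q v) =
        ((LinearMap.mulRight ℂ q).rTensor A).lTensor A (H.T₂₁₂ (c ⊗ₜ v)) := by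
      intro v
      induction v with
      | zero => simp
      | add x y hx hy => simp only [TensorProduct.tmul_add, map_add, hx, hy]
      | tmul x y =>
        have h₂ : ∀ w : A ⊗[ℂ] A, (LinearMap.mulLeft ℂ c).rTensor _
            (TensorProduct.assoc ℂ A A A (w ⊗ₜ y)) = TensorProduct.assoc ℂ A A A
            ((LinearMap.mulLeft ℂ c).rTensor A w ⊗ₜ y) := by
          intro w
          induction w with
          | zero => simp
          | add x y hx hy => simp only [TensorProduct.add_tmul, map_add, hx, hy]
          | tmul x y => simp
        have h₃ : ∀ w : A ⊗[ℂ] A, ((LinearMap.mulRight ℂ q).rTensor A).lTensor A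
            (TensorProduct.assoc ℂ A A A (w ⊗ₜ y)) = TensorProduct.assoc ℂ A A A
            ((LinearMap.mulRight ℂ q).lTensor A w ⊗ₜ y) := by
          intro w
          induction w with
          | zero => simp
          | add x y hx hy => simp only [TensorProduct.add_tmul, map_add, hx, hy]
          | tmul x y => simp
        rw [T₂₁₂_tmul, h₃, ← rTensor_T₁, ← h₂]
        simp [comulInsert]
    rw [comulTwice_tmul, h₁, ← T₁₂₃_tmul, T₂₁₂_T₁₂₃, T₂₁₂_tmul]
    generalize H.T₂ (c ⊗ₜ b) = v
    induction v with
    | zero => simp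
    | add x y hx hy => simp only [TensorProduct.add_tmul, map_add, hx, hy]
    | tmul r s => simp [left_comul_tmul]

/-- For z = Δ(r)(1 ⊗ s), multiplicativity merges Δ(b₍₂₎)Δ(r) into Δ(b₍₂₎r). -/
theorem comulTwice_T₁ (b : A) (u : A ⊗[ℂ] A) :
    H.comulTwice b (H.T₁ u) = H.T₁₂₃ (TensorProduct.assoc ℂ A A A
      ((H.T₁.toLinearMap ∘ₗ TensorProduct.mk ℂ A A b).rTensor A u)) := by
  refine H.eq_of_rTensor_mulLeft fun c => ?_
  rw [rTensor_comulTwice]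
  induction u with
  | zero => simp [comulLeft_zero]
  | add x y hx hy => simp only [map_add, hx, hy, comulLeft_add, LinearMap.lTensor_add,
      LinearMap.add_apply]
  | tmul r s =>
    have h : ∀ w : A ⊗[ℂ] A, (LinearMap.mulLeft ℂ c).rTensor _
        (H.T₁₂₃ (TensorProduct.assoc ℂ A A A (w ⊗ₜ s))) =
        H.T₁₂₃ (TensorProduct.assoc ℂ A A A ((LinearMap.mulLeft ℂ c).rTensor A w ⊗ₜ s)) := by
      intro w
      induction w with
      | zero => simp
      | add x y hx hy => simp only [TensorProduct.add_tmul, map_add, hx, hy]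
      | tmul x y => simp
    rw [LinearMap.rTensor_tmul, h, LinearMap.comp_apply, TensorProduct.mk_apply,
      LinearEquiv.coe_coe, rTensor_T₁]
    generalize H.T₂ (c ⊗ₜ b) = v
    induction v with
    | zero => simp
    | add x y hx hy => simp only [TensorProduct.add_tmul, map_add, hx, hy]
    | tmul r s => simp [left_comul_T₁]

namespace IsAntipode

variable {ε : Module.Dual ℂ A} {S : A ≃ₗ[ℂ] A} (hS : H.IsAntipode ε S)
include hS

/-- `Σ Δ(S(p₍₁₎))(p₍₂₎ q ⊗ 1) = q ⊗ S(p)`. -/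
theorem V_comm_T₁ {V : A ⊗[ℂ] A ≃ₗ[ℂ] A ⊗[ℂ] A}
    (hV : ∀ x x', H.Δ x' * inl x = ofElem (V (x ⊗ₜ[ℂ] x'))) (u : A ⊗[ℂ] A) :
    V (TensorProduct.comm ℂ A A (S.toLinearMap.rTensor A (H.T₁ u))) =
      TensorProduct.comm ℂ A A (S.toLinearMap.rTensor A u) := by
  let Y : A ⊗[ℂ] (A ⊗[ℂ] A) →ₗ[ℂ] A ⊗[ℂ] A := TensorProduct.lift
    (LinearMap.mk₂ ℂ (fun p w => (H.Δ (S p)).left w)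
      (fun p q w => by simp only [map_add]; rfl) (fun c p w => by simp only [map_smul]; rfl)
      (fun p w w' => map_add _ _ _) (fun c p w => map_smul _ _ _))
  have hY : ∀ p w, Y (p ⊗ₜ w) = (H.Δ (S p)).left w := fun p w => by simp [Y]
  -- Δ(S(b₍₁₎))Δ(b₍₂₎)z = ε(b)z. For x ⊗ y = Δ(b)(1 ⊗ d) this becomes, in `h₂`, Δ(S(x₍₁₎))(x₍₂₎q ⊗
  -- y) = q ⊗ S(x)y, so no formula for Δ ∘ S is needed.
  have h₁ : ∀ b z, Y (H.comulTwice b z) = ε b • z := by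
    intro b z
    obtain ⟨u, rfl⟩ := H.T₁.surjective z
    rw [comulTwice_T₁]
    induction u with
    | zero => simp
    | add x y hx hy => simp only [map_add, smul_add, hx, hy]
    | tmul r s =>
      have h : ∀ w : A ⊗[ℂ] A, Y (H.T₁₂₃ (TensorProduct.assoc ℂ A A A (w ⊗ₜ s))) =
          H.T₁ (LinearMap.mul' ℂ A (S.toLinearMap.rTensor A w) ⊗ₜ s) := by
        intro w
        induction w with
        | zero => simp
        | add x y hx hy => simp only [TensorProduct.add_tmul, map_add, hx, hy]
        | tmul x y => simp [hY, left_comul_T₁]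
      rw [LinearMap.rTensor_tmul, h, LinearMap.comp_apply, LinearEquiv.coe_coe,
        TensorProduct.mk_apply, hS.left, ← TensorProduct.smul_tmul', map_smul]
  have h₂ : ∀ q w, Y (H.comulInsert q w) =
      (TensorProduct.mk ℂ A A q) (LinearMap.mul' ℂ A (S.toLinearMap.rTensor A w)) := by
    intro q w
    obtain ⟨u, rfl⟩ := H.T₁.surjective w
    induction u with
    | zero => simp
    | add x y hx hy => simp only [map_add, hx, hy]
    | tmul b d =>
      rw [← comulTwice_tmul, h₁, hS.left]
      simp
  induction u with
  | zero => simp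
  | add x y hx hy => simp only [map_add, hx, hy]
  | tmul p q =>
    refine H.eq_of_lTensor_mulRight fun y => ?_
    have h₃ : ∀ w : A ⊗[ℂ] A, (LinearMap.mulRight ℂ y).lTensor A
        (V (TensorProduct.comm ℂ A A (S.toLinearMap.rTensor A w))) =
          Y (TensorProduct.assoc ℂ A A A (w ⊗ₜ y)) := by
      intro w
      induction w with
      | zero => simp
      | add x y hx hy => simp only [TensorProduct.add_tmul, map_add, hx, hy]
      | tmul x y => simp [hY, lTensor_V hV]
    have := h₂ q (p ⊗ₜ y)
    rw [h₃]
    simpa [comulInsert] using this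

/-- Left local units: every `c` lies in `A c`. -/
theorem exists_mul_eq (hε : H.IsCounit ε) (c : A) : ∃ e, e * c = c := by
  by_contra hc
  -- A functional ω that vanishes on Ac but not at c would give ε(x)ω(c) = ω(S(x₍₁₎)x₍₂₎c) = 0 for
  -- all x.
  obtain ⟨ω, hω, hω₀⟩ := Submodule.exists_dual_map_eq_bot_of_notMem
    (p := LinearMap.range (LinearMap.mulRight ℂ c)) (x := c) (by simpa using hc) inferInstance
  have hω₁ : ∀ x, ω (x * c) = 0 := fun x => by
    have : ω (x * c) ∈ Submodule.map ω (LinearMap.range (LinearMap.mulRight ℂ c)) :=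
      ⟨x * c, ⟨x, rfl⟩, rfl⟩
    simpa [hω₀] using this
  have : Nontrivial A := ⟨c, 0, by rintro rfl; simp at hω⟩
  let κ : A →ₗ[ℂ] Module.Dual ℂ A := (LinearMap.mul ℂ A).flip.compr₂ ω
  -- Multiplied by e ⊗ 1, the second leg lies in Ac, where every functional ω(y ·) vanishes.
  have hκ : ∀ x, κ.lTensor A (H.T₁ (x ⊗ₜ c)) = 0 := by
    intro x
    refine H.eq_of_rTensor_mulLeft fun e => ?_
    rw [map_zero, ← LinearMap.comp_apply, LinearMap.rTensor_comp_lTensor,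
      ← LinearMap.lTensor_comp_rTensor, LinearMap.comp_apply, rTensor_T₁, ← LinearMap.comp_apply,
      ← LinearMap.lTensor_comp]
    have : κ ∘ₗ LinearMap.mulRight ℂ c = 0 := by
      ext x y
      simp [κ, ← mul_assoc, hω₁]
    rw [this]
    simp
  let Θ : A ⊗[ℂ] Module.Dual ℂ A →ₗ[ℂ] ℂ := TensorProduct.lift (LinearMap.id.flip ∘ₗ S.toLinearMap)
  have hΘ : ∀ z, Θ (κ.lTensor A z) = ω (LinearMap.mul' ℂ A (S.toLinearMap.rTensor A z)) := by
    intro z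
    induction z with
    | zero => simp
    | add x y hx hy => simp only [map_add, hx, hy]
    | tmul x y => simp [Θ, κ]
  obtain ⟨x, hx⟩ := DFunLike.ne_iff.mp hε.ne_zero
  have := hΘ (H.T₁ (x ⊗ₜ c))
  rw [hκ, hS.left, map_zero, map_smul, eq_comm, smul_eq_mul, mul_eq_zero] at this
  exact this.elim hx hω

end IsAntipode

end MultiplierHopfAlgebra

/-! ### Counit and antipode of A -/

namespace AlgebraicQuantumGroup

open MultiplierHopfAlgebra

variable {A : Type*} [NonUnitalRing A] [StarRing A] [Module ℂ A]
    [IsScalarTower ℂ A A] [SMulCommClass ℂ A A] [StarModule ℂ A] (G : AlgebraicQuantumGroup A)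

include G in
theorem nontrivial : Nontrivial A := by
  obtain ⟨x, hx⟩ := DFunLike.ne_iff.mp G.φ_ne_zero
  exact ⟨x, 0, by rintro rfl; simp at hx⟩

/-- The counit of `A`. -/
def ε : Module.Dual ℂ A :=
  haveI := G.nontrivial
  G.toMultiplierHopfAlgebra.exists_counit.choose

theorem isCounit : G.IsCounit G.ε :=
  haveI := G.nontrivial
  G.toMultiplierHopfAlgebra.exists_counit.choose_spec

/-- The antipode of `A`. -/
def S : A ≃ₗ[ℂ] A :=
  haveI := G.nontrivial
  (G.isCounit.exists_antipode G.V_spec).choose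

theorem isAntipode : G.IsAntipode G.ε G.S :=
  haveI := G.nontrivial
  (G.isCounit.exists_antipode G.V_spec).choose_spec

theorem S_mul (a b : A) : G.S (a * b) = G.S b * G.S a := G.isAntipode.map_mul a b

theorem S_symm_mul (a b : A) : G.S.symm (a * b) = G.S.symm b * G.S.symm a :=
  G.isAntipode.symm_map_mul a b

/-- `V⁻¹(c ⊗ a)(1 ⊗ b) = (S⁻¹(·)c ⊗ ι)(Δ(a)(1 ⊗ b))`. -/
theorem lTensor_V_symm (c a b : A) :
    (LinearMap.mulRight ℂ b).lTensor A (G.V.symm (c ⊗ₜ a)) =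
      (LinearMap.mulRight ℂ c ∘ₗ G.S.symm.toLinearMap).rTensor A (G.T₁ (a ⊗ₜ b)) := by
  let Φ : (A ⊗[ℂ] A) ⊗[ℂ] A →ₗ[ℂ] A ⊗[ℂ] A := (sliceR G.ε ∘ₗ G.V.symm.toLinearMap).rTensor A
  have h₁ : ∀ u : A ⊗[ℂ] A, Φ ((TensorProduct.assoc ℂ A A A).symm (c ⊗ₜ u)) =
      (LinearMap.mulRight ℂ c ∘ₗ G.S.symm.toLinearMap).rTensor A u := by
    intro u
    induction u with
    | zero => simp
    | add x y hx hy => simp only [TensorProduct.tmul_add, map_add, hx, hy]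
    | tmul p q => simp [Φ, G.isAntipode.symm_mul_eq G.isCounit G.V_spec]
  have h₂ : ∀ r (w : A ⊗[ℂ] A), Φ (G.V.toLinearMap.rTensor A
      ((TensorProduct.assoc ℂ A A A).symm (r ⊗ₜ w))) = r ⊗ₜ sliceL G.ε w := by
    intro r w
    induction w with
    | zero => simp
    | add x y hx hy => simp only [TensorProduct.tmul_add, map_add, hx, hy]
    | tmul p q => simp [Φ, TensorProduct.smul_tmul']
  have h₃ : ∀ u : A ⊗[ℂ] A, Φ ((TensorProduct.assoc ℂ A A A).symm
        (G.T₁.toLinearMap.lTensor A (TensorProduct.assoc ℂ A A A (G.V u ⊗ₜ[ℂ] b)))) =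
      (LinearMap.mulRight ℂ b).lTensor A u := by
    intro u
    induction u with
    | zero => simp
    | add x y hx hy => simp only [TensorProduct.add_tmul, map_add, hx, hy]
    | tmul r s => rw [← coassoc_V, h₂, G.isCounit.sliceL_T₁]; simp
  rw [← h₃, LinearEquiv.apply_symm_apply, ← h₁]
  simp

/-- `(S ⊗ ι)V⁻¹(c ⊗ a) = (S(c) ⊗ 1)Δ(a)`. -/
theorem rTensor_V_symm (c a : A) :
    G.S.toLinearMap.rTensor A (G.V.symm (c ⊗ₜ a)) = G.T₂ (G.S c ⊗ₜ a) := by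
  refine G.eq_of_lTensor_mulRight fun b => ?_
  rw [← LinearMap.comp_apply, LinearMap.lTensor_comp_rTensor, ← LinearMap.rTensor_comp_lTensor,
    LinearMap.comp_apply, G.lTensor_V_symm, ← G.rTensor_T₁, ← LinearMap.comp_apply,
    ← LinearMap.rTensor_comp]
  congr 2
  ext x
  simp [S_mul]

/-! ### Faithfulness of the left integral -/

theorem sliceR_left_comul (x c a : A) : sliceR G.φ ((G.Δ x).left (c ⊗ₜ a)) =
    sliceR (G.fourier a) (G.V (c ⊗ₜ x)) := by
  rw [← lTensor_V G.V_spec, sliceR_comp_lTensor]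
  rfl

theorem sliceR_left_comul' (x c a : A) : sliceR G.φ ((G.Δ x).left (c ⊗ₜ a)) =
    sliceR G.φ (G.T₁ (x ⊗ₜ a)) * c := by
  rw [left_comul_tmul, sliceR_rTensor]
  rfl

theorem sliceR_V (z : A ⊗[ℂ] A) : sliceR G.φ (G.V z) = sliceR G.φ z := by
  induction z with
  | zero => simp
  | add x y hx hy => simp only [map_add, hx, hy]
  | tmul q y => simp [invariant_V]

/-- Left invariance applied to Δ(x)V(p ⊗ q) = V(p ⊗ xq); strong left invariance is derived from
this. -/
theorem sliceR_V_symm (x : A) (z : A ⊗[ℂ] A) :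
    sliceR (G.φ ∘ₗ LinearMap.mulLeft ℂ x) (G.V.symm z) = sliceR G.φ ((G.Δ x).left z) := by
  obtain ⟨u, rfl⟩ := G.V.surjective z
  induction u with
  | zero => simp
  | add x y hx hy => simp only [map_add, hx, hy]
  | tmul p q => rw [left_comul_V, sliceR_V]; simp

theorem φ_mul_eq_zero (h : ∀ x y, G.φ (x * y) = 0) : False := by
  have := G.nontrivial
  refine G.φ_ne_zero (LinearMap.ext fun a => ?_)
  obtain ⟨z, rfl⟩ := G.isCounit.mul'_surjective a
  induction z with
  | zero => simp
  | add x y hx hy => simp_all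
  | tmul p q => simp [h]

/-- Let N be the kernel, so that z ∈ A ⊗ N means (ι ⊗ `fourier`)z = 0. By invariance V⁻¹ maps A ⊗ N
into itself; through S so do T₂ and T₂⁻¹. As N is a left ideal, ε(a)d = mT₂⁻¹(d ⊗ a) ∈ N for a ∈ N
and all d. Since φ ≠ 0 on A² = A, this forces ε = 0 on N, and then ca = (ι ⊗ ε)T₂(c ⊗ a) = 0. -/
theorem fourier_injective : Function.Injective G.fourier := by
  rw [← LinearMap.ker_eq_bot, LinearMap.ker_eq_bot']
  have h₁ : ∀ a, G.fourier a = 0 → ∀ c, G.fourier.lTensor A (G.V.symm (c ⊗ₜ a)) = 0 := by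
    intro a ha c
    refine sliceR_separates (fun x => LinearMap.applyₗ x) (fun m hm => LinearMap.ext hm) fun x => ?_
    rw [sliceR_comp_lTensor, map_zero]
    have h := G.sliceR_V_symm x (c ⊗ₜ a)
    rw [sliceR_left_comul, ha] at h
    simp only [sliceR, LinearMap.lTensor_zero, LinearMap.comp_zero, LinearMap.zero_apply] at h
    exact h
  have h₂ : ∀ a, G.fourier a = 0 → ∀ c, G.fourier.lTensor A (G.T₂ (c ⊗ₜ a)) = 0 := by
    intro a ha c
    obtain ⟨c, rfl⟩ := G.S.surjective c
    rw [← rTensor_V_symm, ← LinearMap.comp_apply, LinearMap.lTensor_comp_rTensor,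
      ← LinearMap.rTensor_comp_lTensor, LinearMap.comp_apply, h₁ a ha, map_zero]
  have h₃ : ∀ a, G.fourier a = 0 → ∀ c, G.fourier.lTensor A (G.T₂.symm (c ⊗ₜ a)) = 0 := by
    intro a ha c
    refine G.eq_of_rTensor_mulRight fun d => ?_
    obtain ⟨d, rfl⟩ := G.S.surjective d
    rw [← LinearMap.comp_apply, LinearMap.rTensor_comp_lTensor,
      ← LinearMap.lTensor_comp_rTensor, LinearMap.comp_apply, G.isAntipode.rTensor_T₂_symm G.isCounit,
      ← LinearMap.comp_apply, LinearMap.lTensor_comp_rTensor,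
      ← LinearMap.rTensor_comp_lTensor, LinearMap.comp_apply, h₂ a ha, map_zero, map_zero]
  have h₄ : ∀ z : A ⊗[ℂ] A, G.fourier.lTensor A z = 0 → G.fourier (LinearMap.mul' ℂ A z) = 0 := by
    intro z hz
    ext y
    let Θ : A ⊗[ℂ] Module.Dual ℂ A →ₗ[ℂ] ℂ :=
      TensorProduct.lift (LinearMap.id.flip ∘ₗ LinearMap.mulLeft ℂ y)
    have : ∀ z, G.fourier (LinearMap.mul' ℂ A z) y = Θ (G.fourier.lTensor A z) := by
      intro z
      induction z with
      | zero => simp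
      | add x y hx hy => simp only [map_add, LinearMap.add_apply, hx, hy]
      | tmul p q => simp [Θ, mul_assoc]
    rw [this, hz]
    simp
  have h₅ : ∀ a, G.fourier a = 0 → G.ε a = 0 := by
    intro a ha
    by_contra hε
    refine G.φ_mul_eq_zero fun x d => ?_
    have := h₄ _ (h₃ a ha d)
    rw [G.isCounit.mul'_T₂_symm, sliceR_tmul, map_smul, smul_eq_zero_iff_right hε] at this
    exact DFunLike.congr_fun this x
  intro a ha
  refine G.nondeg_right a fun c => ?_
  -- Vanishing on the kernel, ε factors through `fourier`, so ι ⊗ ε can be evaluated after ι ⊗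
  -- `fourier`.
  have hmem : G.ε ∈ (LinearMap.ker G.fourier).dualAnnihilator :=
    (Submodule.mem_dualAnnihilator _).mpr fun a ha => h₅ a ha
  rw [← LinearMap.range_dualMap_eq_dualAnnihilator_ker] at hmem
  obtain ⟨g, hg⟩ := hmem
  rw [← G.isCounit.right a c, ← hg]
  have : ∀ z : A ⊗[ℂ] A, sliceR (G.fourier.dualMap g) z = sliceR g (G.fourier.lTensor A z) :=
    fun z => by rw [sliceR_comp_lTensor]; rfl
  rw [this, h₂ a ha, map_zero]

/-- Polarisation: φ is real at (x + y)*(x + y) and at (x + iy)*(x + iy). -/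
theorem φ_star_mul (x y : A) : G.φ (star y * x) = star (G.φ (star x * y)) := by
  have re : ∀ a, (G.φ (star a * a)).im = 0 := fun a =>
    (Complex.le_def.mp (G.φ_nonneg a)).2.symm
  have h₁ := re (x + y)
  have h₂ := re (x + Complex.I • y)
  have hx := re x
  have hy := re y
  simp only [star_add, star_smul, add_mul, mul_add, map_add, smul_mul_assoc, mul_smul_comm, map_smul,
    smul_eq_mul, Complex.add_im, Complex.mul_im, Complex.star_def, Complex.conj_I, Complex.neg_im,
    Complex.neg_re, Complex.I_re, Complex.I_im, Complex.mul_re, hx, hy] at h₁ h₂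
  apply Complex.ext <;> simp <;> linarith

theorem φ_star (x : A) : G.φ (star x) = star (G.φ x) := by
  have := G.nontrivial
  obtain ⟨z, rfl⟩ := G.isCounit.mul'_surjective x
  induction z with
  | zero => simp
  | add x y hx hy => simp only [map_add, star_add, hx, hy]
  | tmul p q =>
    have := G.φ_star_mul (star p) q
    simpa using this

theorem eq_zero_of_φ_mul {a : A} (h : ∀ x, G.φ (a * x) = 0) : a = 0 := by
  have : star a = 0 := G.fourier_injective (by
    ext x
    have := congrArg star (h (star x))
    rw [← φ_star] at this
    simpa using this)
  simpa using this

/-! ### The right integral -/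

/-- The right integral `φ ∘ S`. -/
def ψ : Module.Dual ℂ A := G.φ ∘ₗ G.S.toLinearMap

@[simp] theorem ψ_apply (a : A) : G.ψ a = G.φ (G.S a) := rfl

theorem ψ_ne_zero : G.ψ ≠ 0 := by
  intro h
  refine G.φ_ne_zero (LinearMap.ext fun a => ?_)
  have := DFunLike.congr_fun h (G.S.symm a)
  simpa using this

/-- Right invariance of φ ∘ S: by `V_comm_T₁`, the flipped S ⊗ ι turns T₁ into V⁻¹, and φ is
invariant under V. -/
theorem sliceL_T₁ (u : A ⊗[ℂ] A) : sliceL G.ψ (G.T₁ u) = sliceL G.ψ u := by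
  have h : ∀ u : A ⊗[ℂ] A, sliceL G.ψ u =
      sliceR G.φ (TensorProduct.comm ℂ A A (G.S.toLinearMap.rTensor A u)) := by
    intro u
    induction u with
    | zero => simp
    | add x y hx hy => simp only [map_add, hx, hy]
    | tmul p q => simp
  rw [h, h, ← G.isAntipode.V_comm_T₁ G.V_spec u, sliceR_V]

theorem sliceL_T₁_symm (x : A) (z : A ⊗[ℂ] A) :
    sliceL (G.ψ ∘ₗ LinearMap.mulLeft ℂ x) (G.T₁.symm z) = sliceL G.ψ ((G.Δ x).left z) := by
  obtain ⟨u, rfl⟩ := G.T₁.surjective z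
  induction u with
  | zero => simp
  | add x y hx hy => simp only [map_add, hx, hy]
  | tmul p q => rw [left_comul_T₁, sliceL_T₁]; simp

/-- `ψ(x (ι ⊗ φ)T₁⁻¹(z)) = φ(x (ψ ⊗ ι)V⁻¹(z))`. -/
theorem ψ_mul_sliceR (x : A) (z : A ⊗[ℂ] A) :
    G.ψ (x * sliceR G.φ (G.T₁.symm z)) = G.φ (x * sliceL G.ψ (G.V.symm z)) := by
  calc G.ψ (x * sliceR G.φ (G.T₁.symm z))
      = (G.ψ ∘ₗ LinearMap.mulLeft ℂ x) (sliceR G.φ (G.T₁.symm z)) := rfl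
    _ = G.φ (sliceL G.ψ ((G.Δ x).left z)) := by
        rw [apply_sliceR, ← apply_sliceL, sliceL_T₁_symm]
    _ = (G.φ ∘ₗ LinearMap.mulLeft ℂ x) (sliceL G.ψ (G.V.symm z)) := by
        rw [apply_sliceL, ← apply_sliceR, ← sliceR_V_symm, apply_sliceR, ← apply_sliceL]

/-! ### The dual as a space of functionals -/

/-- The bijection `a ↦ φ(· a)` of `A` onto its dual. -/
def F : A ≃ₗ[ℂ] G.Dual := LinearEquiv.ofInjective G.fourier G.fourier_injective

theorem F_coe (a : A) : (G.F a).1 = G.fourier a := rfl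

@[simp] theorem F_apply (a x : A) : (G.F a).1 x = G.φ (x * a) := rfl

theorem dual_ext {b b' : G.Dual} (h : ∀ x, b.1 x = b'.1 x) : b = b' :=
  Subtype.ext (LinearMap.ext h)

theorem eq_zero_of_dual {a : A} (h : ∀ b : G.Dual, b.1 a = 0) : a = 0 :=
  G.eq_zero_of_φ_mul fun x => h (G.F x)

theorem eq_of_dual {a a' : A} (h : ∀ b : G.Dual, b.1 a = b.1 a') : a = a' :=
  sub_eq_zero.mp (G.eq_zero_of_dual fun b => by rw [map_sub, h, sub_self])

/-- The left action `b ⬝ y = y₍₁₎ b(y₍₂₎)` of the dual on `A`. -/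
def lact : G.Dual →ₗ[ℂ] Module.End ℂ A :=
  (TensorProduct.mk ℂ A A).flip.compr₂ (sliceR G.φ ∘ₗ G.T₁.toLinearMap) ∘ₗ G.F.symm.toLinearMap

/-- The right action `y ⬝ b = b(y₍₁₎) y₍₂₎` of the dual on `A`. -/
def ract : G.Dual →ₗ[ℂ] Module.End ℂ A :=
  (TensorProduct.mk ℂ A A).compr₂ (sliceL G.φ ∘ₗ G.V.toLinearMap) ∘ₗ G.F.symm.toLinearMap

theorem lact_F (d y : A) : G.lact (G.F d) y = sliceR G.φ (G.T₁ (y ⊗ₜ d)) := by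
  simp [lact]

theorem ract_F (c y : A) : G.ract (G.F c) y = sliceL G.φ (G.V (c ⊗ₜ y)) := by
  simp [ract]

theorem mul_apply_lact (b b' : G.Dual) (y : A) : (b * b').1 y = b.1 (G.lact b' y) := by
  obtain ⟨d, rfl⟩ := G.F.surjective b'
  rw [mul_apply G b _ d rfl, lact_F, apply_sliceR]

theorem mul_apply_ract (b b' : G.Dual) (y : A) : (b * b').1 y = b'.1 (G.ract b y) := by
  obtain ⟨d, rfl⟩ := G.F.surjective b
  rw [mul_apply' G _ b' d rfl, ract_F, apply_sliceL]

/-- Independent of a representation b = φ(· d), hence usable when b is given in another form. -/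
theorem lact_mul (b : G.Dual) (y c : A) : G.lact b y * c = sliceR b.1 (G.V (c ⊗ₜ y)) := by
  obtain ⟨d, rfl⟩ := G.F.surjective b
  rw [lact_F, ← sliceR_left_comul', sliceR_left_comul, F_coe]

theorem mul_lact (b : G.Dual) (y c : A) : c * G.lact b y = sliceR b.1 (G.T₂ (c ⊗ₜ y)) := by
  obtain ⟨d, rfl⟩ := G.F.surjective b
  rw [lact_F, ← LinearMap.mulLeft_apply (R := ℂ), ← sliceR_rTensor, rTensor_T₁,
    sliceR_comp_lTensor]
  rfl

theorem ract_mul (b : G.Dual) (y c : A) : G.ract b y * c = sliceL b.1 (G.T₁ (y ⊗ₜ c)) := by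
  obtain ⟨d, rfl⟩ := G.F.surjective b
  rw [ract_F, ← LinearMap.mulRight_apply (R := ℂ), ← sliceL_lTensor, lTensor_V G.V_spec,
    left_comul_tmul, sliceL_comp_rTensor]
  rfl

/-- The module laws are transposes of the associativity of B, which separates the points of A. -/
theorem lact_lact (b b' : G.Dual) (y : A) : G.lact (b * b') y = G.lact b (G.lact b' y) :=
  G.eq_of_dual fun c => by simp only [← mul_apply_lact, mul_assoc]

theorem ract_ract (b b' : G.Dual) (y : A) : G.ract (b * b') y = G.ract b' (G.ract b y) :=
  G.eq_of_dual fun c => by simp only [← mul_apply_ract, mul_assoc]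

theorem lact_ract (b b' : G.Dual) (y : A) : G.lact b (G.ract b' y) = G.ract b' (G.lact b y) :=
  G.eq_of_dual fun c => by
    rw [← mul_apply_ract, ← mul_apply_lact, ← mul_apply_lact, ← mul_apply_ract, mul_assoc]

/-- The elements b ⬝ y span A, because T₁ is onto and φ ≠ 0. -/
theorem hom_ext_lact {X : Type*} [AddCommGroup X] [Module ℂ X] {f g : A →ₗ[ℂ] X}
    (h : ∀ b y, f (G.lact b y) = g (G.lact b y)) : f = g := by
  ext a
  obtain ⟨z, rfl⟩ := sliceR_surjective (M := A) G.φ_ne_zero a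
  obtain ⟨u, rfl⟩ := G.T₁.surjective z
  induction u with
  | zero => simp
  | add x y hx hy => simp only [map_add, hx, hy]
  | tmul p q => rw [← lact_F, h]

theorem hom_ext_ract {X : Type*} [AddCommGroup X] [Module ℂ X] {f g : A →ₗ[ℂ] X}
    (h : ∀ b y, f (G.ract b y) = g (G.ract b y)) : f = g := by
  ext a
  obtain ⟨z, rfl⟩ := sliceL_surjective (M := A) G.φ_ne_zero a
  obtain ⟨u, rfl⟩ := G.V.surjective z
  induction u with
  | zero => simp
  | add x y hx hy => simp only [map_add, hx, hy]
  | tmul p q => rw [← ract_F, h]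

/-! ### Strong invariance and the descriptions ψ(· c) and φ(a ·) of the dual -/

theorem exists_ψ (c : A) : ∃ b : G.Dual, ∀ x, b.1 x = G.ψ (x * c) := by
  obtain ⟨z, rfl⟩ := sliceR_surjective (M := A) G.φ_ne_zero c
  -- With c = (ι ⊗ φ)z, the witness is read off from `ψ_mul_sliceR` at T₁(z).
  refine ⟨G.F (sliceL G.ψ (G.V.symm (G.T₁ z))), fun x => ?_⟩
  rw [F_apply, ← ψ_mul_sliceR, LinearEquiv.symm_apply_apply]

/-- The bijection `c ↦ ψ(· c)` of `A` onto its dual. -/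
def Fψ : A ≃ₗ[ℂ] G.Dual :=
  LinearEquiv.ofBijective
    { toFun := fun c => (G.exists_ψ c).choose
      map_add' := fun c d => G.dual_ext fun x => by
        refine ((G.exists_ψ _).choose_spec x).trans ?_
        rw [mul_add, map_add, ← (G.exists_ψ c).choose_spec, ← (G.exists_ψ d).choose_spec]
        rfl
      map_smul' := fun r c => G.dual_ext fun x => by
        refine ((G.exists_ψ _).choose_spec x).trans ?_
        rw [mul_smul_comm, map_smul, ← (G.exists_ψ c).choose_spec]
        rfl }
    (by
      constructor
      · rw [← LinearMap.ker_eq_bot, LinearMap.ker_eq_bot']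
        intro c hc
        apply G.S.injective
        rw [map_zero]
        refine G.eq_zero_of_φ_mul fun x => ?_
        have := (G.exists_ψ c).choose_spec (G.S.symm x)
        rw [show (G.exists_ψ c).choose = 0 from hc] at this
        simpa [S_mul] using this.symm
      · intro b
        obtain ⟨a, rfl⟩ := G.F.surjective b
        obtain ⟨z, rfl⟩ := sliceL_surjective (M := A) G.ψ_ne_zero a
        refine ⟨sliceR G.φ (G.T₁.symm (G.V z)), G.dual_ext fun x => ?_⟩
        refine ((G.exists_ψ _).choose_spec x).trans ?_
        rw [ψ_mul_sliceR, LinearEquiv.symm_apply_apply, F_apply])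

theorem Fψ_apply (c x : A) : (G.Fψ c).1 x = G.ψ (x * c) := (G.exists_ψ c).choose_spec x

theorem Fψ_coe (c : A) : (G.Fψ c).1 = G.ψ ∘ₗ LinearMap.mulRight ℂ c :=
  LinearMap.ext fun x => G.Fψ_apply c x

theorem ract_Fψ (c x : A) : G.ract (G.Fψ c) x = sliceL G.ψ (G.V (c ⊗ₜ x)) := by
  refine G.eq_of_mul_right fun d => ?_
  rw [ract_mul, Fψ_coe, ← sliceL_comp_rTensor, ← left_comul_tmul, ← lTensor_V G.V_spec,
    sliceL_lTensor]
  rfl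

theorem ract_Fψ_mul (c x d : A) : G.ract (G.Fψ c) x * d =
    sliceL (G.ψ ∘ₗ LinearMap.mulLeft ℂ x) (G.T₁.symm (c ⊗ₜ d)) := by
  rw [ract_mul, Fψ_coe, ← sliceL_comp_rTensor, ← left_comul_tmul, sliceL_T₁_symm]

/-- Strong right invariance, ψ(x₍₁₎c)x₍₂₎ = ψ(xc₍₁₎)S(c₍₂₎), with the factor S(a) that makes the
right side meaningful. -/
theorem mul_ract_Fψ (a c x : A) : G.S a * G.ract (G.Fψ c) x =
    sliceL (G.ψ ∘ₗ LinearMap.mulLeft ℂ x) (G.S.toLinearMap.lTensor A (G.T₁ (c ⊗ₜ a))) := by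
  refine G.eq_of_mul_right fun d => ?_
  rw [mul_assoc, ract_Fψ_mul, ← LinearMap.mulLeft_apply (R := ℂ), ← sliceL_lTensor,
    G.isAntipode.lTensor_T₁_symm G.isCounit, LinearMap.lTensor_comp, LinearMap.comp_apply,
    sliceL_lTensor]
  rfl

/-- `(S ⊗ φ)(Δ(y)(1 ⊗ d)) c = (ι ⊗ φ(y ·))(Δ(d)(c ⊗ 1))`. -/
theorem S_lact_mul (d y c : A) : G.S (G.lact (G.F d) y) * c =
    sliceR (G.φ ∘ₗ LinearMap.mulLeft ℂ y) (G.V (c ⊗ₜ d)) := by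
  have h : ∀ e, e * G.S (G.lact (G.F d) y) =
      sliceR (G.φ ∘ₗ LinearMap.mulLeft ℂ y) (G.T₂ (e ⊗ₜ d)) := by
    intro e
    obtain ⟨e, rfl⟩ := G.S.surjective e
    rw [← rTensor_V_symm, sliceR_rTensor, sliceR_V_symm, sliceR_left_comul', lact_F]
    simp [S_mul]
  refine G.eq_of_mul_left fun e => ?_
  rw [← mul_assoc, h, ← LinearMap.mulRight_apply (R := ℂ), ← sliceR_rTensor,
    ← rTensor_mulLeft_V G.V_spec, sliceR_rTensor]
  rfl

/-- Strong left invariance moves the coproduct in the left factor onto x, and strong right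
invariance then moves it onto S(c); what remains depends on x only as ψ(x ·). -/
theorem exists_φ_mul_aux (u : A ⊗[ℂ] A) :
    ∃ b : G.Dual, ∀ x, b.1 x = G.φ (sliceL (G.ψ ∘ₗ G.S.toLinearMap) (G.T₂ u) * x) := by
  induction u with
  | zero => exact ⟨0, fun x => by simp⟩
  | add u v hu hv =>
    obtain ⟨b, hb⟩ := hu
    obtain ⟨b', hb'⟩ := hv
    exact ⟨b + b', fun x => by simp [hb, hb', add_mul]⟩
  | tmul c a =>
    obtain ⟨a, rfl⟩ := G.S.surjective a
    refine ⟨G.Fψ (sliceR G.φ (G.S.toLinearMap.lTensor A (G.T₁ (G.S c ⊗ₜ a)))), fun x => ?_⟩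
    symm
    calc G.φ (sliceL (G.ψ ∘ₗ G.S.toLinearMap) (G.T₂ (c ⊗ₜ G.S a)) * x)
        = (G.φ ∘ₗ LinearMap.mulRight ℂ x)
            (sliceL (G.ψ ∘ₗ G.S.toLinearMap) (G.T₂ (c ⊗ₜ G.S a))) := rfl
      _ = G.ψ (G.S (c * G.lact (G.F x) (G.S a))) := by
          rw [apply_sliceL, ← apply_sliceR, mul_lact]
          rfl
      _ = (G.φ ∘ₗ LinearMap.mulLeft ℂ (G.S a)) (G.ract (G.Fψ (G.S c)) x) := by
          rw [S_mul, S_lact_mul, apply_sliceR, ← apply_sliceL, ract_Fψ]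
      _ = G.φ (G.S a * G.ract (G.Fψ (G.S c)) x) := rfl
      _ = _ := by
          rw [mul_ract_Fψ, Fψ_apply, apply_sliceL, ← apply_sliceR]
          rfl

theorem exists_φ_mul (a : A) : ∃ b : G.Dual, ∀ x, b.1 x = G.φ (a * x) := by
  have hω : G.ψ ∘ₗ G.S.toLinearMap ≠ 0 := by
    intro h
    refine G.ψ_ne_zero (LinearMap.ext fun a => ?_)
    have := DFunLike.congr_fun h (G.S.symm a)
    simpa using this
  obtain ⟨z, rfl⟩ := sliceL_surjective (N := A) hω a
  obtain ⟨u, rfl⟩ := G.T₂.surjective z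
  exact G.exists_φ_mul_aux u

/-- The bijection `a ↦ φ(a ·)` of `A` onto its dual. -/
def Fl : A ≃ₗ[ℂ] G.Dual :=
  LinearEquiv.ofBijective
    { toFun := fun c => (G.exists_φ_mul c).choose
      map_add' := fun c d => G.dual_ext fun x => by
        refine ((G.exists_φ_mul _).choose_spec x).trans ?_
        rw [add_mul, map_add, ← (G.exists_φ_mul c).choose_spec, ← (G.exists_φ_mul d).choose_spec]
        rfl
      map_smul' := fun r c => G.dual_ext fun x => by
        refine ((G.exists_φ_mul _).choose_spec x).trans ?_
        rw [smul_mul_assoc, map_smul, ← (G.exists_φ_mul c).choose_spec]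
        rfl }
    (by
      constructor
      · rw [← LinearMap.ker_eq_bot, LinearMap.ker_eq_bot']
        intro c hc
        refine G.eq_zero_of_φ_mul fun x => ?_
        rw [← (G.exists_φ_mul c).choose_spec x, show (G.exists_φ_mul c).choose = 0 from hc]
        rfl
      · intro b
        obtain ⟨a, rfl⟩ := G.F.surjective b
        -- Conjugating φ(a* ·) = φ(· d) gives φ(· a) = φ(d* ·).
        obtain ⟨b, hb⟩ := G.exists_φ_mul (star a)
        obtain ⟨d, rfl⟩ := G.F.surjective b
        refine ⟨star d, G.dual_ext fun x => ?_⟩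
        refine ((G.exists_φ_mul _).choose_spec x).trans ?_
        have := congrArg star (hb (star x))
        rw [F_apply, ← φ_star, ← φ_star] at this
        simpa using this)

theorem Fl_apply (c x : A) : (G.Fl c).1 x = G.φ (c * x) := (G.exists_φ_mul c).choose_spec x

end AlgebraicQuantumGroup

/-! ### Constructing a multiplier Hopf algebra from `T₁` and `T₂` -/

section OfEquivs

variable {R : Type*} [NonUnitalRing R] [Module ℂ R] [IsScalarTower ℂ R R] [SMulCommClass ℂ R R]

theorem tensor_mul_tmul (z : R ⊗[ℂ] R) (p q : R) : z * (p ⊗ₜ q) =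
    (LinearMap.mulRight ℂ p).rTensor R ((LinearMap.mulRight ℂ q).lTensor R z) := by
  induction z with
  | zero => simp
  | add x y hx hy => simp only [add_mul, map_add, hx, hy]
  | tmul m w => simp

theorem tmul_mul_tensor (z : R ⊗[ℂ] R) (p q : R) : (p ⊗ₜ q) * z =
    (LinearMap.mulLeft ℂ q).lTensor R ((LinearMap.mulLeft ℂ p).rTensor R z) := by
  induction z with
  | zero => simp
  | add x y hx hy => simp only [mul_add, map_add, hx, hy]
  | tmul m w => simp

theorem tensor_eq_of_mul_right (hR : ∀ a : R, (∀ b, a * b = 0) → a = 0) {z w : R ⊗[ℂ] R}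
    (h : ∀ y, z * y = w * y) : z = w := by
  rw [← sub_eq_zero]
  refine lTensor_separates (fun a : R => LinearMap.mulRight ℂ a) hR _ fun q => ?_
  refine rTensor_separates (fun a : R => LinearMap.mulRight ℂ a) hR _ fun p => ?_
  rw [← tensor_mul_tmul, sub_mul, h, sub_self]

/-- The right part is determined through (xm)y = x(my) and non-degeneracy. -/
theorem multiplier_ext_left (hR : ∀ a : R, (∀ b, a * b = 0) → a = 0)
    {m n : Multiplier (R ⊗[ℂ] R)} (h : ∀ x, m.left x = n.left x) : m = n :=
  ext' h fun x => tensor_eq_of_mul_right hR fun y => by rw [balanced, balanced, h]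

variable (T₁ T₂ : R ⊗[ℂ] R ≃ₗ[ℂ] R ⊗[ℂ] R)

/-- The left part `p ⊗ q ↦ T₁(b ⊗ q)(p ⊗ 1)` of `Δ(b)`. -/
def comulLeftOf (b : R) : R ⊗[ℂ] R →ₗ[ℂ] R ⊗[ℂ] R :=
  TensorProduct.lift (LinearMap.mk₂ ℂ
    (fun p q => (LinearMap.mulRight ℂ p).rTensor R (T₁ (b ⊗ₜ q)))
    (fun p p' q => by
      rw [← LinearMap.add_apply, ← LinearMap.rTensor_add]; congr 2; ext x; simp [mul_add])
    (fun c p q => by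
      rw [← LinearMap.smul_apply, ← LinearMap.rTensor_smul]; congr 2; ext x; simp [mul_smul_comm])
    (fun p q q' => by simp only [TensorProduct.tmul_add, map_add])
    (fun c p q => by simp only [TensorProduct.tmul_smul, map_smul]))

/-- The right part `p ⊗ q ↦ (1 ⊗ q)T₂(p ⊗ b)` of `Δ(b)`. -/
def comulRightOf (b : R) : R ⊗[ℂ] R →ₗ[ℂ] R ⊗[ℂ] R :=
  TensorProduct.lift (LinearMap.mk₂ ℂ
    (fun p q => (LinearMap.mulLeft ℂ q).lTensor R (T₂ (p ⊗ₜ b)))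
    (fun p p' q => by simp only [TensorProduct.add_tmul, map_add])
    (fun c p q => by simp only [← TensorProduct.smul_tmul', map_smul])
    (fun p q q' => by
      rw [← LinearMap.add_apply, ← LinearMap.lTensor_add]; congr 2; ext x; simp [add_mul])
    (fun c p q => by
      rw [← LinearMap.smul_apply, ← LinearMap.lTensor_smul]; congr 2; ext x; simp [smul_mul_assoc]))

@[simp] theorem comulLeftOf_tmul (b p q : R) : comulLeftOf T₁ b (p ⊗ₜ q) =
    (LinearMap.mulRight ℂ p).rTensor R (T₁ (b ⊗ₜ q)) := by simp [comulLeftOf]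

@[simp] theorem comulRightOf_tmul (b p q : R) : comulRightOf T₂ b (p ⊗ₜ q) =
    (LinearMap.mulLeft ℂ q).lTensor R (T₂ (p ⊗ₜ b)) := by simp [comulRightOf]

variable {T₁ T₂}

theorem rTensor_lTensor_comm {M N M' N' : Type*} [AddCommGroup M] [Module ℂ M] [AddCommGroup N]
    [Module ℂ N] [AddCommGroup M'] [Module ℂ M'] [AddCommGroup N'] [Module ℂ N']
    (f : M →ₗ[ℂ] M') (g : N →ₗ[ℂ] N') (z : M ⊗[ℂ] N) :
    f.rTensor N' (g.lTensor M z) = g.lTensor M' (f.rTensor N z) := by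
  rw [← LinearMap.comp_apply, ← LinearMap.comp_apply, LinearMap.rTensor_comp_lTensor,
    LinearMap.lTensor_comp_rTensor]

theorem comulLeftOf_mul
    (h₁ : ∀ b p q, T₁ (b ⊗ₜ (p * q)) = (LinearMap.mulRight ℂ q).lTensor R (T₁ (b ⊗ₜ p)))
    (b : R) (x y : R ⊗[ℂ] R) : comulLeftOf T₁ b (x * y) = comulLeftOf T₁ b x * y := by
  induction x with
  | zero => simp
  | add x x' hx hx' => simp only [add_mul, map_add, hx, hx']
  | tmul p q =>
    induction y with
    | zero => simp
    | add y y' hy hy' => simp only [mul_add, map_add, hy, hy']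
    | tmul r s =>
      simp only [Algebra.TensorProduct.tmul_mul_tmul, comulLeftOf_tmul, tensor_mul_tmul, h₁,
        rTensor_lTensor_comm, LinearMap.mulRight_mul, LinearMap.rTensor_comp,
        LinearMap.comp_apply]

theorem comulRightOf_mul
    (h₂ : ∀ b p q, T₂ ((p * q) ⊗ₜ b) = (LinearMap.mulLeft ℂ p).rTensor R (T₂ (q ⊗ₜ b)))
    (b : R) (x y : R ⊗[ℂ] R) : comulRightOf T₂ b (x * y) = x * comulRightOf T₂ b y := by
  induction x with
  | zero => simp
  | add x x' hx hx' => simp only [add_mul, map_add, hx, hx']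
  | tmul p q =>
    induction y with
    | zero => simp
    | add y y' hy hy' => simp only [mul_add, map_add, hy, hy']
    | tmul r s =>
      simp only [Algebra.TensorProduct.tmul_mul_tmul, comulRightOf_tmul, tmul_mul_tensor, h₂,
        rTensor_lTensor_comm, LinearMap.mulLeft_mul, LinearMap.lTensor_comp,
        LinearMap.comp_apply]

theorem comulRightOf_mul_eq
    (h₃ : ∀ b p q, (LinearMap.mulRight ℂ q).lTensor R (T₂ (p ⊗ₜ b)) =
      (LinearMap.mulLeft ℂ p).rTensor R (T₁ (b ⊗ₜ q)))
    (b : R) (x y : R ⊗[ℂ] R) : comulRightOf T₂ b x * y = x * comulLeftOf T₁ b y := by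
  have h : ∀ p q : R, LinearMap.mulRight ℂ p ∘ₗ LinearMap.mulLeft ℂ q =
      LinearMap.mulLeft ℂ q ∘ₗ LinearMap.mulRight ℂ p := fun p q => by ext x; simp [mul_assoc]
  induction x with
  | zero => simp
  | add x x' hx hx' => simp only [add_mul, map_add, hx, hx']
  | tmul p q =>
    induction y with
    | zero => simp
    | add y y' hy hy' => simp only [mul_add, map_add, hy, hy']
    | tmul r s =>
      rw [comulRightOf_tmul, comulLeftOf_tmul, tensor_mul_tmul, tmul_mul_tensor,
        ← LinearMap.comp_apply (LinearMap.lTensor R _), ← LinearMap.lTensor_comp, h,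
        LinearMap.lTensor_comp, LinearMap.comp_apply, h₃, rTensor_lTensor_comm,
        ← LinearMap.comp_apply (LinearMap.rTensor R _), ← LinearMap.rTensor_comp, h,
        LinearMap.rTensor_comp, LinearMap.comp_apply]

/-- The multiplier `Δ(b)` with `Δ(b)(1 ⊗ q) = T₁(b ⊗ q)` and `(p ⊗ 1)Δ(b) = T₂(p ⊗ b)`. -/
def comulOf
    (h₁ : ∀ b p q, T₁ (b ⊗ₜ (p * q)) = (LinearMap.mulRight ℂ q).lTensor R (T₁ (b ⊗ₜ p)))
    (h₂ : ∀ b p q, T₂ ((p * q) ⊗ₜ b) = (LinearMap.mulLeft ℂ p).rTensor R (T₂ (q ⊗ₜ b)))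
    (h₃ : ∀ b p q, (LinearMap.mulRight ℂ q).lTensor R (T₂ (p ⊗ₜ b)) =
      (LinearMap.mulLeft ℂ p).rTensor R (T₁ (b ⊗ₜ q))) (b : R) : Multiplier (R ⊗[ℂ] R) :=
  ⟨(comulLeftOf T₁ b, MulOpposite.op (comulRightOf T₂ b)),
    comulLeftOf_mul h₁ b, comulRightOf_mul h₂ b, comulRightOf_mul_eq h₃ b⟩

/-- A multiplier Hopf algebra from its maps `T₁` and `T₂`. -/
def MultiplierHopfAlgebra.ofEquivs
    (nondeg_left : ∀ a : R, (∀ b, a * b = 0) → a = 0)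
    (nondeg_right : ∀ a : R, (∀ b, b * a = 0) → a = 0)
    (hmul : Function.Surjective (LinearMap.mul' ℂ R))
    (T₁ T₂ : R ⊗[ℂ] R ≃ₗ[ℂ] R ⊗[ℂ] R)
    (h₁ : ∀ b p q, T₁ (b ⊗ₜ (p * q)) = (LinearMap.mulRight ℂ q).lTensor R (T₁ (b ⊗ₜ p)))
    (h₂ : ∀ b p q, T₂ ((p * q) ⊗ₜ b) = (LinearMap.mulLeft ℂ p).rTensor R (T₂ (q ⊗ₜ b)))
    (h₃ : ∀ b p q, (LinearMap.mulRight ℂ q).lTensor R (T₂ (p ⊗ₜ b)) =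
      (LinearMap.mulLeft ℂ p).rTensor R (T₁ (b ⊗ₜ q)))
    (h₄ : ∀ b b' d, T₁ ((b * b') ⊗ₜ d) = comulLeftOf T₁ b (T₁ (b' ⊗ₜ d)))
    (coassoc : ∀ a b c,
      T₂.toLinearMap.rTensor R ((TensorProduct.assoc ℂ R R R).symm (a ⊗ₜ[ℂ] T₁ (b ⊗ₜ[ℂ] c))) =
      (TensorProduct.assoc ℂ R R R).symm
        (T₁.toLinearMap.lTensor R (TensorProduct.assoc ℂ R R R (T₂ (a ⊗ₜ[ℂ] b) ⊗ₜ[ℂ] c)))) :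
    MultiplierHopfAlgebra R where
  nondeg_left := nondeg_left
  nondeg_right := nondeg_right
  Δ :=
    { toFun := comulOf h₁ h₂ h₃
      map_smul' := fun c b => multiplier_ext_left nondeg_left fun x => by
        change comulLeftOf T₁ (c • b) x = c • comulLeftOf T₁ b x
        induction x with
        | zero => simp
        | add x y hx hy => simp only [map_add, smul_add, hx, hy]
        | tmul p q => simp [← TensorProduct.smul_tmul']
      map_zero' := multiplier_ext_left nondeg_left fun x => by
        change comulLeftOf T₁ 0 x = 0
        induction x with
        | zero => simp
        | add x y hx hy => simp only [map_add, hx, hy, add_zero]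
        | tmul p q => simp
      map_add' := fun b b' => multiplier_ext_left nondeg_left fun x => by
        change comulLeftOf T₁ (b + b') x = comulLeftOf T₁ b x + comulLeftOf T₁ b' x
        induction x with
        | zero => simp
        | add x y hx hy => simp only [map_add, hx, hy]; abel
        | tmul p q => simp [TensorProduct.add_tmul]
      map_mul' := fun b b' => multiplier_ext_left nondeg_left fun x => by
        change comulLeftOf T₁ (b * b') x = comulLeftOf T₁ b (comulLeftOf T₁ b' x)
        induction x with
        | zero => simp
        | add x y hx hy => simp only [map_add, hx, hy]
        | tmul p q =>
          refine tensor_eq_of_mul_right nondeg_left fun y => ?_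
          rw [comulLeftOf_tmul, h₄, comulLeftOf_tmul, ← comulLeftOf_mul h₁]
          -- `h₄` covers Δ(bb')(1 ⊗ q) only; the extra factor p ⊗ 1 is moved onto the test element
          -- y.
          have h : ∀ (z : R ⊗[ℂ] R) y, (LinearMap.mulRight ℂ p).rTensor R z * y =
              z * (LinearMap.mulLeft ℂ p).rTensor R y := by
            intro z y
            exact balanced (inl p) z y
          rw [h, h, comulLeftOf_mul h₁] }
  T₁ := T₁
  T₂ := T₂
  T₁_spec := fun a a' => multiplier_ext_left nondeg_left fun x => by
    change comulLeftOf T₁ a ((LinearMap.mulLeft ℂ a').lTensor R x) = T₁ (a ⊗ₜ a') * x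
    induction x with
    | zero => simp
    | add x y hx hy => simp only [map_add, mul_add, hx, hy]
    | tmul p q => simp [h₁, tensor_mul_tmul]
  T₂_spec := fun a a' => multiplier_ext_left nondeg_left fun x => by
    change (LinearMap.mulLeft ℂ a).rTensor R (comulLeftOf T₁ a' x) = T₂ (a ⊗ₜ a') * x
    induction x with
    | zero => simp
    | add x y hx hy => simp only [map_add, mul_add, hx, hy]
    | tmul p q =>
      rw [comulLeftOf_tmul, tensor_mul_tmul, h₃, ← LinearMap.comp_apply, ← LinearMap.comp_apply,
        ← LinearMap.rTensor_comp, ← LinearMap.rTensor_comp]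
      congr 2
      ext x
      simp [mul_assoc]
  nondeg_comul := by
    rw [eq_top_iff]
    rintro w -
    induction w with
    | zero => exact zero_mem _
    | add x y hx hy => exact add_mem hx hy
    | tmul x y =>
      obtain ⟨u, rfl⟩ := hmul x
      induction u with
      | zero => simp
      | add x y hx hy => simp only [map_add, TensorProduct.add_tmul]; exact add_mem hx hy
      | tmul x p =>
        obtain ⟨v, hv⟩ := T₁.surjective (x ⊗ₜ y)
        have h : LinearMap.mul' ℂ R (x ⊗ₜ p) ⊗ₜ[ℂ] y =
            (LinearMap.mulRight ℂ p).rTensor R (T₁ v) := by rw [hv]; simp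
        rw [h]
        clear h hv
        induction v with
        | zero => simp
        | add x y hx hy => simp only [map_add]; exact add_mem hx hy
        | tmul a q => exact Submodule.subset_span ⟨a, p ⊗ₜ q, comulLeftOf_tmul T₁ a p q⟩
  coassoc := coassoc

end OfEquivs

namespace AlgebraicQuantumGroup

open MultiplierHopfAlgebra

variable {A : Type*} [NonUnitalRing A] [StarRing A] [Module ℂ A]
    [IsScalarTower ℂ A A] [SMulCommClass ℂ A A] [StarModule ℂ A] (G : AlgebraicQuantumGroup A)

/-! ### The dual multiplier Hopf algebra -/

theorem tensorFun_congr {M N M' N' : Type*} [AddCommGroup M] [Module ℂ M] [AddCommGroup N]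
    [Module ℂ N] [AddCommGroup M'] [Module ℂ M'] [AddCommGroup N'] [Module ℂ N']
    (e : M ≃ₗ[ℂ] M') (e' : N ≃ₗ[ℂ] N') (f : Module.Dual ℂ M') (g : Module.Dual ℂ N')
    (z : M ⊗[ℂ] N) : tensorFun f g (TensorProduct.congr e e' z) =
      tensorFun (f ∘ₗ e.toLinearMap) (g ∘ₗ e'.toLinearMap) z := by
  induction z with
  | zero => simp
  | add x y hx hy => simp only [map_add, hx, hy]
  | tmul p q => simp

theorem tensorFun_comm {M N : Type*} [AddCommGroup M] [Module ℂ M] [AddCommGroup N]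
    [Module ℂ N] (f : Module.Dual ℂ M) (g : Module.Dual ℂ N)
    (z : N ⊗[ℂ] M) : tensorFun f g (TensorProduct.comm ℂ N M z) = tensorFun g f z := by
  induction z with
  | zero => simp
  | add x y hx hy => simp only [map_add, hx, hy]
  | tmul p q => simp [mul_comm]

/-- Evaluation of the elements of the dual at `x`. -/
def ev : A →ₗ[ℂ] Module.Dual ℂ G.Dual := LinearMap.flip G.Dual.subtype

@[simp] theorem ev_apply (x : A) (b : G.Dual) : G.ev x b = b.1 x := rfl

theorem eq_zero_of_ev (b : G.Dual) (h : ∀ x, G.ev x b = 0) : b = 0 := G.dual_ext h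

theorem eq_of_sliceR_ev {X : Type*} [AddCommGroup X] [Module ℂ X] {z w : X ⊗[ℂ] G.Dual}
    (h : ∀ y, sliceR (G.ev y) z = sliceR (G.ev y) w) : z = w :=
  sliceR_separates (fun y => G.ev y) G.eq_zero_of_ev h

theorem eq_of_tensorFun_ev {z w : G.Dual ⊗[ℂ] G.Dual}
    (h : ∀ x y, tensorFun (G.ev x) (G.ev y) z = tensorFun (G.ev x) (G.ev y) w) : z = w :=
  G.eq_of_sliceR_ev fun y => G.dual_ext fun x => by
    have := h x y
    rwa [← apply_sliceR, ← apply_sliceR] at this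

/-- `T₁` of the dual. -/
def dualT₁ : G.Dual ⊗[ℂ] G.Dual ≃ₗ[ℂ] G.Dual ⊗[ℂ] G.Dual :=
  (TensorProduct.congr (G.S.symm ≪≫ₗ G.Fl) G.F).symm ≪≫ₗ G.V ≪≫ₗ
    TensorProduct.congr (G.S.symm ≪≫ₗ G.Fl) G.F

/-- `T₂` of the dual. -/
def dualT₂ : G.Dual ⊗[ℂ] G.Dual ≃ₗ[ℂ] G.Dual ⊗[ℂ] G.Dual :=
  (TensorProduct.congr G.Fψ G.F).symm ≪≫ₗ G.T₁.symm ≪≫ₗ TensorProduct.congr G.Fψ G.F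

/-- The map `b ⊗ b' ↦ Δ(b')(b ⊗ 1)` of the dual. -/
def dualV : G.Dual ⊗[ℂ] G.Dual ≃ₗ[ℂ] G.Dual ⊗[ℂ] G.Dual :=
  (TensorProduct.congr G.F G.F).symm ≪≫ₗ TensorProduct.comm ℂ A A ≪≫ₗ G.V.symm ≪≫ₗ
    TensorProduct.comm ℂ A A ≪≫ₗ TensorProduct.congr G.F G.F

theorem ev_F (x : A) : G.ev x ∘ₗ G.F.toLinearMap = G.φ ∘ₗ LinearMap.mulLeft ℂ x := rfl

theorem ev_Fψ (x : A) : G.ev x ∘ₗ G.Fψ.toLinearMap = G.ψ ∘ₗ LinearMap.mulLeft ℂ x :=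
  LinearMap.ext fun c => G.Fψ_apply c x

/-- The right side is ⟨x ⊗ y, Δ_B(b)(1 ⊗ b')⟩ for the opposite coproduct, as b' moves onto y. For b
= φ(S⁻¹(c) ·) and b' = φ(· d), strong left invariance identifies it with V(c ⊗ d); this explains the
choice of `dualT₁`. -/
theorem ev_dualT₁ (b b' : G.Dual) (x y : A) :
    tensorFun (G.ev x) (G.ev y) (G.dualT₁ (b ⊗ₜ b')) = b.1 (G.lact b' y * x) := by
  obtain ⟨c, rfl⟩ := (G.S.symm ≪≫ₗ G.Fl).surjective b
  obtain ⟨d, rfl⟩ := G.F.surjective b'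
  have h : G.dualT₁ ((G.S.symm ≪≫ₗ G.Fl) c ⊗ₜ G.F d) =
      TensorProduct.congr (G.S.symm ≪≫ₗ G.Fl) G.F (G.V (c ⊗ₜ d)) := by
    simp [dualT₁]
  rw [h, tensorFun_congr, ev_F, ← apply_sliceR, ← S_lact_mul]
  simp [Fl_apply, S_symm_mul, mul_assoc]

/-- Here strong right invariance, with b = ψ(· c), yields T₁⁻¹. -/
theorem ev_dualT₂ (b b' : G.Dual) (x y : A) :
    tensorFun (G.ev x) (G.ev y) (G.dualT₂ (b ⊗ₜ b')) = b'.1 (y * G.ract b x) := by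
  obtain ⟨c, rfl⟩ := G.Fψ.surjective b
  obtain ⟨d, rfl⟩ := G.F.surjective b'
  have h : G.dualT₂ (G.Fψ c ⊗ₜ G.F d) =
      TensorProduct.congr G.Fψ G.F (G.T₁.symm (c ⊗ₜ d)) := by
    simp [dualT₂]
  rw [h, tensorFun_congr, ev_F, ev_Fψ, ← apply_sliceL, ← ract_Fψ_mul]
  simp [mul_assoc]

theorem ev_dualV (b b' : G.Dual) (x y : A) :
    tensorFun (G.ev x) (G.ev y) (G.dualV (b ⊗ₜ b')) = b'.1 (y * G.lact b x) := by
  obtain ⟨d, rfl⟩ := G.F.surjective b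
  obtain ⟨c, rfl⟩ := G.F.surjective b'
  have h : G.dualV (G.F d ⊗ₜ G.F c) =
      TensorProduct.congr G.F G.F (TensorProduct.comm ℂ A A (G.V.symm (c ⊗ₜ d))) := by
    simp [dualV]
  rw [h, tensorFun_congr, tensorFun_comm, ev_F, ev_F, ← apply_sliceR, sliceR_V_symm,
    sliceR_left_comul', ← lact_F]
  simp [mul_assoc]

theorem sliceR_dualT₁ (b b' : G.Dual) (y x : A) :
    (sliceR (G.ev y) (G.dualT₁ (b ⊗ₜ b'))).1 x = b.1 (G.lact b' y * x) := by
  rw [← ev_dualT₁, ← apply_sliceR, ev_apply]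

theorem ev_mulRight (c : G.Dual) (x : A) :
    G.ev x ∘ₗ LinearMap.mulRight ℂ c = G.ev (G.lact c x) :=
  LinearMap.ext fun b => G.mul_apply_lact b c x

theorem ev_mulLeft (c : G.Dual) (x : A) :
    G.ev x ∘ₗ LinearMap.mulLeft ℂ c = G.ev (G.ract c x) :=
  LinearMap.ext fun b => G.mul_apply_ract c b x

theorem tensorFun_rTensor {M N M' : Type*} [AddCommGroup M] [Module ℂ M] [AddCommGroup N]
    [Module ℂ N] [AddCommGroup M'] [Module ℂ M'] (f : Module.Dual ℂ M') (g : Module.Dual ℂ N)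
    (h : M →ₗ[ℂ] M') (z : M ⊗[ℂ] N) :
    tensorFun f g (h.rTensor N z) = tensorFun (f ∘ₗ h) g z := by
  rw [← apply_sliceL, ← apply_sliceL, sliceL_comp_rTensor]

theorem tensorFun_lTensor {M N N' : Type*} [AddCommGroup M] [Module ℂ M] [AddCommGroup N]
    [Module ℂ N] [AddCommGroup N'] [Module ℂ N'] (f : Module.Dual ℂ M) (g : Module.Dual ℂ N')
    (h : N →ₗ[ℂ] N') (z : M ⊗[ℂ] N) :
    tensorFun f g (h.lTensor M z) = tensorFun f (g ∘ₗ h) z := by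
  rw [← apply_sliceR, ← apply_sliceR, sliceR_comp_lTensor]

theorem dual_nondeg_left (b : G.Dual) (h : ∀ c, b * c = 0) : b = 0 := by
  apply Subtype.ext
  refine G.hom_ext_lact fun c y => ?_
  rw [← mul_apply_lact, h]
  rfl

theorem dual_nondeg_right (b : G.Dual) (h : ∀ c, c * b = 0) : b = 0 := by
  apply Subtype.ext
  refine G.hom_ext_ract fun c y => ?_
  rw [← mul_apply_ract, h]
  rfl

/-- Since V⁻¹ is onto, this formula yields B² = B. -/
theorem F_mul_F (c d : A) : G.F c * G.F d = G.F (sliceL G.φ (G.V.symm (c ⊗ₜ d))) := by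
  refine G.dual_ext fun x => ?_
  rw [mul_apply_lact, F_apply, lact_F, ← sliceR_left_comul', ← sliceR_V_symm, F_apply,
    apply_sliceR]
  exact (apply_sliceL G.φ (G.φ ∘ₗ LinearMap.mulLeft ℂ x) _).symm

theorem dual_mul_surjective : Function.Surjective (LinearMap.mul' ℂ G.Dual) := by
  intro b
  obtain ⟨a, rfl⟩ := G.F.surjective b
  obtain ⟨z, rfl⟩ := sliceL_surjective (M := A) G.φ_ne_zero a
  obtain ⟨u, rfl⟩ := G.V.symm.surjective z
  refine ⟨TensorProduct.congr G.F G.F u, ?_⟩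
  induction u with
  | zero => simp
  | add x y hx hy => simp only [map_add, hx, hy]
  | tmul c d => simp [F_mul_F]

/-- For `b = φ(· e)` the functional `b(Y ·)` acts by
`x ↦ (ι ⊗ φ(Y ·))(Δ(x)(1 ⊗ e))`. -/
theorem lact_of_eq (e Y x : A) (g : G.Dual) (hg : ∀ x, g.1 x = (G.F e).1 (Y * x)) :
    G.lact g x = sliceR (G.φ ∘ₗ LinearMap.mulLeft ℂ Y) (G.T₁ (x ⊗ₜ e)) := by
  refine G.eq_of_mul_right fun c => ?_
  have h : g.1 = (G.φ ∘ₗ LinearMap.mulLeft ℂ Y) ∘ₗ LinearMap.mulRight ℂ e := by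
    ext x
    simp [hg, mul_assoc]
  rw [lact_mul, h, ← sliceR_comp_lTensor, lTensor_V G.V_spec, left_comul_tmul, sliceR_rTensor]
  rfl

theorem rTensor_lact_dualT₁ (e x : A) (d : G.Dual) :
    (G.lact.flip x).rTensor _ (G.dualT₁ (G.F e ⊗ₜ d)) =
      (LinearMap.mulRight ℂ d ∘ₗ G.F.toLinearMap).lTensor A (G.T₁ (x ⊗ₜ e)) := by
  refine G.eq_of_sliceR_ev fun y => ?_
  rw [sliceR_rTensor, LinearMap.flip_apply, G.lact_of_eq e (G.lact d y) x _
    (fun x => G.sliceR_dualT₁ _ _ _ _), sliceR_comp_lTensor, ← LinearMap.comp_assoc, ev_mulRight,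
    ev_F]

/-- The map `u ⊗ q ↦ (q ⬝ y) u`. -/
def lactMul (y : A) : A ⊗[ℂ] G.Dual →ₗ[ℂ] A :=
  TensorProduct.lift ((LinearMap.mul ℂ A ∘ₗ G.lact.flip y).flip)

@[simp] theorem lactMul_tmul (y u : A) (q : G.Dual) : G.lactMul y (u ⊗ₜ q) = G.lact q y * u := by
  simp [lactMul]

theorem lactMul_lTensor (y : A) (d : G.Dual) (z : A ⊗[ℂ] A) :
    G.lactMul y ((LinearMap.mulRight ℂ d ∘ₗ G.F.toLinearMap).lTensor A z) =
      sliceR G.φ ((G.Δ (G.lact d y)).left z) := by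
  induction z with
  | zero => simp
  | add x y hx hy => simp only [map_add, hx, hy]
  | tmul r s =>
    rw [LinearMap.lTensor_tmul, lactMul_tmul, sliceR_left_comul', ← lact_F, LinearMap.comp_apply,
      LinearMap.mulRight_apply, lact_lact]
    rfl

theorem ev_comulLeftOf (b : G.Dual) (w : G.Dual ⊗[ℂ] G.Dual) (x y : A) :
    tensorFun (G.ev x) (G.ev y) (comulLeftOf G.dualT₁ b w) =
      b.1 (G.lactMul y ((G.lact.flip x).rTensor _ w)) := by
  induction w with
  | zero => simp
  | add x y hx hy => simp only [map_add, hx, hy]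
  | tmul p q =>
    rw [comulLeftOf_tmul, tensorFun_rTensor, ev_mulRight, ev_dualT₁]
    simp

/-- With b' = φ(· e), both sides at x ⊗ y are b(b' ⬝ ((d ⬝ y)x)). Multiplicativity of Δ enters as
Δ(d ⬝ y)T₁(x ⊗ e) = T₁((d ⬝ y)x ⊗ e). -/
theorem dualT₁_mul (b b' d : G.Dual) :
    G.dualT₁ ((b * b') ⊗ₜ d) = comulLeftOf G.dualT₁ b (G.dualT₁ (b' ⊗ₜ d)) := by
  obtain ⟨e, rfl⟩ := G.F.surjective b'
  refine G.eq_of_tensorFun_ev fun x y => ?_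
  rw [ev_dualT₁, ev_comulLeftOf, rTensor_lact_dualT₁, lactMul_lTensor, left_comul_T₁, ← lact_F,
    mul_apply_lact]

/-- At x ⊗ y ⊗ w both sides are b((c ⬝ w)y(x ⬝ a)): associativity of A. -/
theorem dual_coassoc (a b c : G.Dual) :
    G.dualT₂.toLinearMap.rTensor _
        ((TensorProduct.assoc ℂ _ _ _).symm (a ⊗ₜ[ℂ] G.dualT₁ (b ⊗ₜ[ℂ] c))) =
      (TensorProduct.assoc ℂ _ _ _).symm (G.dualT₁.toLinearMap.lTensor _
        (TensorProduct.assoc ℂ _ _ _ (G.dualT₂ (a ⊗ₜ[ℂ] b) ⊗ₜ[ℂ] c))) := by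
  refine G.eq_of_sliceR_ev fun w => G.eq_of_tensorFun_ev fun x y => ?_
  have h₁ : ∀ u : G.Dual ⊗[ℂ] G.Dual, sliceR (G.ev w) (G.dualT₂.toLinearMap.rTensor _
      ((TensorProduct.assoc ℂ _ _ _).symm (a ⊗ₜ[ℂ] u))) =
        G.dualT₂ (a ⊗ₜ sliceR (G.ev w) u) := by
    intro u
    rw [sliceR_rTensor]
    induction u with
    | zero => simp
    | add x y hx hy => simp only [TensorProduct.tmul_add, map_add, hx, hy]
    | tmul p q => simp
  have h₂ : ∀ u : G.Dual ⊗[ℂ] G.Dual, tensorFun (G.ev x) (G.ev y) (sliceR (G.ev w)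
      ((TensorProduct.assoc ℂ _ _ _).symm (G.dualT₁.toLinearMap.lTensor _
        (TensorProduct.assoc ℂ _ _ _ (u ⊗ₜ[ℂ] c))))) =
      tensorFun (G.ev x) (G.ev (G.lact c w * y)) u := by
    intro u
    induction u with
    | zero => simp
    | add x y hx hy => simp only [TensorProduct.add_tmul, map_add, hx, hy]
    | tmul p q =>
      have h₃ : ∀ v : G.Dual ⊗[ℂ] G.Dual, sliceR (G.ev w)
          ((TensorProduct.assoc ℂ _ _ _).symm (p ⊗ₜ v)) = p ⊗ₜ sliceR (G.ev w) v := by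
        intro v
        induction v with
        | zero => simp
        | add x y hx hy => simp only [TensorProduct.tmul_add, map_add, hx, hy]
        | tmul p q => simp
      rw [TensorProduct.assoc_tmul, LinearMap.lTensor_tmul, h₃, tensorFun_tmul, LinearEquiv.coe_coe,
        ev_apply, ev_apply, sliceR_dualT₁]
      simp
  rw [h₁, h₂, ev_dualT₂, ev_dualT₂, sliceR_dualT₁, mul_assoc]

/-- The dual of `A`, as a multiplier Hopf algebra. -/
def dualHopf : MultiplierHopfAlgebra G.Dual :=
  MultiplierHopfAlgebra.ofEquivs G.dual_nondeg_left G.dual_nondeg_right G.dual_mul_surjective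
    G.dualT₁ G.dualT₂
    (fun b p q => G.eq_of_tensorFun_ev fun x y => by
      rw [tensorFun_lTensor, ev_mulRight, ev_dualT₁, ev_dualT₁, lact_lact])
    (fun b p q => G.eq_of_tensorFun_ev fun x y => by
      rw [tensorFun_rTensor, ev_mulLeft, ev_dualT₂, ev_dualT₂, ract_ract])
    (fun b p q => G.eq_of_tensorFun_ev fun x y => by
      rw [tensorFun_rTensor, tensorFun_lTensor, ev_mulLeft, ev_mulRight, ev_dualT₂, ev_dualT₁])
    G.dualT₁_mul G.dual_coassoc

/-- Supplies the hypothesis on `V` in `exists_antipode` for the dual. -/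
theorem dualHopf_V (b b' : G.Dual) :
    G.dualHopf.Δ b' * inl b = ofElem (G.dualV (b ⊗ₜ[ℂ] b')) := by
  refine multiplier_ext_left G.dual_nondeg_left fun x => ?_
  change comulLeftOf G.dualT₁ b' ((LinearMap.mulLeft ℂ b).rTensor _ x) = G.dualV (b ⊗ₜ b') * x
  induction x with
  | zero => simp
  | add x y hx hy => simp only [map_add, mul_add, hx, hy]
  | tmul p q =>
    refine G.eq_of_tensorFun_ev fun x y => ?_
    rw [LinearMap.rTensor_tmul, LinearMap.mulLeft_apply, comulLeftOf_tmul, tensor_mul_tmul,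
      tensorFun_rTensor, tensorFun_rTensor, tensorFun_lTensor, ev_mulRight, ev_mulRight,
      ev_mulRight, ev_dualT₁, ev_dualV, lact_lact]

theorem isOppositeDual : G.IsOppositeDual G.dualHopf := by
  intro b b' x y
  have h : ∀ z : G.Dual ⊗[ℂ] G.Dual, TensorProduct.dualDistrib ℂ A A
      (TensorProduct.map G.Dual.subtype G.Dual.subtype z) (x ⊗ₜ[ℂ] y) =
        tensorFun (G.ev x) (G.ev y) z := by
    intro z
    induction z with
    | zero => simp
    | add x y hx hy => simp only [map_add, LinearMap.add_apply, hx, hy]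
    | tmul p q => simp
  rw [h, ← apply_sliceR b.1 b'.1, ← lact_mul]
  exact G.ev_dualT₁ b b' x y

/-! ### Counit and antipode of the dual -/

theorem dual_nontrivial : Nontrivial G.Dual :=
  have := G.nontrivial
  G.F.toEquiv.symm.nontrivial

/-- The counit of the dual. -/
def εB : Module.Dual ℂ G.Dual :=
  haveI := G.dual_nontrivial
  G.dualHopf.exists_counit.choose

theorem dual_isCounit : G.dualHopf.IsCounit G.εB :=
  haveI := G.dual_nontrivial
  G.dualHopf.exists_counit.choose_spec

/-- The antipode of the dual. -/
def SB : G.Dual ≃ₗ[ℂ] G.Dual :=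
  haveI := G.dual_nontrivial
  (G.dual_isCounit.exists_antipode G.dualHopf_V).choose

theorem dual_isAntipode : G.dualHopf.IsAntipode G.εB G.SB :=
  haveI := G.dual_nontrivial
  (G.dual_isCounit.exists_antipode G.dualHopf_V).choose_spec

/-- The map `a ↦ b(a ·)` from `A` to its dual. -/
def mulLeftFun (b : G.Dual) : A →ₗ[ℂ] G.Dual :=
  G.Fl.toLinearMap ∘ₗ LinearMap.mulLeft ℂ (G.Fl.symm b)

@[simp] theorem mulLeftFun_apply (b : G.Dual) (a x : A) :
    (G.mulLeftFun b a).1 x = b.1 (a * x) := by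
  obtain ⟨c, rfl⟩ := G.Fl.surjective b
  simp [mulLeftFun, Fl_apply, mul_assoc]

/-- The counit of B is evaluation at 1. For a = b' ⬝ y the functional b(a ·) is a slice of Δ_B(b)(1
⊗ b'), so the counit law applies. -/
theorem εB_mulLeftFun (b : G.Dual) (a : A) : G.εB (G.mulLeftFun b a) = b.1 a := by
  have h : G.εB ∘ₗ G.mulLeftFun b = b.1 := by
    refine G.hom_ext_lact fun b' y => ?_
    have h₁ : G.mulLeftFun b (G.lact b' y) = sliceR (G.ev y) (G.dualT₁ (b ⊗ₜ b')) :=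
      G.dual_ext fun x => by rw [mulLeftFun_apply, sliceR_dualT₁]
    have h₂ : sliceL G.εB (G.dualT₁ (b ⊗ₜ b')) = b * b' := G.dual_isCounit.left b b'
    rw [LinearMap.comp_apply, h₁, apply_sliceR, ← apply_sliceL, h₂, ev_apply, mul_apply_lact]
  exact DFunLike.congr_fun h a

theorem ev_dualT₁_symm (b b' : G.Dual) (x y : A) :
    tensorFun (G.ev x) (G.ev y) (G.dualT₁.symm (b ⊗ₜ b')) =
      b.1 (G.S.symm (G.lact b' y) * x) := by
  obtain ⟨c, rfl⟩ := (G.S.symm ≪≫ₗ G.Fl).surjective b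
  obtain ⟨d, rfl⟩ := G.F.surjective b'
  have h : G.dualT₁.symm ((G.S.symm ≪≫ₗ G.Fl) c ⊗ₜ G.F d) =
      TensorProduct.congr (G.S.symm ≪≫ₗ G.Fl) G.F (G.V.symm (c ⊗ₜ d)) := by
    rw [LinearEquiv.symm_apply_eq]
    simp [dualT₁]
  rw [h, tensorFun_congr, ev_F, ← apply_sliceR, sliceR_V_symm, sliceR_left_comul', ← lact_F]
  simp [Fl_apply, S_symm_mul, mul_assoc]

/-- Evaluate S_B(b)b' = (ε_B ⊗ ι)T₁⁻¹(b ⊗ b') at y: by `ev_dualT₁_symm` the first leg is b(S⁻¹(b' ⬝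
y) ·), and ε_B evaluates it at 1. The inverse of S appears because Δ_B is the opposite coproduct. -/
theorem SB_apply (b : G.Dual) (x : A) : (G.SB b).1 x = b.1 (G.S.symm x) := by
  have h : (G.SB b).1 = b.1 ∘ₗ G.S.symm.toLinearMap := by
    refine G.hom_ext_lact fun b' y => ?_
    have h₁ : sliceR (G.ev y) (G.dualT₁.symm (b ⊗ₜ b')) =
        G.mulLeftFun b (G.S.symm (G.lact b' y)) := G.dual_ext fun x => by
      rw [mulLeftFun_apply, ← ev_dualT₁_symm, ← apply_sliceR, ev_apply]
    have h₂ : G.SB b * b' = sliceL G.εB (G.dualT₁.symm (b ⊗ₜ b')) :=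
      G.dual_isAntipode.mul_eq b b'
    rw [← mul_apply_lact, h₂, ← ev_apply, apply_sliceL, ← apply_sliceR, h₁, εB_mulLeftFun]
    rfl
  exact DFunLike.congr_fun h x

theorem SB_mul (b b' : G.Dual) : G.SB (b * b') = G.SB b' * G.SB b :=
  G.dual_isAntipode.map_mul b b'

/-- The transpose of the anti-multiplicativity of S_B. -/
theorem S_lact (b : G.Dual) (y : A) : G.S (G.lact b (G.S.symm y)) = G.ract (G.SB b) y := by
  refine G.eq_of_dual fun g => ?_
  obtain ⟨h, rfl⟩ := G.SB.surjective g
  rw [SB_apply, LinearEquiv.symm_apply_apply, ← mul_apply_lact, ← mul_apply_ract, ← SB_mul,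
    SB_apply]

end AlgebraicQuantumGroup

/-! ### Invertible multipliers -/

section UnitOfEquivs

variable {R : Type*} [NonUnitalRing R] [Module ℂ R] [IsScalarTower ℂ R R] [SMulCommClass ℂ R R]

/-- A multiplier with bijective left and right parts is invertible. -/
def unitOfEquivs (L P : R ≃ₗ[ℂ] R) (hL : ∀ x y, L (x * y) = L x * y)
    (hP : ∀ x y, P (x * y) = x * P y) (hPL : ∀ x y, P x * y = x * L y) : (Multiplier R)ˣ where
  val := ⟨(L.toLinearMap, MulOpposite.op P.toLinearMap), hL, hP, hPL⟩
  inv := ⟨(L.symm.toLinearMap, MulOpposite.op P.symm.toLinearMap),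
    fun x y => by
      apply L.injective
      simp [hL],
    fun x y => by
      apply P.injective
      simp [hP],
    fun x y => by
      have := hPL (P.symm x) (L.symm y)
      simpa using this.symm⟩
  val_inv := ext' (fun x => L.apply_symm_apply x) (fun x => P.symm_apply_apply x)
  inv_val := ext' (fun x => L.symm_apply_apply x) (fun x => P.apply_symm_apply x)

end UnitOfEquivs

namespace AlgebraicQuantumGroup

open MultiplierHopfAlgebra

variable {A : Type*} [NonUnitalRing A] [StarRing A] [Module ℂ A]
    [IsScalarTower ℂ A A] [SMulCommClass ℂ A A] [StarModule ℂ A] (G : AlgebraicQuantumGroup A)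

/-! ### The multiplier `W` -/

/-- The left part of `W`, `W(a ⊗ φ(· d)) = (ι ⊗ F)V⁻¹(a ⊗ d)`. -/
def leftW : A ⊗[ℂ] G.Dual ≃ₗ[ℂ] A ⊗[ℂ] G.Dual :=
  (TensorProduct.congr (LinearEquiv.refl ℂ A) G.F).symm ≪≫ₗ G.V.symm ≪≫ₗ
    TensorProduct.congr (LinearEquiv.refl ℂ A) G.F

/-- The right part of `W`. -/
def rightW : A ⊗[ℂ] G.Dual ≃ₗ[ℂ] A ⊗[ℂ] G.Dual :=
  (TensorProduct.congr G.S G.Fψ).symm ≪≫ₗ TensorProduct.comm ℂ A A ≪≫ₗ G.T₁ ≪≫ₗ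
    TensorProduct.comm ℂ A A ≪≫ₗ TensorProduct.congr G.S G.Fψ

theorem sliceR_congr {M N M' N' : Type*} [AddCommGroup M] [Module ℂ M] [AddCommGroup N]
    [Module ℂ N] [AddCommGroup M'] [Module ℂ M'] [AddCommGroup N'] [Module ℂ N']
    (e : M ≃ₗ[ℂ] M') (e' : N ≃ₗ[ℂ] N') (g : Module.Dual ℂ N') (z : M ⊗[ℂ] N) :
    sliceR g (TensorProduct.congr e e' z) = e (sliceR (g ∘ₗ e'.toLinearMap) z) := by
  induction z with
  | zero => simp
  | add x y hx hy => simp only [map_add, hx, hy]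
  | tmul p q => simp

theorem sliceR_comm {M N : Type*} [AddCommGroup M] [Module ℂ M] [AddCommGroup N]
    [Module ℂ N] (g : Module.Dual ℂ N) (z : N ⊗[ℂ] M) :
    sliceR g (TensorProduct.comm ℂ N M z) = sliceL g z := by
  induction z with
  | zero => simp
  | add x y hx hy => simp only [map_add, hx, hy]
  | tmul p q => simp

theorem sliceR_leftW (a : A) (b : G.Dual) (y : A) :
    sliceR (G.ev y) (G.leftW (a ⊗ₜ b)) = G.lact b y * a := by
  obtain ⟨d, rfl⟩ := G.F.surjective b
  have h : G.leftW (a ⊗ₜ G.F d) =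
      TensorProduct.congr (LinearEquiv.refl ℂ A) G.F (G.V.symm (a ⊗ₜ d)) := by
    simp [leftW]
  rw [h, sliceR_congr, ev_F, sliceR_V_symm, sliceR_left_comul', ← lact_F]
  rfl

/-- Strong left invariance (`S_lact_mul`): W⁻¹ is W with S applied to the first leg. -/
theorem sliceR_leftW_symm (a : A) (b : G.Dual) (y : A) :
    sliceR (G.ev y) (G.leftW.symm (a ⊗ₜ b)) = G.S (G.lact b y) * a := by
  obtain ⟨d, rfl⟩ := G.F.surjective b
  have h : G.leftW.symm (a ⊗ₜ G.F d) =
      TensorProduct.congr (LinearEquiv.refl ℂ A) G.F (G.V (a ⊗ₜ d)) := by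
    rw [LinearEquiv.symm_apply_eq]
    simp [leftW]
  rw [h, sliceR_congr, ev_F, S_lact_mul]
  rfl

theorem sliceR_rightW (a : A) (b : G.Dual) (y : A) :
    sliceR (G.ev y) (G.rightW (a ⊗ₜ b)) = a * G.ract b y := by
  obtain ⟨a, rfl⟩ := G.S.surjective a
  obtain ⟨c, rfl⟩ := G.Fψ.surjective b
  have h : G.rightW (G.S a ⊗ₜ G.Fψ c) =
      TensorProduct.congr G.S G.Fψ (TensorProduct.comm ℂ A A (G.T₁ (c ⊗ₜ a))) := by
    simp [rightW]
  rw [h, sliceR_congr, ev_Fψ, sliceR_comm, mul_ract_Fψ, sliceL_lTensor]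
  rfl

theorem sliceR_mul_tmul (z : A ⊗[ℂ] G.Dual) (a : A) (b : G.Dual) (y : A) :
    sliceR (G.ev y) (z * (a ⊗ₜ b)) = sliceR (G.ev (G.lact b y)) z * a := by
  induction z with
  | zero => simp
  | add x y hx hy => simp only [add_mul, map_add, hx, hy]
  | tmul p q => simp [mul_apply_lact, smul_mul_assoc]

theorem sliceR_tmul_mul (z : A ⊗[ℂ] G.Dual) (a : A) (b : G.Dual) (y : A) :
    sliceR (G.ev y) ((a ⊗ₜ b) * z) = a * sliceR (G.ev (G.ract b y)) z := by
  induction z with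
  | zero => simp
  | add x y hx hy => simp only [mul_add, map_add, hx, hy]
  | tmul p q => simp [mul_apply_ract, mul_smul_comm]

theorem leftW_mul (x y : A ⊗[ℂ] G.Dual) : G.leftW (x * y) = G.leftW x * y := by
  induction x with
  | zero => simp
  | add x x' hx hx' => simp only [add_mul, map_add, hx, hx']
  | tmul p q =>
    induction y with
    | zero => simp
    | add y y' hy hy' => simp only [mul_add, map_add, hy, hy']
    | tmul r s =>
      refine G.eq_of_sliceR_ev fun y => ?_
      rw [Algebra.TensorProduct.tmul_mul_tmul, sliceR_leftW, sliceR_mul_tmul, sliceR_leftW,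
        lact_lact, mul_assoc]

theorem rightW_mul (x y : A ⊗[ℂ] G.Dual) : G.rightW (x * y) = x * G.rightW y := by
  induction x with
  | zero => simp
  | add x x' hx hx' => simp only [add_mul, map_add, hx, hx']
  | tmul p q =>
    induction y with
    | zero => simp
    | add y y' hy hy' => simp only [mul_add, map_add, hy, hy']
    | tmul r s =>
      refine G.eq_of_sliceR_ev fun y => ?_
      rw [Algebra.TensorProduct.tmul_mul_tmul, sliceR_rightW, sliceR_tmul_mul, sliceR_rightW,
        ract_ract, mul_assoc]

theorem rightW_mul_eq (x y : A ⊗[ℂ] G.Dual) : G.rightW x * y = x * G.leftW y := by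
  induction x with
  | zero => simp
  | add x x' hx hx' => simp only [add_mul, map_add, hx, hx']
  | tmul p q =>
    induction y with
    | zero => simp
    | add y y' hy hy' => simp only [mul_add, map_add, hy, hy']
    | tmul r s =>
      refine G.eq_of_sliceR_ev fun y => ?_
      rw [sliceR_mul_tmul, sliceR_rightW, sliceR_tmul_mul, sliceR_leftW, lact_ract, mul_assoc]

/-- The multiplier `W ∈ M(A ⊗ B)`. -/
def W : (Multiplier (A ⊗[ℂ] G.Dual))ˣ :=
  unitOfEquivs G.leftW G.rightW G.leftW_mul G.rightW_mul G.rightW_mul_eq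

theorem left_W (p : A ⊗[ℂ] G.Dual) : (G.W : Multiplier (A ⊗[ℂ] G.Dual)).left p = G.leftW p := rfl

theorem left_W_inv (p : A ⊗[ℂ] G.Dual) :
    (↑G.W⁻¹ : Multiplier (A ⊗[ℂ] G.Dual)).left p = G.leftW.symm p := rfl

/-- The map `b ↦ λ(b)`. -/
def lam : G.Dual →ₗ[ℂ] Module.End ℂ A := G.ract ∘ₗ G.SB.toLinearMap

theorem isConvolution : G.IsConvolution G.S G.lam := by
  intro b x a'
  have h : (G.SB b).1 = b.1 ∘ₗ G.S.symm.toLinearMap := LinearMap.ext fun x => G.SB_apply b x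
  rw [← h, ← ract_mul]
  rfl

@[simp] theorem tensorAction_tmul (a : A) (b : G.Dual) (x y : A) :
    G.tensorAction G.lam (a ⊗ₜ b) (x ⊗ₜ y) = (a * x) ⊗ₜ G.ract (G.SB b) y := by
  simp [tensorAction, lam]

theorem span_tensorAction :
    Submodule.span ℂ {w | ∃ p z, G.tensorAction G.lam p z = w} = ⊤ := by
  have := G.nontrivial
  rw [eq_top_iff]
  rintro w -
  induction w with
  | zero => exact zero_mem _
  | add x y hx hy => exact add_mem hx hy
  | tmul x y =>
    obtain ⟨u, rfl⟩ := G.isCounit.mul'_surjective x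
    obtain ⟨z, rfl⟩ := sliceL_surjective (M := A) G.φ_ne_zero y
    obtain ⟨v, rfl⟩ := G.V.surjective z
    induction u with
    | zero => simp
    | add x y hx hy => simp only [map_add, TensorProduct.add_tmul]; exact add_mem hx hy
    | tmul a x =>
      induction v with
      | zero => simp
      | add x y hx hy => simp only [map_add, TensorProduct.tmul_add]; exact add_mem hx hy
      | tmul c y =>
        obtain ⟨b, hb⟩ := G.SB.surjective (G.F c)
        refine Submodule.subset_span ⟨a ⊗ₜ b, x ⊗ₜ y, ?_⟩
        rw [tensorAction_tmul, hb, ract_F]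
        simp

/-- Slicing the second leg with g ∈ B turns both sides into (g ⬝ (x' ⬝ S_B(b)))ax, by `S_lact` and
the commutation of the two actions. -/
theorem tensorAction_leftW_symm (p : A ⊗[ℂ] G.Dual) (z : A ⊗[ℂ] A) :
    G.tensorAction G.lam (G.leftW.symm p) z = G.V (G.tensorAction G.lam p z) := by
  induction p with
  | zero => simp
  | add x y hx hy => simp only [map_add, LinearMap.add_apply, hx, hy]
  | tmul a b =>
    induction z with
    | zero => simp
    | add x y hx hy => simp only [map_add, hx, hy]
    | tmul x x' =>
      refine sliceR_separates (fun g : G.Dual => g.1) (fun m hm => G.eq_zero_of_dual hm) fun g => ?_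
      have h : ∀ w : A ⊗[ℂ] G.Dual, sliceR g.1 (G.tensorAction G.lam w (x ⊗ₜ x')) =
          sliceR (G.ev (G.S.symm (G.lact g x'))) w * x := by
        intro w
        induction w with
        | zero => simp
        | add x y hx hy => simp only [map_add, LinearMap.add_apply, add_mul, hx, hy]
        | tmul p q =>
          rw [tensorAction_tmul, sliceR_tmul, sliceR_tmul, ← mul_apply_ract, mul_apply_lact,
            SB_apply, smul_mul_assoc]
          rfl
      rw [h, sliceR_leftW_symm, tensorAction_tmul, ← lact_mul, S_lact, lact_ract, mul_assoc]

theorem actsAs_W_inv : G.ActsAs G.lam ↑G.W⁻¹ G.V.toLinearMap :=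
  ⟨G.span_tensorAction, fun p z => by
    rw [left_W_inv, tensorAction_leftW_symm]
    rfl⟩

theorem actsAs_W : G.ActsAs G.lam G.W G.V.symm.toLinearMap :=
  ⟨G.span_tensorAction, fun p z => by
    rw [left_W, LinearEquiv.coe_coe, LinearEquiv.symm_apply_eq, ← tensorAction_leftW_symm,
      LinearEquiv.symm_apply_apply]⟩

/-! ### The pairing of `M(A ⊗ B)` with `B ⊗ A` -/

include G in
theorem exists_mul_eq (c : A) : ∃ e, e * c = c := G.isAntipode.exists_mul_eq G.isCounit c

include G in
theorem exists_eq_mul (c : A) : ∃ u, c * u = c := by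
  obtain ⟨e, he⟩ := G.exists_mul_eq (star c)
  exact ⟨star e, by rw [← star_inj, star_mul, star_star, he]⟩

/-- If ω kills all f ⬝ a but not a, faithfulness gives (ω ⊗ ι)(Δ(a)(1 ⊗ d)) = 0, and applying ε
yields ω(a)ε(d) = 0 for all d. -/
theorem exists_lact_eq (a : A) : ∃ f, G.lact f a = a := by
  have := G.nontrivial
  by_contra hc
  obtain ⟨ω, hω, hω₀⟩ := Submodule.exists_dual_map_eq_bot_of_notMem
    (p := LinearMap.range (G.lact.flip a)) (x := a) (by simpa using hc) inferInstance
  have hω₁ : ∀ f, ω (G.lact f a) = 0 := fun f => by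
    have : ω (G.lact f a) ∈ Submodule.map ω (LinearMap.range (G.lact.flip a)) :=
      ⟨_, ⟨f, rfl⟩, rfl⟩
    simpa [hω₀] using this
  have h : ∀ d, sliceL ω (G.T₁ (a ⊗ₜ d)) = 0 := fun d => G.eq_zero_of_φ_mul fun d' => by
    rw [← LinearMap.mulRight_apply (R := ℂ), ← sliceL_lTensor, ← T₁_mul, apply_sliceL,
      ← apply_sliceR, ← lact_F, hω₁]
  obtain ⟨d, hd⟩ := DFunLike.ne_iff.mp G.isCounit.ne_zero
  have h₁ := congrArg G.ε (h d)
  rw [apply_sliceL, ← apply_sliceR, G.isCounit.sliceR_T₁, map_smul, map_zero, smul_eq_mul,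
    mul_eq_zero] at h₁
  exact h₁.elim hd hω

theorem exists_ract_eq (a : A) : ∃ f, G.ract f a = a := by
  have := G.nontrivial
  by_contra hc
  obtain ⟨ω, hω, hω₀⟩ := Submodule.exists_dual_map_eq_bot_of_notMem
    (p := LinearMap.range (G.ract.flip a)) (x := a) (by simpa using hc) inferInstance
  have hω₁ : ∀ f, ω (G.ract f a) = 0 := fun f => by
    have : ω (G.ract f a) ∈ Submodule.map ω (LinearMap.range (G.ract.flip a)) :=
      ⟨_, ⟨f, rfl⟩, rfl⟩
    simpa [hω₀] using this
  have h : ∀ c, sliceR ω (G.V (c ⊗ₜ a)) = 0 := fun c => G.eq_zero_of_φ_mul fun c' => by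
    rw [← LinearMap.mulRight_apply (R := ℂ), ← sliceR_rTensor, ← V_mul G.V_spec, apply_sliceR,
      ← apply_sliceL, ← ract_F, hω₁]
  obtain ⟨d, hd⟩ := DFunLike.ne_iff.mp G.isCounit.ne_zero
  have h₁ := congrArg G.ε (h d)
  rw [apply_sliceR, ← apply_sliceL, G.isCounit.sliceL_V G.V_spec, map_smul, map_zero, smul_eq_mul,
    mul_eq_zero] at h₁
  exact h₁.elim hd hω

/-- `e` covers `b`: `⟨a' e, b⟩ = ⟨a', b⟩` for all `a'`. -/
def CoversDual (b : G.Dual) (e : A) : Prop := ∀ a', b.1 (a' * e) = b.1 a'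

/-- `f` covers `a`: `⟨a, b' f⟩ = ⟨a, b'⟩` for all `b'`. -/
def Covers (a : A) (f : G.Dual) : Prop := ∀ b' : G.Dual, (b' * f).1 a = b'.1 a

theorem coversDual_F {c e : A} (h : e * c = c) : G.CoversDual (G.F c) e := fun a' => by
  simp [mul_assoc, h]

theorem covers_of_lact_eq {a : A} {f : G.Dual} (h : G.lact f a = a) : G.Covers a f := fun b' => by
  rw [mul_apply_lact, h]

theorem Covers.lact_eq {a : A} {f : G.Dual} (h : G.Covers a f) : G.lact f a = a :=
  G.eq_of_dual fun b => by rw [← mul_apply_lact, h]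

theorem exists_coversDual (b b' : G.Dual) : ∃ e, G.CoversDual b e ∧ G.CoversDual b' e := by
  obtain ⟨c, rfl⟩ := G.F.surjective b
  obtain ⟨c', rfl⟩ := G.F.surjective b'
  obtain ⟨e, he⟩ := G.exists_mul_eq c
  obtain ⟨e', he'⟩ := G.exists_mul_eq (c' - e * c')
  -- This is 1 - (1 - e')(1 - e): 1 - e kills c, and 1 - e' kills c' - ec'.
  refine ⟨e + e' - e' * e, G.coversDual_F ?_, G.coversDual_F ?_⟩
  · rw [sub_mul, add_mul, mul_assoc, he, add_sub_cancel_right]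
  · rw [mul_sub, ← mul_assoc] at he'
    rw [sub_mul, add_mul, add_sub_assoc, he', add_sub_cancel]

theorem exists_covers (a a' : A) : ∃ f, G.Covers a f ∧ G.Covers a' f := by
  obtain ⟨f, hf⟩ := G.exists_lact_eq a
  obtain ⟨f', hf'⟩ := G.exists_lact_eq (a' - G.lact f a')
  refine ⟨f + f' - f' * f, G.covers_of_lact_eq ?_, G.covers_of_lact_eq ?_⟩
  · rw [map_sub, map_add, LinearMap.sub_apply, LinearMap.add_apply, lact_lact, hf,
      add_sub_cancel_right]
  · rw [map_sub] at hf'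
    rw [map_sub, map_add, LinearMap.sub_apply, LinearMap.add_apply, lact_lact, add_sub_assoc, hf',
      add_sub_cancel]

theorem pairing_eq (b : G.Dual) (a : A) (z : A ⊗[ℂ] G.Dual) :
    G.pairing b a z = b.1 (sliceR (G.ev a) z) := by
  rw [apply_sliceR]
  rfl

/-- Given left covers `u` of `b` and `v` of `a`, the number `⟨m(e ⊗ f), b ⊗ a⟩` equals
`⟨(u ⊗ v)m, b ⊗ a⟩`. -/
theorem pairing_left_eq (m : Multiplier (A ⊗[ℂ] G.Dual)) {b : G.Dual} {a u e : A} {v f : G.Dual}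
    (hu : ∀ x, b.1 (u * x) = b.1 x) (hv : G.ract v a = a) (he : G.CoversDual b e)
    (hf : G.Covers a f) : G.pairing b a (m.left (e ⊗ₜ f)) = G.pairing b a (m.right (u ⊗ₜ v)) := by
  have h := m.balanced (u ⊗ₜ v) (e ⊗ₜ f)
  have h₁ := congrArg (G.pairing b a) h
  rw [pairing_eq, pairing_eq, sliceR_mul_tmul, sliceR_tmul_mul, he, hu, hv, hf.lact_eq] at h₁
  rw [pairing_eq, pairing_eq, h₁]

/-- Covers u, v from the other side rewrite both values as ⟨(u ⊗ v)m, b ⊗ a⟩, which involves neither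
e nor f. -/
theorem pairing_left_congr (m : Multiplier (A ⊗[ℂ] G.Dual)) {b : G.Dual} {a e e' : A}
    {f f' : G.Dual} (he : G.CoversDual b e) (he' : G.CoversDual b e') (hf : G.Covers a f)
    (hf' : G.Covers a f') :
    G.pairing b a (m.left (e ⊗ₜ f)) = G.pairing b a (m.left (e' ⊗ₜ f')) := by
  obtain ⟨c, rfl⟩ := G.Fl.surjective b
  obtain ⟨u, hu⟩ := G.exists_eq_mul c
  obtain ⟨v, hv⟩ := G.exists_ract_eq a
  have hu' : ∀ x, (G.Fl c).1 (u * x) = (G.Fl c).1 x := fun x => by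
    rw [Fl_apply, Fl_apply, ← mul_assoc, hu]
  rw [G.pairing_left_eq m hu' hv he hf, G.pairing_left_eq m hu' hv he' hf']

/-- The extended pairing of `m` with `b ⊗ a`. -/
def extPairing (m : Multiplier (A ⊗[ℂ] G.Dual)) (b : G.Dual) (a : A) : ℂ :=
  G.pairing b a (m.left ((G.exists_coversDual b b).choose ⊗ₜ (G.exists_covers a a).choose))

theorem extPairing_eq (m : Multiplier (A ⊗[ℂ] G.Dual)) {b : G.Dual} {a e : A}
    {f : G.Dual} (he : G.CoversDual b e) (hf : G.Covers a f) :
    G.extPairing m b a = G.pairing b a (m.left (e ⊗ₜ f)) :=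
  G.pairing_left_congr m (G.exists_coversDual b b).choose_spec.1 he
    (G.exists_covers a a).choose_spec.1 hf

theorem extPairing_add_left (m : Multiplier (A ⊗[ℂ] G.Dual)) (b b' : G.Dual) (a : A) :
    G.extPairing m (b + b') a = G.extPairing m b a + G.extPairing m b' a := by
  obtain ⟨e, he, he'⟩ := G.exists_coversDual b b'
  obtain ⟨f, hf, -⟩ := G.exists_covers a a
  have h : G.CoversDual (b + b') e := fun x => congrArg₂ (· + ·) (he x) (he' x)
  rw [G.extPairing_eq m h hf, G.extPairing_eq m he hf, G.extPairing_eq m he' hf]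
  simp only [pairing_eq]
  rfl

theorem extPairing_smul_left (m : Multiplier (A ⊗[ℂ] G.Dual)) (r : ℂ) (b : G.Dual) (a : A) :
    G.extPairing m (r • b) a = r • G.extPairing m b a := by
  obtain ⟨e, he, -⟩ := G.exists_coversDual b b
  obtain ⟨f, hf, -⟩ := G.exists_covers a a
  have h : G.CoversDual (r • b) e := fun x => congrArg (r * ·) (he x)
  rw [G.extPairing_eq m h hf, G.extPairing_eq m he hf]
  simp only [pairing_eq]
  rfl

theorem pairing_add_right (b : G.Dual) (a a' : A) (z : A ⊗[ℂ] G.Dual) :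
    G.pairing b (a + a') z = G.pairing b a z + G.pairing b a' z := by
  induction z with
  | zero => simp
  | add x y hx hy => simp only [map_add, hx, hy]; ring
  | tmul p q => simp [pairing, mul_add]

theorem pairing_smul_right (b : G.Dual) (r : ℂ) (a : A) (z : A ⊗[ℂ] G.Dual) :
    G.pairing b (r • a) z = r • G.pairing b a z := by
  induction z with
  | zero => simp
  | add x y hx hy => simp only [map_add, smul_add, hx, hy]
  | tmul p q => simp [pairing, mul_left_comm]

theorem extPairing_add_right (m : Multiplier (A ⊗[ℂ] G.Dual)) (b : G.Dual) (a a' : A) :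
    G.extPairing m b (a + a') = G.extPairing m b a + G.extPairing m b a' := by
  obtain ⟨e, he, -⟩ := G.exists_coversDual b b
  obtain ⟨f, hf, hf'⟩ := G.exists_covers a a'
  have h : G.Covers (a + a') f := fun b => by rw [map_add, map_add, hf, hf']
  rw [G.extPairing_eq m he h, G.extPairing_eq m he hf, G.extPairing_eq m he hf',
    pairing_add_right]

theorem extPairing_smul_right (m : Multiplier (A ⊗[ℂ] G.Dual)) (r : ℂ) (b : G.Dual) (a : A) :
    G.extPairing m b (r • a) = r • G.extPairing m b a := by
  obtain ⟨e, he, -⟩ := G.exists_coversDual b b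
  obtain ⟨f, hf, -⟩ := G.exists_covers a a
  have h : G.Covers (r • a) f := fun b => by rw [map_smul, map_smul, hf]
  rw [G.extPairing_eq m he h, G.extPairing_eq m he hf, pairing_smul_right]

/-- The extended pairing, as a linear map. -/
def P : Multiplier (A ⊗[ℂ] G.Dual) →ₗ[ℂ] Module.Dual ℂ (G.Dual ⊗[ℂ] A) where
  toFun m := TensorProduct.lift (LinearMap.mk₂ ℂ (G.extPairing m) (G.extPairing_add_left m)
    (G.extPairing_smul_left m) (G.extPairing_add_right m)
    (fun r b a => G.extPairing_smul_right m r b a))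
  -- The covers chosen in `extPairing` do not depend on the multiplier, so linearity in it is
  -- immediate.
  map_add' m n := TensorProduct.ext' fun b a => by
    simp only [TensorProduct.lift.tmul, LinearMap.mk₂_apply, LinearMap.add_apply, extPairing]
    rw [← map_add]
    rfl
  map_smul' r m := TensorProduct.ext' fun b a => by
    simp only [TensorProduct.lift.tmul, LinearMap.mk₂_apply, LinearMap.smul_apply, extPairing,
      RingHom.id_apply]
    rw [← map_smul]
    rfl

theorem P_tmul (m : Multiplier (A ⊗[ℂ] G.Dual)) (b : G.Dual) (a : A) :
    G.P m (b ⊗ₜ a) = G.extPairing m b a := by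
  simp [P]

theorem hasPairing_P (m : Multiplier (A ⊗[ℂ] G.Dual)) (b : G.Dual) (a : A) :
    G.HasPairing m b a (G.P m (b ⊗ₜ[ℂ] a)) :=
  ⟨(G.exists_coversDual b b).imp fun _ h => h.1, (G.exists_covers a a).imp fun _ h => h.1,
    fun e f he hf => by rw [P_tmul, G.extPairing_eq m he hf]⟩

theorem P_W (a : A) (b : G.Dual) : G.P G.W (b ⊗ₜ a) = b.1 a := by
  obtain ⟨e, he, -⟩ := G.exists_coversDual b b
  obtain ⟨f, hf, -⟩ := G.exists_covers a a
  rw [P_tmul, G.extPairing_eq _ he hf, pairing_eq, left_W, sliceR_leftW, hf.lact_eq, he]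

theorem P_W_inv (a : A) (b : G.Dual) : G.P ↑G.W⁻¹ (b ⊗ₜ a) = b.1 (G.S a) := by
  obtain ⟨e, he, -⟩ := G.exists_coversDual b b
  obtain ⟨f, hf, -⟩ := G.exists_covers a a
  rw [P_tmul, G.extPairing_eq _ he hf, pairing_eq, left_W_inv, sliceR_leftW_symm, hf.lact_eq, he]

theorem apply_S_eq (a : A) (b : G.Dual) : b.1 (G.S a) = (G.SB.symm b).1 a := by
  have := G.SB_apply (G.SB.symm b) (G.S a)
  simpa using this

end AlgebraicQuantumGroup

end

theorem proposition3p8 {A : Type*} [NonUnitalRing A] [StarRing A] [Module ℂ A]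
    [IsScalarTower ℂ A A] [SMulCommClass ℂ A A] [StarModule ℂ A] (G : AlgebraicQuantumGroup A) :
    ∃ (ε : Module.Dual ℂ A) (S : A ≃ₗ[ℂ] A)
      (HB : MultiplierHopfAlgebra G.Dual) (εB : Module.Dual ℂ G.Dual) (SB : G.Dual ≃ₗ[ℂ] G.Dual)
      (lam : G.Dual →ₗ[ℂ] Module.End ℂ A)
      (P : Multiplier (A ⊗[ℂ] G.Dual) →ₗ[ℂ] Module.Dual ℂ (G.Dual ⊗[ℂ] A)),
      G.IsCounit ε ∧ G.IsAntipode ε S ∧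
      G.IsOppositeDual HB ∧ HB.IsCounit εB ∧ HB.IsAntipode εB SB ∧
      G.IsConvolution S lam ∧
      (∀ m b a, G.HasPairing m b a (P m (b ⊗ₜ[ℂ] a))) ∧
      ∃ W : (Multiplier (A ⊗[ℂ] G.Dual))ˣ,
        G.ActsAs lam W G.V.symm.toLinearMap ∧
        G.ActsAs lam ↑W⁻¹ G.V.toLinearMap ∧
        ∀ (a : A) (b : G.Dual),
          P W (b ⊗ₜ[ℂ] a) = b.1 a ∧
          P ↑W⁻¹ (b ⊗ₜ[ℂ] a) = b.1 (S a) ∧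
          b.1 (S a) = (SB.symm b).1 a :=
  ⟨G.ε, G.S, G.dualHopf, G.εB, G.SB, G.lam, G.P, G.isCounit, G.isAntipode, G.isOppositeDual,
    G.dual_isCounit, G.dual_isAntipode, G.isConvolution, G.hasPairing_P, G.W, G.actsAs_W,
    G.actsAs_W_inv, fun a b => ⟨G.P_W a b, G.P_W_inv a b, G.apply_S_eq a b⟩⟩
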